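/- **Setting.** A vertex operator algebra (VOA) $V$ is over $\mathbf C$, with vacuum $\mathbf 1\ne 0$, Virasoro vector $\omega\neq 0$, modes $Y(v,z)=\sum_n v_{(n)}z^{-n-1}$, $L_n=\omega_{(n+1)}$ and central charge $c\in\mathbf C$. It is graded by the finite-dimensional $L_0$-eigenspaces $V_n$, $n\in\mathbf Z$, with $V_n=0$ for $n<0$ and $V_0=\mathbf C\mathbf 1$. We assume that $V$ is a direct sum of highest weight modules for the Virasoro algebra with highest weights in $\mathbf Z_{\ge0}$ (nonzero quotients of Verma modules $M(c,k)$). Let $\pi$ be the projection of $V$ onto the summand of highest weight $0$ (the Virasoro module $V_\omega$ generated by $\mathbf 1$) whose kernel is the sum of the summands of positive highest weight. A $V$-module $W$ is the direct sum of finite-dimensional $L_0$-eigenspaces $W_\mu$; it has conformal weight $h\in\mathbf C$ if $W=\bigoplus_{n\ge 0}W_{h+n}$ and $W_h\neq 0$. A homogeneous subspace $X$ of a $V$-module is a *conformal $t$-design* if $\mathrm{tr}|_X\,\mathrm o(v)=\mathrm{tr}|_X\,\mathrm o(\pi(v))$ for all $v\in V_n$, $0\le n\le t$, where $\mathrm o(v)=v_{(n-1)}$.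 Let $V$ be such a VOA and suppose that there are elements $\omega'$, $\omega-\omega'\in V_2$ generating two commuting Virasoro VOAs of central charge $e$ and $c-e$, respectively (the modes $\omega'_{(n+1)}$ and $(\omega-\omega')_{(n+1)}$ satisfy the Virasoro relations with central charge $e$ and $c-e$, and the modes of $\omega'$ commute with those of $\omega-\omega'$), with $$e,\ c-e\ \notin\ \{-\tfrac{46}{3},\,-\tfrac{68}{7},\,-\tfrac{22}{5},\,-\tfrac35,\,0\}.$$ Consider the two cases * (G) $e\neq\frac12$ and $c-e\ne\frac12$; * (H) $e=\frac12$ and the VOA generated by $\omega'$ is simple, or $e=c-\frac12$ and the VOA generated by $\omega-\omega'$ is simple. **Proposition 4.6.** Let $c\neq -31,\,-\frac{44}{5},\,-\frac{184}{105},\,\frac{6}{55},\,\frac{-47\pm5\sqrt{57}}{4},\,1$, and let $W$ be a $V$-module of conformal weight $h\neq0$ such that $W_h$ is a conformal $8$-design. In case (G), $$(c-24h+12)\bigl(10c^3+(141-615h)c^2+2(5740h^2-3321h+171)c-24(2870h^3-2870h^2+451h+15)\bigr)=0.$$ In case (H), $$\begin{aligned}&152700c^6+(3535420-2546820h)c^5+2(5519040h^2-33944388h+10007663)c^4\\&+(-66228480h^3+505357184h^2-303807330h+24963561)c^3\\&+(-2634772224h^3+409756928h^2+611923251h-162937170)c^2\\&+3(4450030592h^3-4570094080h^2+1282098891h-49633193)c\\&+18(120063488h^3-120063488h^2+34154597h-1236817)=0.\end{aligned}$$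 **Proposition 4.7.** Let $c\neq -31,\,-\frac{44}{5},\,-\frac{184}{105},\,\frac{6}{55},\,36,\,\frac{-47\pm5\sqrt{57}}{4},\,1$ and $20c^3-2178c^2+65956c-595056\neq0$. Suppose that $V_1=0$ and that $V_2$ is a conformal $8$-design, and let $d=\dim V_2$. In case (G), $$d=\frac{15c\,(155c^3+4133c^2+32074c+88392)}{20c^3-2178c^2+65956c-595056}.$$ In case (H), if also $260520c^5-7840184c^4-72048858c^3+5528559692c^2-75371626638c+17347413996\neq0$, then $$d=-\frac{15c\,(5734920c^5+59136716c^4+283246086c^3+2858841411c^2+7908127017c-2179288566)}{260520c^5-7840184c^4-72048858c^3+5528559692c^2-75371626638c+17347413996}.$$ -/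

import Mathlib

noncomputable section

namespace ConformalDesign

/-- The relations of the Virasoro algebra with the central element acting as the scalar `c`. -/
def VirasoroRelations {V : Type*} [AddCommGroup V] [Module ℂ V]
    (L : ℤ → Module.End ℂ V) (c : ℂ) : Prop :=
  ∀ m n : ℤ, L m * L n - L n * L m =
    ((m : ℂ) - n) • L (m + n) +
      (if m + n = 0 then ((m : ℂ) ^ 3 - m) / 12 * c else 0) • (1 : Module.End ℂ V)

/-- The Borcherds (Jacobi) identity in components, for a state-field correspondence `Y` on `V`
and an action `YW` of `V` on `W`. All sums are finite, as the fields are Laurent series. -/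
def BorcherdsIdentity {V W : Type*} [AddCommGroup V] [Module ℂ V] [AddCommGroup W] [Module ℂ W]
    (Y : V →ₗ[ℂ] VertexOperator ℂ V) (YW : V →ₗ[ℂ] VertexOperator ℂ W) : Prop :=
  ∀ (u v : V) (w : W) (l m n : ℤ),
    ∑ᶠ i : ℕ, ((Ring.choose m i : ℤ) : ℂ) •
        (YW ((Y u).ncoeff (l + i) v)).ncoeff (m + n - i) w =
      ∑ᶠ i : ℕ, ((-1 : ℂ) ^ i * ((Ring.choose l i : ℤ) : ℂ)) •
        ((YW u).ncoeff (m + l - i) ((YW v).ncoeff (n + i) w) -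
          (-1 : ℂ) ^ l • (YW v).ncoeff (n + l - i) ((YW u).ncoeff (m + i) w))

/-- Vertex operator algebras over `ℂ` with `V_n = 0` for `n < 0`, `V_0 = ℂ 1` and all `V_n`
finite-dimensional, where `V_n` is the eigenspace of `L_0` with eigenvalue `n`. The coefficient
`v_(n)` of `z ^ (-n-1)` in `Y(v,z)` is `(Y v).ncoeff n`, and `L_n = ω_(n+1)`.
(Eigenspaces are independent, so `iSup_homog` says that `V` is their direct sum.) -/
structure VertexOperatorAlgebra (V : Type*) [AddCommGroup V] [Module ℂ V] where
  Y : V →ₗ[ℂ] VertexOperator ℂ V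
  vac : V
  ω : V
  c : ℂ
  vac_ne_zero : vac ≠ 0
  ω_ne_zero : ω ≠ 0
  vac_mode : ∀ n : ℤ, (Y vac).ncoeff n = if n = -1 then 1 else 0
  mode_vac : ∀ v : V, (Y v).ncoeff (-1) vac = v
  mode_vac_of_nonneg : ∀ (v : V) (n : ℤ), 0 ≤ n → (Y v).ncoeff n vac = 0
  borcherds : BorcherdsIdentity Y Y
  virasoro : VirasoroRelations (fun n => (Y ω).ncoeff (n + 1)) c
  translation : ∀ (v : V) (n : ℤ),
    (Y ((Y ω).ncoeff 0 v)).ncoeff n = -(n : ℂ) • (Y v).ncoeff (n - 1)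
  iSup_homog : ⨆ n : ℤ, ((Y ω).ncoeff 1).eigenspace (n : ℂ) = ⊤
  homog_finite : ∀ n : ℤ, FiniteDimensional ℂ (((Y ω).ncoeff 1).eigenspace (n : ℂ))
  homog_neg : ∀ n : ℤ, n < 0 → ((Y ω).ncoeff 1).eigenspace (n : ℂ) = ⊥
  homog_zero : ((Y ω).ncoeff 1).eigenspace 0 = Submodule.span ℂ {vac}

namespace VertexOperatorAlgebra

variable {V : Type*} [AddCommGroup V] [Module ℂ V] (A : VertexOperatorAlgebra V)

/-- The mode `v_(n)`. -/
def mode (v : V) (n : ℤ) : Module.End ℂ V := (A.Y v).ncoeff n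

/-- The Virasoro operator `L_n = ω_(n+1)`. -/
def L (n : ℤ) : Module.End ℂ V := A.mode A.ω (n + 1)

/-- The degree `n` subspace `V_n`. -/
def homog (n : ℕ) : Submodule ℂ V := (A.L 0).eigenspace (n : ℂ)

/-- The subalgebra of `V` generated by a set: the smallest subspace which contains the set and
the vacuum and is closed under all products `u_(n) v`. -/
def generated (S : Set V) : Submodule ℂ V :=
  sInf {U | S ⊆ U ∧ A.vac ∈ U ∧ ∀ u ∈ U, ∀ v ∈ U, ∀ n : ℤ, A.mode u n v ∈ U}

/-- A subalgebra `U` is simple if it is irreducible as a module over itself. -/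
def IsSimpleSubalgebra (U : Submodule ℂ V) : Prop :=
  U ≠ ⊥ ∧ ∀ I : Submodule ℂ V, I ≤ U → (∀ u ∈ U, ∀ x ∈ I, ∀ n : ℤ, A.mode u n x ∈ I) →
    I = ⊥ ∨ I = U

/-- The Virasoro submodule of `V` generated by a vector. -/
def virasoroSpan (v : V) : Submodule ℂ V :=
  sInf {U | v ∈ U ∧ ∀ x ∈ U, ∀ n : ℤ, A.L n x ∈ U}

theorem L_mem_virasoroSpan (v x : V) (hx : x ∈ A.virasoroSpan v) (n : ℤ) :
    A.L n x ∈ A.virasoroSpan v := by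
  simp only [virasoroSpan, Submodule.mem_sInf, Set.mem_ofPred_eq] at hx ⊢
  exact fun U hU => hU.2 x (hx U hU) n

/-- Two vectors `w₁, w₂` of degree two generate commuting Virasoro vertex operator algebras of
central charges `c₁` and `c₂`. -/
structure IsCommutingVirasoroPair (w₁ w₂ : V) (c₁ c₂ : ℂ) : Prop where
  mem₁ : w₁ ∈ A.homog 2
  mem₂ : w₂ ∈ A.homog 2
  virasoro₁ : VirasoroRelations (fun n => A.mode w₁ (n + 1)) c₁
  virasoro₂ : VirasoroRelations (fun n => A.mode w₂ (n + 1)) c₂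
  comm : ∀ m n : ℤ, Commute (A.mode w₁ m) (A.mode w₂ n)

end VertexOperatorAlgebra

/-- A decomposition of `V` into a direct sum of highest weight modules for the Virasoro algebra
of highest weights in `ℤ_{≥0}`: the `i`-th summand is generated by the highest weight vector
`hwv i`, i.e. it is a nonzero quotient of the Verma module `M(c, weight i)`. -/
structure VirasoroDecomposition {V : Type*} [AddCommGroup V] [Module ℂ V]
    (A : VertexOperatorAlgebra V) (ι : Type*) [DecidableEq ι] where
  weight : ι → ℕ
  hwv : ι → V
  hwv_ne_zero : ∀ i, hwv i ≠ 0
  L_zero_hwv : ∀ i, A.L 0 (hwv i) = (weight i : ℂ) • hwv i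
  L_pos_hwv : ∀ i, ∀ n : ℤ, 0 < n → A.L n (hwv i) = 0
  isInternal : DirectSum.IsInternal fun i => A.virasoroSpan (hwv i)

namespace VirasoroDecomposition

variable {V : Type*} [AddCommGroup V] [Module ℂ V] {A : VertexOperatorAlgebra V}
  {ι : Type*} [DecidableEq ι] (D : VirasoroDecomposition A ι)

/-- The projection `π` of `V` onto the sum of the summands of highest weight `0` (which is the
Virasoro submodule `V_ω` generated by the vacuum, because `V_0 = ℂ 1`), whose kernel is the sum
of the summands of positive highest weight. -/
def proj : V →ₗ[ℂ] V :=
  DirectSum.toModule ℂ ι V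
      (fun i => if D.weight i = 0 then (A.virasoroSpan (D.hwv i)).subtype else 0) ∘ₗ
    (LinearEquiv.ofBijective
      (DirectSum.coeLinearMap fun i => A.virasoroSpan (D.hwv i)) D.isInternal).symm.toLinearMap

theorem proj_apply_of_mem (i : ι) (x : V) (hx : x ∈ A.virasoroSpan (D.hwv i)) :
    D.proj x = if D.weight i = 0 then x else 0 := by
  have h : (LinearEquiv.ofBijective
      (DirectSum.coeLinearMap fun i => A.virasoroSpan (D.hwv i)) D.isInternal).symm x =
      DirectSum.lof ℂ ι (fun i => A.virasoroSpan (D.hwv i)) i ⟨x, hx⟩ := by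
    rw [LinearEquiv.symm_apply_eq]
    exact (DirectSum.coeLinearMap_lof (fun i => A.virasoroSpan (D.hwv i)) i ⟨x, hx⟩).symm
  simp only [proj, LinearMap.comp_apply, LinearEquiv.coe_coe, h, DirectSum.toModule_lof]
  split_ifs <;> simp

theorem proj_L (n : ℤ) (x : V) : D.proj (A.L n x) = A.L n (D.proj x) := by
  have hx : x ∈ ⨆ i, A.virasoroSpan (D.hwv i) := by
    rw [D.isInternal.submodule_iSup_eq_top]; trivial
  induction hx using Submodule.iSup_induction' with
  | mem i y hy =>
    rw [D.proj_apply_of_mem i y hy, D.proj_apply_of_mem i _ (A.L_mem_virasoroSpan _ y hy n)]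
    split_ifs <;> simp
  | zero => simp
  | add y z _ _ h₁ h₂ => simp [h₁, h₂]

theorem proj_mem_homog {n : ℕ} {v : V} (hv : v ∈ A.homog n) : D.proj v ∈ A.homog n := by
  rw [VertexOperatorAlgebra.homog, Module.End.mem_eigenspace_iff] at hv ⊢
  rw [← D.proj_L, hv, map_smul]

end VirasoroDecomposition

/-- (Ordinary) modules of a vertex operator algebra: `W` is the direct sum of the
finite-dimensional eigenspaces of `L_0`, and in each coset of `ℤ` the eigenvalues are bounded
from below. -/
structure VOAModule {V : Type*} [AddCommGroup V] [Module ℂ V] (A : VertexOperatorAlgebra V)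
    (W : Type*) [AddCommGroup W] [Module ℂ W] where
  Y : V →ₗ[ℂ] VertexOperator ℂ W
  vac_mode : ∀ n : ℤ, (Y A.vac).ncoeff n = if n = -1 then 1 else 0
  borcherds : BorcherdsIdentity A.Y Y
  translation : ∀ (v : V) (n : ℤ),
    (Y (A.L (-1) v)).ncoeff n = -(n : ℂ) • (Y v).ncoeff (n - 1)
  iSup_homog : ⨆ μ : ℂ, ((Y A.ω).ncoeff 1).eigenspace μ = ⊤
  homog_finite : ∀ μ : ℂ, FiniteDimensional ℂ (((Y A.ω).ncoeff 1).eigenspace μ)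
  homog_bdd : ∀ μ : ℂ, ∃ N : ℤ, ∀ n : ℤ, n < N → ((Y A.ω).ncoeff 1).eigenspace (μ + n) = ⊥

namespace VertexOperatorAlgebra

variable {V : Type*} [AddCommGroup V] [Module ℂ V] (A : VertexOperatorAlgebra V)

theorem eigenspace_eq_bot (μ : ℂ) (hμ : ∀ n : ℤ, μ ≠ n) :
    ((A.Y A.ω).ncoeff 1).eigenspace μ = ⊥ := by
  have h := Module.End.eigenspaces_iSupIndep ((A.Y A.ω).ncoeff 1) μ
  have h' : (⨆ (j : ℂ) (_ : j ≠ μ), ((A.Y A.ω).ncoeff 1).eigenspace j) = ⊤ := by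
    rw [eq_top_iff, ← A.iSup_homog]
    exact iSup_le fun n => le_iSup₂_of_le (n : ℂ) (fun h => hμ n h.symm) le_rfl
  rw [h'] at h
  exact disjoint_top.mp h

/-- `V` as a module over itself. -/
def selfModule : VOAModule A V where
  Y := A.Y
  vac_mode := A.vac_mode
  borcherds := A.borcherds
  translation := A.translation
  iSup_homog := by
    rw [eq_top_iff, ← A.iSup_homog]
    exact iSup_le fun n => le_iSup (fun μ : ℂ => ((A.Y A.ω).ncoeff 1).eigenspace μ) (n : ℂ)
  homog_finite := fun μ => by
    by_cases h : ∃ n : ℤ, μ = n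
    · obtain ⟨n, rfl⟩ := h
      exact A.homog_finite n
    · rw [A.eigenspace_eq_bot μ fun n hn => h ⟨n, hn⟩]
      infer_instance
  homog_bdd := fun μ => by
    by_cases h : ∃ n : ℤ, μ = n
    · obtain ⟨m, rfl⟩ := h
      refine ⟨-m, fun n hn => ?_⟩
      have := A.homog_neg (m + n) (by omega)
      simpa using this
    · refine ⟨0, fun n _ => A.eigenspace_eq_bot _ fun k hk => h ⟨k - n, ?_⟩⟩
      push_cast
      rw [← hk]
      ring

end VertexOperatorAlgebra

namespace VOAModule

variable {V : Type*} [AddCommGroup V] [Module ℂ V] {A : VertexOperatorAlgebra V}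
  {W : Type*} [AddCommGroup W] [Module ℂ W] (M : VOAModule A W)

/-- The action of the mode `v_(n)` on the module. -/
def mode (v : V) (n : ℤ) : Module.End ℂ W := (M.Y v).ncoeff n

/-- The homogeneous subspace of degree `μ`: the eigenspace of `L_0 = ω_(1)` for `μ`. -/
def homog (μ : ℂ) : Submodule ℂ W := (M.mode A.ω 1).eigenspace μ

/-- The module has conformal weight `h`: it is `⨁_{n ≥ 0} W_{h+n}` with `W_h ≠ 0`. -/
def HasConformalWeight (h : ℂ) : Prop :=
  M.homog h ≠ ⊥ ∧ ∀ μ : ℂ, M.homog μ ≠ ⊥ → ∃ n : ℕ, μ = h + n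

theorem L_zero_commutator (v : V) (k : ℤ) (w : W) :
    M.mode A.ω 1 (M.mode v k w) - M.mode v k (M.mode A.ω 1 w) =
      M.mode (A.L 0 v) k w - ((k : ℂ) + 1) • M.mode v k w := by
  have h := M.borcherds A.ω v w 0 1 k
  rw [finsum_eq_sum_of_support_subset (s := Finset.range 2),
    finsum_eq_sum_of_support_subset (s := Finset.range 1)] at h
  · have ht := congrArg (fun f : Module.End ℂ W => f w) (M.translation v (1 + k))
    simp only [VertexOperatorAlgebra.L, VertexOperatorAlgebra.mode] at ht
    norm_num [Finset.sum_range_succ] at h ht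
    simp only [mode, VertexOperatorAlgebra.L, VertexOperatorAlgebra.mode, zero_add]
    rw [← h, ht]
    module
  · intro i hi
    by_contra hi'
    simp only [Finset.coe_range, Set.mem_Iio, not_lt] at hi'
    apply hi
    have : Ring.choose (0 : ℤ) i = 0 := by
      rw [← Nat.cast_zero, Ring.choose_natCast, Nat.choose_eq_zero_of_lt (by omega), Nat.cast_zero]
    simp [this]
  · intro i hi
    by_contra hi'
    simp only [Finset.coe_range, Set.mem_Iio, not_lt] at hi'
    apply hi
    have : Ring.choose (1 : ℤ) i = 0 := by
      rw [← Nat.cast_one, Ring.choose_natCast, Nat.choose_eq_zero_of_lt (by omega), Nat.cast_zero]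
    simp [this]

/-- For `v ∈ V_n` the operator `o(v) = v_(n-1)` preserves the homogeneous subspaces. -/
theorem zeroMode_mem (μ : ℂ) (n : ℕ) (v : V) (hv : v ∈ A.homog n) (x : W) (hx : x ∈ M.homog μ) :
    M.mode v ((n : ℤ) - 1) x ∈ M.homog μ := by
  rw [VertexOperatorAlgebra.homog, Module.End.mem_eigenspace_iff] at hv
  rw [homog, Module.End.mem_eigenspace_iff] at hx ⊢
  have h := M.L_zero_commutator v ((n : ℤ) - 1) x
  rw [hv, hx] at h
  simpa [mode, sub_eq_zero] using h

/-- The operator `o(v) = v_(n-1)` on the homogeneous subspace of degree `μ`, for `v ∈ V_n`. -/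
def zeroMode (μ : ℂ) (n : ℕ) (v : V) (hv : v ∈ A.homog n) : Module.End ℂ (M.homog μ) :=
  (M.mode v ((n : ℤ) - 1)).restrict (M.zeroMode_mem μ n v hv)

/-- The homogeneous subspace `X` of degree `μ` is a conformal `t`-design:
`tr|_X o(v) = tr|_X o(π(v))` for all `v ∈ V_n` with `0 ≤ n ≤ t`. -/
def IsConformalDesign {ι : Type*} [DecidableEq ι] (D : VirasoroDecomposition A ι)
    (t : ℕ) (μ : ℂ) : Prop :=
  ∀ n : ℕ, n ≤ t → ∀ (v : V) (hv : v ∈ A.homog n),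
    LinearMap.trace ℂ (M.homog μ) (M.zeroMode μ n v hv) =
      LinearMap.trace ℂ (M.homog μ) (M.zeroMode μ n (D.proj v) (D.proj_mem_homog hv))

end VOAModule

end ConformalDesign

end

noncomputable section

set_option linter.unusedSimpArgs false

namespace ConformalDesign

/-! ### Virasoro algebra on a vacuum vector: quasi-primary vectors of weights 2, 4, 6, 8 and their
pairings. -/

section Vacuum

variable {V : Type*} [AddCommGroup V] [Module ℂ V]

namespace VirasoroRelations

variable {L : ℤ → Module.End ℂ V} {c : ℂ} (hL : VirasoroRelations L c)
include hL

/-! The hypotheses are so strong that they leave only finitely many numerical possibilities: a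
lowest degree space that is an 8-design forces `c = 142/5` and `h = 11/5`, and in the case of `V_2`
either `c = 24`, `d = 196884` or `c = 142/5`, `d = -164081`. The displayed identities of both cases
then hold because they hold at these points. The second value of `d` cannot be a dimension, but it
satisfies the formulas as well, so it need not be excluded.

Let `w₁` be one of `ω'`, `ω - ω'`, of central charge `c₁ ≠ 1/2`; such a choice exists since `c ≠ 1`.
In weights 2, 4, 6, 8 there are quasi-primary vectors built from `w₁` and the vacuum by words of at
most two Virasoro modes. On vectors killed by the positive Virasoro modes of `w₁`, their zero modes
are polynomials of degree at most two in `w₁_(1)` (`ActsBy.mode_virasoro`). The four design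
equations for these vectors therefore involve only two unknown traces, `tr w₁_(1)` and `tr w₁_(1)²`.

The right-hand sides require `π(z)` for such a vector `z`. Since `π` commutes with the `L_n`, the
vector `π(z)` is quasi-primary in the vacuum module, hence a combination of the corresponding
vectors built from `ω`. The coefficients satisfy linear equations obtained by lowering to the vacuum
with words in the `L_n`: on `z` these agree with the modes of `w₁`, because `z` commutes with `ω -
w₁`, and so they produce the same polynomials at `c₁` instead of `c`. Comparing the determinants in
weight 8 shows in addition that `c` is not a zero of the determinant when `c₁` is not
(`det_pairingEight_ne_zero`).

On `V_2` with `V_1 = 0` the vectors killed by the positive modes form a hyperplane, and the zero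
mode differs from the polynomial by a rank one operator, whose trace is read off at `w₁` itself by
skew symmetry (`trace_zeroMode_two`).

Eliminating the two traces leaves two relations, of weights 6 and 8. They are quadratic in `e = c₁`
and hold trivially for `e = 0` and `e = c`, so after the factor `e (c - e)` is cancelled they
involve only `c` and `h`, or `c` and `d`. Two relations in two unknowns leave the points above. -/

theorem apply_apply (m n : ℤ) (x : V) :
    L m (L n x) = L n (L m x) + ((m : ℂ) - n) • L (m + n) x +
      (if m + n = 0 then ((m : ℂ) ^ 3 - m) / 12 * c else 0) • x := by
  have h := congrArg (fun f : Module.End ℂ V => f x) (hL m n)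
  simp only [LinearMap.sub_apply, Module.End.mul_apply, LinearMap.add_apply, LinearMap.smul_apply,
    Module.End.one_apply] at h
  rw [sub_eq_iff_eq_add] at h
  rw [h]
  abel

/-- The side condition `n < m` orients the commutator as a rewriting rule: larger modes move to the
right until they reach the vacuum. The integer cast lets `simp` evaluate the structure constant.
`apply_neg` is the companion rule for the central term. -/
theorem apply_apply_of_lt {m n : ℤ} (_ : n < m) (h0 : m + n ≠ 0) (x : V) :
    L m (L n x) = L n (L m x) + ((m - n : ℤ) : ℂ) • L (m + n) x := by
  rw [hL.apply_apply, if_neg h0, zero_smul, add_zero, Int.cast_sub]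

theorem apply_neg {m : ℤ} (_ : 0 < m) (x : V) :
    L m (L (-m) x) = L (-m) (L m x) + ((2 * m : ℤ) : ℂ) • L 0 x +
      (((m : ℂ) ^ 3 - m) / 12 * c) • x := by
  rw [hL.apply_apply, if_pos (by ring), add_neg_cancel]
  push_cast
  congr 3
  ring

end VirasoroRelations

/-- A vector of weight 2 annihilated by `L 1`, in terms of the vacuum `v`. -/
def quasiprimaryTwo (L : ℤ → Module.End ℂ V) (v : V) : V :=
  L (-2) v

/-- A vector of weight 4 annihilated by `L 1`, in terms of the vacuum `v`. -/
def quasiprimaryFour (L : ℤ → Module.End ℂ V) (v : V) : V :=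
  (-3 / 5 : ℂ) • L (-4) v + L (-2) (L (-2) v)

/-- A vector of weight 6 annihilated by `L 1`, in terms of the vacuum `v`. -/
def quasiprimarySixA (L : ℤ → Module.End ℂ V) (v : V) : V :=
  (-4 / 7 : ℂ) • L (-6) v + (-8 / 5 : ℂ) • L (-4) (L (-2) v) + L (-3) (L (-3) v)

/-- A vector of weight 6 annihilated by `L 1`, in terms of the vacuum `v`. -/
def quasiprimarySixB (L : ℤ → Module.End ℂ V) (v : V) : V :=
  (-6 / 7 : ℂ) • L (-6) v + (-9 / 5 : ℂ) • L (-4) (L (-2) v) + L (-2) (L (-2) (L (-2) v))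

/-- A vector of weight 8 annihilated by `L 1`, in terms of the vacuum `v`. -/
def quasiprimaryEightA (L : ℤ → Module.End ℂ V) (v : V) : V :=
  (-5 / 9 : ℂ) • L (-8) v + (20 / 21 : ℂ) • L (-6) (L (-2) v) + (-5 / 3 : ℂ) • L (-5) (L (-3) v) + L (-4) (L (-4) v)

/-- A vector of weight 8 annihilated by `L 1`, in terms of the vacuum `v`. -/
def quasiprimaryEightB (L : ℤ → Module.End ℂ V) (v : V) : V :=
  (-36 / 35 : ℂ) • L (-6) (L (-2) v) + (4 / 5 : ℂ) • L (-5) (L (-3) v) + (-8 / 5 : ℂ) • L (-4) (L (-2) (L (-2) v)) + L (-3) (L (-3) (L (-2) v))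

/-- A vector of weight 8 annihilated by `L 1`, in terms of the vacuum `v`. -/
def quasiprimaryEightC (L : ℤ → Module.End ℂ V) (v : V) : V :=
  (-3 : ℂ) • L (-8) v + (-156 / 35 : ℂ) • L (-6) (L (-2) v) + (9 / 5 : ℂ) • L (-5) (L (-3) v) + (-18 / 5 : ℂ) • L (-4) (L (-2) (L (-2) v)) + L (-2) (L (-2) (L (-2) (L (-2) v)))

namespace VirasoroRelations

variable {L : ℤ → Module.End ℂ V} {c : ℂ} (hL : VirasoroRelations L c) {v : V}
  (hv : ∀ n : ℤ, -1 ≤ n → L n v = 0)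
include hL hv

/-- The coefficients of these vectors solve `L_1 x = 0` in the basis of ordered words without
`L_(-1)`. The solution spaces have dimensions 1, 1, 2, 3 in weights 2, 4, 6, 8. The bases are
normalized on the words `L_(-3)²`, `L_(-2)³` in weight 6 and `L_(-4)²`, `L_(-3)² L_(-2)`, `L_(-2)⁴`
in weight 8, so the `A` vectors contain no word of length three or more. -/
theorem L_one_quasiprimaryTwo : L 1 (quasiprimaryTwo L v) = 0 := by
  simp [quasiprimaryTwo, hL.apply_apply_of_lt, hL.apply_neg, hv, smul_smul]

theorem L_zero_quasiprimaryTwo : L 0 (quasiprimaryTwo L v) = (2 : ℂ) • quasiprimaryTwo L v := by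
  simp [quasiprimaryTwo, hL.apply_apply_of_lt, hL.apply_neg, hv, smul_smul]

theorem L_one_quasiprimaryFour : L 1 (quasiprimaryFour L v) = 0 := by
  simp [quasiprimaryFour, hL.apply_apply_of_lt, hL.apply_neg, hv, smul_smul]

theorem L_zero_quasiprimaryFour : L 0 (quasiprimaryFour L v) = (4 : ℂ) • quasiprimaryFour L v := by
  simp [quasiprimaryFour, hL.apply_apply_of_lt, hL.apply_neg, hv, smul_smul]
  module

theorem L_one_quasiprimarySixA : L 1 (quasiprimarySixA L v) = 0 := by
  simp [quasiprimarySixA, hL.apply_apply_of_lt, hL.apply_neg, hv, smul_smul]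
  module

theorem L_zero_quasiprimarySixA : L 0 (quasiprimarySixA L v) = (6 : ℂ) • quasiprimarySixA L v := by
  simp [quasiprimarySixA, hL.apply_apply_of_lt, hL.apply_neg, hv, smul_smul]
  module

theorem L_one_quasiprimarySixB : L 1 (quasiprimarySixB L v) = 0 := by
  simp [quasiprimarySixB, hL.apply_apply_of_lt, hL.apply_neg, hv, smul_smul]
  module

theorem L_one_quasiprimaryEightA : L 1 (quasiprimaryEightA L v) = 0 := by
  simp [quasiprimaryEightA, hL.apply_apply_of_lt, hL.apply_neg, hv, smul_smul]
  module

theorem L_zero_quasiprimaryEightA : L 0 (quasiprimaryEightA L v) = (8 : ℂ) • quasiprimaryEightA L v := by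
  simp [quasiprimaryEightA, hL.apply_apply_of_lt, hL.apply_neg, hv, smul_smul]
  module

theorem L_one_quasiprimaryEightB : L 1 (quasiprimaryEightB L v) = 0 := by
  simp [quasiprimaryEightB, hL.apply_apply_of_lt, hL.apply_neg, hv, smul_smul]
  module

theorem L_zero_quasiprimaryEightB : L 0 (quasiprimaryEightB L v) = (8 : ℂ) • quasiprimaryEightB L v := by
  simp [quasiprimaryEightB, hL.apply_apply_of_lt, hL.apply_neg, hv, smul_smul]
  module

theorem L_one_quasiprimaryEightC : L 1 (quasiprimaryEightC L v) = 0 := by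
  simp [quasiprimaryEightC, hL.apply_apply_of_lt, hL.apply_neg, hv, smul_smul]
  module

theorem L_zero_quasiprimaryEightC : L 0 (quasiprimaryEightC L v) = (8 : ℂ) • quasiprimaryEightC L v := by
  simp [quasiprimaryEightC, hL.apply_apply_of_lt, hL.apply_neg, hv, smul_smul]
  module

/-- In each weight there are as many lowering words as quasi-primary vectors, so that the pairings
form a square matrix. From weight 4 on, the first word is `L_2 L_(n-2)`, which also occurs in the
trace over `V_2`. -/
theorem L_2_quasiprimaryTwo :
    L 2 (quasiprimaryTwo L v) =
      ((1 / 2) * c) • v := by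
  simp [quasiprimaryTwo, hL.apply_apply_of_lt, hL.apply_neg, hv, smul_smul]
  match_scalars
  ring

/-- The case `n = 2` of the word `L_2 L_(n-2)` needed for the trace over `V_2`. -/
theorem L_2_0_quasiprimaryTwo :
    L 2 (L 0 (quasiprimaryTwo L v)) =
      (c) • v := by
  simp [quasiprimaryTwo, hL.apply_apply_of_lt, hL.apply_neg, hv, smul_smul]
  match_scalars
  ring

theorem L_2_2_quasiprimaryFour :
    L 2 (L 2 (quasiprimaryFour L v)) =
      ((1 / 2) * c ^ 2 + (11 / 5) * c) • v := by
  simp [quasiprimaryFour, hL.apply_apply_of_lt, hL.apply_neg, hv, smul_smul]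
  match_scalars
  ring

theorem L_2_4_quasiprimarySixA :
    L 2 (L 4 (quasiprimarySixA L v)) =
      ((-4) * c ^ 2 + (-58 / 35) * c) • v := by
  simp [quasiprimarySixA, hL.apply_apply_of_lt, hL.apply_neg, hv, smul_smul]
  match_scalars
  ring

theorem L_2_4_quasiprimarySixB :
    L 2 (L 4 (quasiprimarySixB L v)) =
      ((186 / 35) * c) • v := by
  simp [quasiprimarySixB, hL.apply_apply_of_lt, hL.apply_neg, hv, smul_smul]
  match_scalars
  ring

theorem L_2_2_2_quasiprimarySixA :
    L 2 (L 2 (L 2 (quasiprimarySixA L v))) =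
      ((-36 / 5) * c ^ 2 + (-774 / 35) * c) • v := by
  simp [quasiprimarySixA, hL.apply_apply_of_lt, hL.apply_neg, hv, smul_smul]
  match_scalars
  ring

theorem L_2_2_2_quasiprimarySixB :
    L 2 (L 2 (L 2 (quasiprimarySixB L v))) =
      ((3 / 4) * c ^ 3 + (99 / 10) * c ^ 2 + (1128 / 35) * c) • v := by
  simp [quasiprimarySixB, hL.apply_apply_of_lt, hL.apply_neg, hv, smul_smul]
  match_scalars
  ring

theorem L_2_6_quasiprimaryEightA :
    L 2 (L 6 (quasiprimaryEightA L v)) =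
      ((25 / 3) * c ^ 2 + (55 / 63) * c) • v := by
  simp [quasiprimaryEightA, hL.apply_apply_of_lt, hL.apply_neg, hv, smul_smul]
  match_scalars
  ring

theorem L_2_6_quasiprimaryEightB :
    L 2 (L 6 (quasiprimaryEightB L v)) =
      ((-8) * c ^ 2 + (-166 / 35) * c) • v := by
  simp [quasiprimaryEightB, hL.apply_apply_of_lt, hL.apply_neg, hv, smul_smul]
  match_scalars
  ring

theorem L_2_6_quasiprimaryEightC :
    L 2 (L 6 (quasiprimaryEightC L v)) =
      ((-9) * c ^ 2 + (459 / 35) * c) • v := by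
  simp [quasiprimaryEightC, hL.apply_apply_of_lt, hL.apply_neg, hv, smul_smul]
  match_scalars
  ring

theorem L_2_2_4_quasiprimaryEightA :
    L 2 (L 2 (L 4 (quasiprimaryEightA L v))) =
      ((730 / 21) * c ^ 2 + (506 / 21) * c) • v := by
  simp [quasiprimaryEightA, hL.apply_apply_of_lt, hL.apply_neg, hv, smul_smul]
  match_scalars
  ring

theorem L_2_2_4_quasiprimaryEightB :
    L 2 (L 2 (L 4 (quasiprimaryEightB L v))) =
      ((-4) * c ^ 3 + (-442 / 7) * c ^ 2 + (-3176 / 35) * c) • v := by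
  simp [quasiprimaryEightB, hL.apply_apply_of_lt, hL.apply_neg, hv, smul_smul]
  match_scalars
  ring

theorem L_2_2_4_quasiprimaryEightC :
    L 2 (L 2 (L 4 (quasiprimaryEightC L v))) =
      ((-114 / 7) * c ^ 2 + (4134 / 35) * c) • v := by
  simp [quasiprimaryEightC, hL.apply_apply_of_lt, hL.apply_neg, hv, smul_smul]
  match_scalars
  ring

theorem L_2_2_2_2_quasiprimaryEightA :
    L 2 (L 2 (L 2 (L 2 (quasiprimaryEightA L v)))) =
      ((698 / 7) * c ^ 2 + (5786 / 21) * c) • v := by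
  simp [quasiprimaryEightA, hL.apply_apply_of_lt, hL.apply_neg, hv, smul_smul]
  match_scalars
  ring

theorem L_2_2_2_2_quasiprimaryEightB :
    L 2 (L 2 (L 2 (L 2 (quasiprimaryEightB L v)))) =
      ((-72 / 5) * c ^ 3 + (-9036 / 35) * c ^ 2 + (-5028 / 7) * c) • v := by
  simp [quasiprimaryEightB, hL.apply_apply_of_lt, hL.apply_neg, hv, smul_smul]
  match_scalars
  ring

theorem L_2_2_2_2_quasiprimaryEightC :
    L 2 (L 2 (L 2 (L 2 (quasiprimaryEightC L v)))) =
      ((3 / 2) * c ^ 4 + (198 / 5) * c ^ 3 + (8304 / 35) * c ^ 2 + (4518 / 7) * c) • v := by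
  simp [quasiprimaryEightC, hL.apply_apply_of_lt, hL.apply_neg, hv, smul_smul]
  match_scalars
  ring

/-- The digits name the word. The words in `L_(-1)` and `L_(-2)` that start with `L_(-2)` are
quasi-primary up to the image of `L_(-1)`; words starting with `L_(-1)` lie in that image anyway.
The witnesses come from solving a linear system in the ordered words. -/
theorem word_2 : ∃ (α : ℂ) (y : V), L 0 y = (1 : ℂ) • y ∧
    L (-2) v =
      α • quasiprimaryTwo L v + L (-1) y := by
  refine ⟨1, 0, ?_, ?_⟩ <;>
  simp [quasiprimaryTwo, hL.apply_apply_of_lt, hL.apply_neg, hv, smul_smul]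

theorem word_2_2 : ∃ (α : ℂ) (y : V), L 0 y = (3 : ℂ) • y ∧
    L (-2) (L (-2) v) =
      α • quasiprimaryFour L v + L (-1) y := by
  refine ⟨1, (3 / 10 : ℂ) • L (-3) v, ?_, ?_⟩ <;>
  simp [quasiprimaryFour, hL.apply_apply_of_lt, hL.apply_neg, hv, smul_smul] <;>
  module

theorem word_2_2_2 : ∃ (α β : ℂ) (y : V), L 0 y = (5 : ℂ) • y ∧
    L (-2) (L (-2) (L (-2) v)) =
      α • quasiprimarySixA L v + β • quasiprimarySixB L v + L (-1) y := by
  refine ⟨-1 / 2, 1, (1 / 7 : ℂ) • L (-5) v + (1 / 2 : ℂ) • L (-3) (L (-2) v), ?_, ?_⟩ <;>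
  simp [quasiprimarySixA, quasiprimarySixB, hL.apply_apply_of_lt, hL.apply_neg, hv, smul_smul] <;>
  module

theorem word_2_1_1_2 : ∃ (α β : ℂ) (y : V), L 0 y = (5 : ℂ) • y ∧
    L (-2) (L (-1) (L (-1) (L (-2) v))) =
      α • quasiprimarySixA L v + β • quasiprimarySixB L v + L (-1) y := by
  refine ⟨-5 / 9, 0, (58 / 63 : ℂ) • L (-5) v + (5 / 9 : ℂ) • L (-3) (L (-2) v), ?_, ?_⟩ <;>
  simp [quasiprimarySixA, quasiprimarySixB, hL.apply_apply_of_lt, hL.apply_neg, hv, smul_smul] <;>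
  module

theorem word_2_2_2_2 : ∃ (α β γ : ℂ) (y : V), L 0 y = (7 : ℂ) • y ∧
    L (-2) (L (-2) (L (-2) (L (-2) v))) =
      α • quasiprimaryEightA L v + β • quasiprimaryEightB L v + γ • quasiprimaryEightC L v + L (-1) y := by
  refine ⟨90 / 143, -18 / 13, 1, (281 / 858 : ℂ) • L (-7) v + (87 / 143 : ℂ) • L (-5) (L (-2) v) + (-45 / 143 : ℂ) • L (-4) (L (-3) v) + (9 / 13 : ℂ) • L (-3) (L (-2) (L (-2) v)), ?_, ?_⟩ <;>
  simp [quasiprimaryEightA, quasiprimaryEightB, quasiprimaryEightC, hL.apply_apply_of_lt, hL.apply_neg, hv, smul_smul] <;>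
  module

theorem word_2_2_1_1_2 : ∃ (α β γ : ℂ) (y : V), L 0 y = (7 : ℂ) • y ∧
    L (-2) (L (-2) (L (-1) (L (-1) (L (-2) v)))) =
      α • quasiprimaryEightA L v + β • quasiprimaryEightB L v + γ • quasiprimaryEightC L v + L (-1) y := by
  refine ⟨6 / 13, -10 / 13, 0, (302 / 117 : ℂ) • L (-7) v + (22 / 13 : ℂ) • L (-5) (L (-2) v) + (-3 / 13 : ℂ) • L (-4) (L (-3) v) + (5 / 13 : ℂ) • L (-3) (L (-2) (L (-2) v)), ?_, ?_⟩ <;>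
  simp [quasiprimaryEightA, quasiprimaryEightB, quasiprimaryEightC, hL.apply_apply_of_lt, hL.apply_neg, hv, smul_smul] <;>
  module

theorem word_2_1_2_1_2 : ∃ (α β γ : ℂ) (y : V), L 0 y = (7 : ℂ) • y ∧
    L (-2) (L (-1) (L (-2) (L (-1) (L (-2) v)))) =
      α • quasiprimaryEightA L v + β • quasiprimaryEightB L v + γ • quasiprimaryEightC L v + L (-1) y := by
  refine ⟨12 / 143, -5 / 13, 0, (3574 / 1287 : ℂ) • L (-7) v + (269 / 143 : ℂ) • L (-5) (L (-2) v) + (-6 / 143 : ℂ) • L (-4) (L (-3) v) + (9 / 13 : ℂ) • L (-3) (L (-2) (L (-2) v)), ?_, ?_⟩ <;>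
  simp [quasiprimaryEightA, quasiprimaryEightB, quasiprimaryEightC, hL.apply_apply_of_lt, hL.apply_neg, hv, smul_smul] <;>
  module

theorem word_2_1_1_2_2 : ∃ (α β γ : ℂ) (y : V), L 0 y = (7 : ℂ) • y ∧
    L (-2) (L (-1) (L (-1) (L (-2) (L (-2) v)))) =
      α • quasiprimaryEightA L v + β • quasiprimaryEightB L v + γ • quasiprimaryEightC L v + L (-1) y := by
  refine ⟨-18 / 143, -10 / 13, 0, (409 / 143 : ℂ) • L (-7) v + (405 / 143 : ℂ) • L (-5) (L (-2) v) + (9 / 143 : ℂ) • L (-4) (L (-3) v) + (18 / 13 : ℂ) • L (-3) (L (-2) (L (-2) v)), ?_, ?_⟩ <;>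
  simp [quasiprimaryEightA, quasiprimaryEightB, quasiprimaryEightC, hL.apply_apply_of_lt, hL.apply_neg, hv, smul_smul] <;>
  module

theorem word_2_1_1_1_1_2 : ∃ (α β γ : ℂ) (y : V), L 0 y = (7 : ℂ) • y ∧
    L (-2) (L (-1) (L (-1) (L (-1) (L (-1) (L (-2) v))))) =
      α • quasiprimaryEightA L v + β • quasiprimaryEightB L v + γ • quasiprimaryEightC L v + L (-1) y := by
  refine ⟨252 / 143, 0, 0, (6934 / 429 : ℂ) • L (-7) v + (798 / 143 : ℂ) • L (-5) (L (-2) v) + (-126 / 143 : ℂ) • L (-4) (L (-3) v), ?_, ?_⟩ <;>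
  simp [quasiprimaryEightA, quasiprimaryEightB, quasiprimaryEightC, hL.apply_apply_of_lt, hL.apply_neg, hv, smul_smul] <;>
  module

end VirasoroRelations

end Vacuum

/-! ### Consequences of the Borcherds identity: commutators, iterates, degrees, skew symmetry. -/

namespace VOAModule

variable {V : Type*} [AddCommGroup V] [Module ℂ V] {A : VertexOperatorAlgebra V}
  {W : Type*} [AddCommGroup W] [Module ℂ W] (M : VOAModule A W)

theorem commutator (u v : V) (w : W) (m n : ℤ) :
    ∑ᶠ i : ℕ, ((Ring.choose m i : ℤ) : ℂ) • M.mode (A.mode u i v) (m + n - i) w =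
      M.mode u m (M.mode v n w) - M.mode v n (M.mode u m w) := by
  have h := M.borcherds u v w 0 m n
  rw [finsum_eq_single (fun i : ℕ => ((-1 : ℂ) ^ i * _) • _) 0
    fun i hi => by simp [Ring.choose_zero_pos ℤ (Nat.pos_of_ne_zero hi)]] at h
  simpa [mode, VertexOperatorAlgebra.mode] using h

theorem mode_zero_commutator (u v : V) (w : W) (n : ℤ) :
    M.mode (A.mode u 0 v) n w = M.mode u 0 (M.mode v n w) - M.mode v n (M.mode u 0 w) := by
  rw [← M.commutator u v w 0 n, finsum_eq_single _ 0 fun i hi => by simp [Ring.choose_zero_pos ℤ (Nat.pos_of_ne_zero hi)]]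
  simp

theorem mode_one_commutator (u v : V) (w : W) (n : ℤ) :
    M.mode (A.mode u 0 v) (1 + n) w + M.mode (A.mode u 1 v) n w =
      M.mode u 1 (M.mode v n w) - M.mode v n (M.mode u 1 w) := by
  rw [← M.commutator u v w 1 n, finsum_eq_sum_of_support_subset (s := Finset.range 2)]
  · simp [Finset.sum_range_succ]
  · intro i hi
    by_contra hi'
    simp only [Finset.coe_range, Set.mem_Iio, not_lt] at hi'
    apply hi
    have : Ring.choose (1 : ℤ) i = 0 := by
      rw [← Nat.cast_one, Ring.choose_natCast, Nat.choose_eq_zero_of_lt (by omega), Nat.cast_zero]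
    simp [this]

theorem mode_iterate (u v : V) (w : W) (l n : ℤ) :
    M.mode (A.mode u l v) n w = ∑ᶠ i : ℕ, ((-1 : ℂ) ^ i * ((Ring.choose l i : ℤ) : ℂ)) •
        (M.mode u (l - i) (M.mode v (n + i) w) -
          (-1 : ℂ) ^ l • M.mode v (n + l - i) (M.mode u i w)) := by
  have h := M.borcherds u v w l 0 n
  rw [finsum_eq_single (fun i : ℕ => ((Ring.choose (0 : ℤ) i : ℤ) : ℂ) • _) 0
    fun i hi => by simp [Ring.choose_zero_pos ℤ (Nat.pos_of_ne_zero hi)]] at h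
  simpa [mode, VertexOperatorAlgebra.mode] using h

/-- The modes of `u_(l) v` on a vector that is annihilated by `u_(i)` for `i ≥ 2` and by the modes
of `v` with large index. -/
theorem mode_iterate_of_annihilate {u v : V} {w : W} {l n : ℤ}
    (hu : ∀ i : ℤ, 2 ≤ i → M.mode u i w = 0) (hv : ∀ i : ℤ, n ≤ i → M.mode v i w = 0) :
    M.mode (A.mode u l v) n w = (-1 : ℂ) ^ (l + 1) •
      (M.mode v (n + l) (M.mode u 0 w) - (l : ℂ) • M.mode v (n + l - 1) (M.mode u 1 w)) := by
  -- The terms in which `v` acts first vanish by `hv`, those in which `u` acts first vanish for `i ≥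
  -- 2` by `hu`; only `i = 0, 1` remain.
  rw [mode_iterate, finsum_eq_sum_of_support_subset (s := Finset.range 2)]
  · rw [Finset.sum_range_succ, Finset.sum_range_one, hv _ (by simp), hv _ (by simp)]
    simp only [map_zero, zero_sub, Nat.cast_zero, sub_zero, Nat.cast_one, Ring.choose_zero_right,
      Ring.choose_one_right, pow_zero, pow_one, Int.cast_one, zpow_add₀ (by norm_num : (-1 : ℂ) ≠ 0),
      zpow_one]
    module
  · intro i hi
    by_contra hi'
    simp only [Finset.coe_range, Set.mem_Iio, not_lt] at hi'
    apply hi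
    simp only [hv (n + i) (by omega), hu i (by omega), map_zero, smul_zero, sub_zero]

/-- Modes shift the degree. -/
theorem mode_mem_homog {μ k : ℂ} {v : V} (hv : A.L 0 v = k • v) (n : ℤ) {x : W}
    (hx : x ∈ M.homog μ) : M.mode v n x ∈ M.homog (μ + k - n - 1) := by
  rw [homog, Module.End.mem_eigenspace_iff] at hx ⊢
  have h := M.L_zero_commutator v n x
  rw [hv, hx, map_smul] at h
  have h' : M.mode (k • v) n x = k • M.mode v n x := by simp [mode]
  rw [h', sub_eq_iff_eq_add] at h
  rw [h]
  module

end VOAModule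

namespace VertexOperatorAlgebra

variable {V : Type*} [AddCommGroup V] [Module ℂ V] (A : VertexOperatorAlgebra V)

/-- The subspace `V_n` for an arbitrary integer `n`. -/
def degree (n : ℤ) : Submodule ℂ V := (A.L 0).eigenspace (n : ℂ)

theorem mem_degree {n : ℤ} {v : V} : v ∈ A.degree n ↔ A.L 0 v = (n : ℂ) • v :=
  Module.End.mem_eigenspace_iff

theorem homog_eq_degree (n : ℕ) : A.homog n = A.degree n := by
  simp [homog, degree]

theorem degree_neg {n : ℤ} (hn : n < 0) : A.degree n = ⊥ := A.homog_neg n hn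

theorem eq_zero_of_mem_degree_neg {n : ℤ} (hn : n < 0) {v : V} (hv : v ∈ A.degree n) : v = 0 := by
  rwa [A.degree_neg hn, Submodule.mem_bot] at hv

theorem degree_zero : A.degree 0 = Submodule.span ℂ {A.vac} := by
  rw [← A.homog_zero, degree, Int.cast_zero]
  rfl

theorem mode_mem_degree {k m n : ℤ} {v x : V} (hv : v ∈ A.degree k) (hx : x ∈ A.degree m) :
    A.mode v n x ∈ A.degree (m + k - n - 1) := by
  have h := A.selfModule.mode_mem_homog (μ := m) (A.mem_degree.1 hv) n (x := x) hx
  have : A.degree (m + k - n - 1) = A.selfModule.homog ((m : ℂ) + k - n - 1) := by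
    rw [degree]
    push_cast
    rfl
  rwa [this]

theorem vac_mem_degree : A.vac ∈ A.degree 0 := by
  rw [degree_zero]
  exact Submodule.mem_span_singleton_self _

/-- Skew symmetry in the case that `u_(i) v` is a multiple of the vacuum for `i > n`. -/
theorem mode_skew {u v : V} (n : ℕ)
    (h : ∀ i : ℕ, n < i → A.mode u i v ∈ Submodule.span ℂ {A.vac}) :
    A.mode v n u = (-1 : ℂ) ^ (n + 1) • A.mode u n v := by
  have h1 := A.selfModule.commutator u v A.vac (-1) n
  have hz : A.mode v n A.vac = 0 := A.mode_vac_of_nonneg v n (by simp)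
  have hu : A.mode u (-1) A.vac = u := A.mode_vac u
  have e1 : ∀ (x : V) (k : ℤ), A.selfModule.mode x k = A.mode x k := fun _ _ => rfl
  simp only [e1, hz, hu, map_zero, zero_sub] at h1
  -- The commutator of `u_(-1)` and `v_(n)` on the vacuum: terms with `i < n` are nonnegative modes
  -- on the vacuum, terms with `i > n` are modes of a multiple of the vacuum other than the one of
  -- index `-1`.
  rw [finsum_eq_single _ n] at h1
  · rw [show (-1 : ℤ) + n - n = -1 by ring, show A.mode (A.mode u n v) (-1) A.vac = A.mode u n v from
      A.mode_vac _, Ring.choose_neg',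
      Ring.multichoose_one] at h1
    rw [← neg_neg (A.mode v n u), ← h1, Units.smul_def, smul_eq_mul, mul_one, Int.coe_negOnePow_natCast, pow_succ]
    simp
  · intro i hi
    rcases lt_or_gt_of_ne hi with hlt | hgt
    · rw [show A.mode (A.mode u i v) (-1 + n - i) A.vac = 0 from
        A.mode_vac_of_nonneg _ _ (by omega), smul_zero]
    · obtain ⟨t, ht⟩ := Submodule.mem_span_singleton.1 (h i hgt)
      have h2 : A.mode (t • A.vac) (-1 + n - i) = 0 := by
        have := A.vac_mode (-1 + n - i)
        rw [if_neg (by omega)] at this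
        simp [mode, this]
      rw [← ht, h2, LinearMap.zero_apply, smul_zero]

end VertexOperatorAlgebra

/-! ### Zero modes of Virasoro descendants as polynomials on highest weight spaces. -/

section

open Polynomial

namespace VOAModule

variable {V : Type*} [AddCommGroup V] [Module ℂ V] {A : VertexOperatorAlgebra V}
  {W : Type*} [AddCommGroup W] [Module ℂ W] (M : VOAModule A W)

/-- A subspace that is annihilated by the Virasoro operators `ν_(n+1)`, `n > 0`, and preserved by
`ν_(1)`. -/
structure IsHighestWeightSpace (ν : V) (S : Submodule ℂ W) : Prop where
  annihilate : ∀ x ∈ S, ∀ i : ℤ, 2 ≤ i → M.mode ν i x = 0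
  stable : ∀ x ∈ S, M.mode ν 1 x ∈ S

/-- The vector `v` has weight `k` for `ν_(1)`; on the subspace `S` its modes `v_(j)` with `j ≥ k`
vanish and its zero mode is the polynomial `p` in `ν_(1)`. -/
structure ActsBy (ν : V) (S : Submodule ℂ W) (v : V) (k : ℤ) (p : ℂ[X]) : Prop where
  weight : A.mode ν 1 v = (k : ℂ) • v
  high : ∀ x ∈ S, ∀ j : ℤ, k ≤ j → M.mode v j x = 0
  zero : ∀ x ∈ S, M.mode v (k - 1) x = aeval (M.mode ν 1) p x

namespace ActsBy

variable {M} {ν : V} {S : Submodule ℂ W} {v v' : V} {k : ℤ} {p p' : ℂ[X]}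

theorem vac : M.ActsBy ν S A.vac 0 1 where
  weight := by
    rw [Int.cast_zero, zero_smul]
    exact A.mode_vac_of_nonneg ν 1 (by norm_num)
  high x _ j hj := by rw [mode, M.vac_mode, if_neg (by omega), LinearMap.zero_apply]
  zero x _ := by rw [mode, M.vac_mode, if_pos (by omega), map_one]

theorem add (h : M.ActsBy ν S v k p) (h' : M.ActsBy ν S v' k p') :
    M.ActsBy ν S (v + v') k (p + p') where
  weight := by rw [map_add, h.weight, h'.weight, smul_add]
  high x hx j hj := by
    have := h.high x hx j hj
    have := h'.high x hx j hj
    simp_all [mode]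
  zero x hx := by
    have := h.zero x hx
    have := h'.zero x hx
    simp_all [mode]

theorem smul (h : M.ActsBy ν S v k p) (t : ℂ) : M.ActsBy ν S (t • v) k (C t * p) where
  weight := by rw [map_smul, h.weight, smul_comm]
  high x hx j hj := by
    have := h.high x hx j hj
    simp_all [mode]
  zero x hx := by
    have := h.zero x hx
    rw [map_mul, aeval_C, Module.algebraMap_end_eq_smul_id, Module.End.mul_apply, ← this]
    simp [mode]

theorem congr {k' : ℤ} (h : M.ActsBy ν S v k p) (hk : k = k') (hp : ∀ x, p.eval x = p'.eval x) :
    M.ActsBy ν S v k' p' := by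
  rwa [← hk, ← Polynomial.funext hp]

/-- By the iterate formula, a mode of `ν_(n+1) v` on the highest weight space reduces to modes of
`v` after `ν_(0)` and `ν_(1)`. The first leaves the space, but commutators bring it back, and each
descendant multiplies the polynomial by a factor linear in `ν_(1)`. For `n = -1` that factor is a
constant; a word of `r` modes thus has degree at most `r`. -/
theorem mode_virasoro {c : ℂ} (hν : VirasoroRelations (fun n => A.mode ν (n + 1)) c)
    (hS : M.IsHighestWeightSpace ν S) (h : M.ActsBy ν S v k p) {n : ℤ} (hn : n < 0) :
    M.ActsBy ν S (A.mode ν (n + 1) v) (k - n)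
      (C ((-1 : ℂ) ^ n) * (C (-(n : ℂ) - 1) * X + C (k : ℂ)) * p) := by
  have key : ∀ x ∈ S, ∀ j : ℤ, k - n - 1 ≤ j → M.mode (A.mode ν (n + 1) v) j x =
      (-1 : ℂ) ^ n • (M.mode v (j + n + 1) (M.mode ν 0 x) -
        ((n : ℂ) + 1) • M.mode v (j + n) (M.mode ν 1 x)) := by
    intro x hx j hj
    rw [M.mode_iterate_of_annihilate (hS.annihilate x hx)
      (fun i hi => h.high x hx i (by omega)), zpow_add₀ (by norm_num), zpow_add₀ (by norm_num),
      ← add_assoc, add_sub_cancel_right]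
    push_cast
    norm_num
  -- For a general `ν` the operator `ν_(0)` is not the translation operator, so the modes of `ν_(0)
  -- v` are not known directly. They are eliminated between the commutators of `v` with `ν_(0)` and
  -- with `ν_(1)`.
  have trans : ∀ x ∈ S, ∀ j : ℤ, k ≤ j → M.mode v j (M.mode ν 0 x) =
      (k : ℂ) • M.mode v (j - 1) x - M.mode ν 1 (M.mode v (j - 1) x) +
        M.mode v (j - 1) (M.mode ν 1 x) := by
    intro x hx j hj
    have h0 := M.mode_zero_commutator ν v x j
    have h1 := M.mode_one_commutator ν v x (j - 1)
    have hk : M.mode ((k : ℂ) • v) (j - 1) x = (k : ℂ) • M.mode v (j - 1) x := by simp [mode]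
    rw [h.high x hx j hj, map_zero, zero_sub] at h0
    rw [add_sub_cancel, h0, h.weight, hk] at h1
    rw [eq_add_of_sub_eq h1.symm]
    abel
  have hzero : ∀ x ∈ S, M.mode v k (M.mode ν 0 x) = (k : ℂ) • aeval (M.mode ν 1) p x := by
    intro x hx
    have hc : M.mode ν 1 (aeval (M.mode ν 1) p x) = aeval (M.mode ν 1) p (M.mode ν 1 x) := by
      rw [← Module.End.mul_apply, ← Module.End.mul_apply]
      congr 1
      simpa using congrArg (aeval (M.mode ν 1)) (mul_comm X p)
    rw [trans x hx k le_rfl, h.zero x hx, h.zero _ (hS.stable x hx), hc]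
    abel
  have hhigh : ∀ x ∈ S, ∀ j : ℤ, k < j → M.mode v j (M.mode ν 0 x) = 0 := by
    intro x hx j hj
    rw [trans x hx j hj.le, h.high x hx _ (by omega), h.high _ (hS.stable x hx) _ (by omega)]
    simp
  refine ⟨?_, fun x hx j hj => ?_, fun x hx => ?_⟩
  · have := hν.apply_apply 0 n v
    rw [if_neg (by omega)] at this
    simp only [zero_add, h.weight, map_smul] at this
    rw [this]
    push_cast
    module
  · rw [key x hx j (by omega), hhigh x hx _ (by omega), h.high _ (hS.stable x hx) _ (by omega)]
    simp
  · rw [key x hx _ le_rfl, show k - n - 1 + n + 1 = k by ring, hzero x hx,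
      show k - n - 1 + n = k - 1 by ring, h.zero _ (hS.stable x hx)]
    have : aeval (M.mode ν 1) (C ((-1 : ℂ) ^ n) * (C (-(n : ℂ) - 1) * X + C (k : ℂ)) * p) x =
        aeval (M.mode ν 1) (C ((-1 : ℂ) ^ n) * (C (-(n : ℂ) - 1) * (p * X) + C (k : ℂ) * p)) x := by
      congr 2
      ring
    rw [this]
    simp only [map_mul, map_add, aeval_C, aeval_X, Module.algebraMap_end_eq_smul_id,
      Module.End.mul_apply, LinearMap.add_apply, LinearMap.smul_apply, LinearMap.id_apply]
    module

variable {c : ℂ} (hν : VirasoroRelations (fun n => A.mode ν (n + 1)) c)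
    (hS : M.IsHighestWeightSpace ν S)
include hν hS

theorem quasiprimaryTwo :
    M.ActsBy ν S (ConformalDesign.quasiprimaryTwo (fun n => A.mode ν (n + 1)) A.vac) 2
      X := by
  have s (n : ℤ) (hn : n < 0) {v : V} {k : ℤ} {p : ℂ[X]} (h : M.ActsBy ν S v k p) :=
    h.mode_virasoro hν hS hn
  have h0 := (s (-2) (by norm_num) vac)
  refine (h0.congr (k' := 2) (by norm_num) fun _ => rfl).congr rfl fun x => ?_
  simp only [eval_add, eval_mul, eval_C, eval_X, eval_pow, eval_one]
  norm_num

theorem quasiprimaryFour :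
    M.ActsBy ν S (ConformalDesign.quasiprimaryFour (fun n => A.mode ν (n + 1)) A.vac) 4
      (X ^ 2 + C (1 / 5) * X) := by
  have s (n : ℤ) (hn : n < 0) {v : V} {k : ℤ} {p : ℂ[X]} (h : M.ActsBy ν S v k p) :=
    h.mode_virasoro hν hS hn
  have h0 := (s (-4) (by norm_num) vac)
  have h1 := (s (-2) (by norm_num) (s (-2) (by norm_num) vac))
  refine (((h0.congr (k' := 4) (by norm_num) fun _ => rfl).smul (-3 / 5)).add
    (h1.congr (k' := 4) (by norm_num) fun _ => rfl)).congr rfl fun x => ?_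
  simp only [eval_add, eval_mul, eval_C, eval_X, eval_pow, eval_one]
  norm_num
  ring

theorem quasiprimarySixA :
    M.ActsBy ν S (ConformalDesign.quasiprimarySixA (fun n => A.mode ν (n + 1)) A.vac) 6
      (C (-4 / 5) * X ^ 2 + C (-2 / 35) * X) := by
  have s (n : ℤ) (hn : n < 0) {v : V} {k : ℤ} {p : ℂ[X]} (h : M.ActsBy ν S v k p) :=
    h.mode_virasoro hν hS hn
  have h0 := (s (-6) (by norm_num) vac)
  have h1 := (s (-4) (by norm_num) (s (-2) (by norm_num) vac))
  have h2 := (s (-3) (by norm_num) (s (-3) (by norm_num) vac))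
  refine ((((h0.congr (k' := 6) (by norm_num) fun _ => rfl).smul (-4 / 7)).add
    ((h1.congr (k' := 6) (by norm_num) fun _ => rfl).smul (-8 / 5))).add
    (h2.congr (k' := 6) (by norm_num) fun _ => rfl)).congr rfl fun x => ?_
  simp only [eval_add, eval_mul, eval_C, eval_X, eval_pow, eval_one]
  norm_num
  ring

theorem quasiprimarySixB :
    M.ActsBy ν S (ConformalDesign.quasiprimarySixB (fun n => A.mode ν (n + 1)) A.vac) 6
      (X ^ 3 + C (3 / 5) * X ^ 2 + C (4 / 35) * X) := by
  have s (n : ℤ) (hn : n < 0) {v : V} {k : ℤ} {p : ℂ[X]} (h : M.ActsBy ν S v k p) :=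
    h.mode_virasoro hν hS hn
  have h0 := (s (-6) (by norm_num) vac)
  have h1 := (s (-4) (by norm_num) (s (-2) (by norm_num) vac))
  have h2 := (s (-2) (by norm_num) (s (-2) (by norm_num) (s (-2) (by norm_num) vac)))
  refine ((((h0.congr (k' := 6) (by norm_num) fun _ => rfl).smul (-6 / 7)).add
    ((h1.congr (k' := 6) (by norm_num) fun _ => rfl).smul (-9 / 5))).add
    (h2.congr (k' := 6) (by norm_num) fun _ => rfl)).congr rfl fun x => ?_
  simp only [eval_add, eval_mul, eval_C, eval_X, eval_pow, eval_one]
  norm_num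
  ring

theorem quasiprimaryEightA :
    M.ActsBy ν S (ConformalDesign.quasiprimaryEightA (fun n => A.mode ν (n + 1)) A.vac) 8
      (C (3 / 7) * X ^ 2 + C (1 / 63) * X) := by
  have s (n : ℤ) (hn : n < 0) {v : V} {k : ℤ} {p : ℂ[X]} (h : M.ActsBy ν S v k p) :=
    h.mode_virasoro hν hS hn
  have h0 := (s (-8) (by norm_num) vac)
  have h1 := (s (-6) (by norm_num) (s (-2) (by norm_num) vac))
  have h2 := (s (-5) (by norm_num) (s (-3) (by norm_num) vac))
  have h3 := (s (-4) (by norm_num) (s (-4) (by norm_num) vac))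
  refine (((((h0.congr (k' := 8) (by norm_num) fun _ => rfl).smul (-5 / 9)).add
    ((h1.congr (k' := 8) (by norm_num) fun _ => rfl).smul (20 / 21))).add
    ((h2.congr (k' := 8) (by norm_num) fun _ => rfl).smul (-5 / 3))).add
    (h3.congr (k' := 8) (by norm_num) fun _ => rfl)).congr rfl fun x => ?_
  simp only [eval_add, eval_mul, eval_C, eval_X, eval_pow, eval_one]
  norm_num
  ring

theorem quasiprimaryEightB :
    M.ActsBy ν S (ConformalDesign.quasiprimaryEightB (fun n => A.mode ν (n + 1)) A.vac) 8
      (C (-4 / 5) * X ^ 3 + C (-26 / 35) * X ^ 2 + C (-2 / 35) * X) := by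
  have s (n : ℤ) (hn : n < 0) {v : V} {k : ℤ} {p : ℂ[X]} (h : M.ActsBy ν S v k p) :=
    h.mode_virasoro hν hS hn
  have h0 := (s (-6) (by norm_num) (s (-2) (by norm_num) vac))
  have h1 := (s (-5) (by norm_num) (s (-3) (by norm_num) vac))
  have h2 := (s (-4) (by norm_num) (s (-2) (by norm_num) (s (-2) (by norm_num) vac)))
  have h3 := (s (-3) (by norm_num) (s (-3) (by norm_num) (s (-2) (by norm_num) vac)))
  refine (((((h0.congr (k' := 8) (by norm_num) fun _ => rfl).smul (-36 / 35)).add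
    ((h1.congr (k' := 8) (by norm_num) fun _ => rfl).smul (4 / 5))).add
    ((h2.congr (k' := 8) (by norm_num) fun _ => rfl).smul (-8 / 5))).add
    (h3.congr (k' := 8) (by norm_num) fun _ => rfl)).congr rfl fun x => ?_
  simp only [eval_add, eval_mul, eval_C, eval_X, eval_pow, eval_one]
  norm_num
  ring

theorem quasiprimaryEightC :
    M.ActsBy ν S (ConformalDesign.quasiprimaryEightC (fun n => A.mode ν (n + 1)) A.vac) 8
      (X ^ 4 + C (6 / 5) * X ^ 3 + C (4 / 35) * X ^ 2 + C (3 / 35) * X) := by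
  have s (n : ℤ) (hn : n < 0) {v : V} {k : ℤ} {p : ℂ[X]} (h : M.ActsBy ν S v k p) :=
    h.mode_virasoro hν hS hn
  have h0 := (s (-8) (by norm_num) vac)
  have h1 := (s (-6) (by norm_num) (s (-2) (by norm_num) vac))
  have h2 := (s (-5) (by norm_num) (s (-3) (by norm_num) vac))
  have h3 := (s (-4) (by norm_num) (s (-2) (by norm_num) (s (-2) (by norm_num) vac)))
  have h4 := (s (-2) (by norm_num) (s (-2) (by norm_num) (s (-2) (by norm_num) (s (-2) (by norm_num) vac))))
  refine ((((((h0.congr (k' := 8) (by norm_num) fun _ => rfl).smul (-3)).add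
    ((h1.congr (k' := 8) (by norm_num) fun _ => rfl).smul (-156 / 35))).add
    ((h2.congr (k' := 8) (by norm_num) fun _ => rfl).smul (9 / 5))).add
    ((h3.congr (k' := 8) (by norm_num) fun _ => rfl).smul (-18 / 5))).add
    (h4.congr (k' := 8) (by norm_num) fun _ => rfl)).congr rfl fun x => ?_
  simp only [eval_add, eval_mul, eval_C, eval_X, eval_pow, eval_one]
  norm_num
  ring

end ActsBy

end VOAModule

end

/-! ### The vacuum Virasoro module: spanning words and its quasi-primary vectors. -/

namespace VertexOperatorAlgebra

variable {V : Type*} [AddCommGroup V] [Module ℂ V] (A : VertexOperatorAlgebra V)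

theorem virasoroRelations : VirasoroRelations A.L A.c := A.virasoro

theorem L_vac {n : ℤ} (hn : -1 ≤ n) : A.L n A.vac = 0 :=
  A.mode_vac_of_nonneg A.ω (n + 1) (by omega)

theorem L_mem_degree {m : ℤ} {x : V} (hx : x ∈ A.degree m) (n : ℤ) :
    A.L n x ∈ A.degree (m - n) := by
  rw [mem_degree] at hx ⊢
  rw [A.virasoroRelations.apply_apply, hx, map_smul]
  split_ifs with h
  · obtain rfl : n = 0 := by omega
    simp [hx]
  · push_cast
    rw [zero_add]
    module

theorem iSupIndep_degree : iSupIndep A.degree := by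
  have h := Module.End.eigenspaces_iSupIndep (A.L 0)
  exact h.comp (f := fun n : ℤ => (n : ℂ)) Int.cast_injective

/-- If `v` is annihilated by the `L n` with `n > t`, then the Virasoro module generated by `v` is
generated from `v` by the `L n` with `n ≤ t`. -/
theorem virasoroSpan_le (t : ℤ) {v : V} {U : Submodule ℂ V} (hann : ∀ n, t < n → A.L n v = 0)
    (hv : v ∈ U) (hU : ∀ x ∈ U, ∀ n ≤ t, A.L n x ∈ U) : A.virasoroSpan v ≤ U := by
  -- A weak form of the PBW theorem: `J` is the closure under the modes `n ≤ t`, and `J'` below is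
  -- its largest part sent into `J` by the other modes. The commutation relations make `J'` closed
  -- under the modes `n ≤ t`, so `J ≤ J'`.
  let J : Submodule ℂ V := sInf {U | v ∈ U ∧ ∀ x ∈ U, ∀ n ≤ t, A.L n x ∈ U}
  have hvJ : v ∈ J := Submodule.mem_sInf.2 fun U hU => hU.1
  have hJ : ∀ x ∈ J, ∀ n ≤ t, A.L n x ∈ J := fun x hx n hn =>
    Submodule.mem_sInf.2 fun U hU => hU.2 x (Submodule.mem_sInf.1 hx U hU) n hn
  let J' : Submodule ℂ V :=
    { carrier := {x | x ∈ J ∧ ∀ n, t < n → A.L n x ∈ J}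
      add_mem' := fun hx hy => ⟨J.add_mem hx.1 hy.1, fun n hn => by
        rw [map_add]; exact J.add_mem (hx.2 n hn) (hy.2 n hn)⟩
      zero_mem' := ⟨J.zero_mem, fun n _ => by rw [map_zero]; exact J.zero_mem⟩
      smul_mem' := fun a x hx => ⟨J.smul_mem a hx.1, fun n hn => by
        rw [map_smul]; exact J.smul_mem a (hx.2 n hn)⟩ }
  have hJJ' : J ≤ J' := by
    refine sInf_le ⟨⟨hvJ, fun n hn => ?_⟩, fun x hx m hm => ⟨hJ x hx.1 m hm, fun n hn => ?_⟩⟩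
    · rw [hann n hn]; exact J.zero_mem
    · rw [A.virasoroRelations.apply_apply]
      refine J.add_mem (J.add_mem (hJ _ (hx.2 n hn) m hm) (J.smul_mem _ ?_)) (J.smul_mem _ hx.1)
      rcases le_or_gt (n + m) t with h | h
      · exact hJ x hx.1 _ h
      · exact hx.2 _ h
  refine (sInf_le ⟨hvJ, fun x hx n => ?_⟩ : A.virasoroSpan v ≤ J).trans (sInf_le ⟨hv, hU⟩)
  rcases le_or_gt n t with h | h
  · exact hJ x hx n h
  · exact (hJJ' hx).2 n h

theorem virasoroSpan_le_iSup_degree {k : ℤ} {v : V} (hv : v ∈ A.degree k)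
    (hpos : ∀ n, 0 < n → A.L n v = 0) :
    A.virasoroSpan v ≤ ⨆ (n : ℤ) (_ : k ≤ n), A.degree n := by
  refine A.virasoroSpan_le 0 hpos (le_iSup₂ (f := fun n (_ : k ≤ n) => A.degree n) k le_rfl hv) ?_
  intro x hx n hn
  suffices h : (⨆ (n : ℤ) (_ : k ≤ n), A.degree n) ≤
      (⨆ (n : ℤ) (_ : k ≤ n), A.degree n).comap (A.L n) from h hx
  refine iSup₂_le fun m hm y hy => ?_
  exact le_iSup₂ (f := fun n (_ : k ≤ n) => A.degree n) (m - n) (by omega) (A.L_mem_degree hy n)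

/-- The subspace of weight `n` spanned by the words in `L (-1)` and `L (-2)` on the vacuum. -/
def wordSpan : ℕ → Submodule ℂ V
  | 0 => Submodule.span ℂ {A.vac}
  | 1 => ⊥
  | n + 2 => (wordSpan n).map (A.L (-2)) ⊔ (wordSpan (n + 1)).map (A.L (-1))

theorem wordSpan_le_degree : ∀ n : ℕ, A.wordSpan n ≤ A.degree n
  | 0 => by simp [wordSpan, degree_zero]
  | 1 => by simp [wordSpan]
  | n + 2 => by
    rw [wordSpan]
    refine sup_le (Submodule.map_le_iff_le_comap.2 fun x hx => ?_)
      (Submodule.map_le_iff_le_comap.2 fun x hx => ?_)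
    · have := A.L_mem_degree (wordSpan_le_degree n hx) (-2)
      simpa using this
    · have := A.L_mem_degree (wordSpan_le_degree (n + 1) hx) (-1)
      rw [Submodule.mem_comap]
      convert this using 2
      push_cast
      ring

theorem L_neg_mem_wordSpan (k : ℕ) {n : ℕ} {x : V} (hx : x ∈ A.wordSpan n) :
    A.L (-(k + 1 : ℕ)) x ∈ A.wordSpan (n + k + 1) := by
  have one : ∀ {n : ℕ} {x : V}, x ∈ A.wordSpan n → A.L (-1) x ∈ A.wordSpan (n + 1) := by
    intro n x hx
    cases n with
    | zero =>
      obtain ⟨t, rfl⟩ := Submodule.mem_span_singleton.1 hx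
      rw [map_smul, A.L_vac le_rfl, smul_zero]
      exact Submodule.zero_mem _
    | succ n => exact Submodule.mem_sup_right (Submodule.mem_map_of_mem hx)
  induction k generalizing n x with
  | zero => simpa using one hx
  | succ k ih =>
    cases k with
    | zero => exact Submodule.mem_sup_left (Submodule.mem_map_of_mem hx)
    | succ k =>
      have h1 := one (ih hx)
      have h2 := ih (one hx)
      have h := A.virasoroRelations.apply_apply (-1) (-(k + 1 + 1 : ℕ)) x
      rw [if_neg (by omega), zero_smul, add_zero] at h
      have hk : ((-1 : ℤ) : ℂ) - (-(k + 1 + 1 : ℕ) : ℤ) ≠ 0 := by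
        push_cast
        have : ((k + 1 : ℕ) : ℂ) ≠ 0 := Nat.cast_ne_zero.2 (by omega)
        intro h0
        apply this
        push_cast
        linear_combination h0
      -- The modes `L_(-1)` and `L_(-2)` generate all negative modes, since `[L_(-1), L_(-m)] = (m -
      -- 1) L_(-m-1)` and `m - 1 ≠ 0` for `m ≥ 2`.
      have e : A.L (-(k + 1 + 1 + 1 : ℕ)) x = (((-1 : ℤ) : ℂ) - (-(k + 1 + 1 : ℕ) : ℤ))⁻¹ •
          (A.L (-1) (A.L (-(k + 1 + 1 : ℕ)) x) - A.L (-(k + 1 + 1 : ℕ)) (A.L (-1) x)) := by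
        rw [h, add_sub_cancel_left, smul_smul, inv_mul_cancel₀ hk, one_smul]
        congr 3
        push_cast
        ring
      rw [e]
      refine Submodule.smul_mem _ _ (Submodule.sub_mem _ h1 ?_)
      convert h2 using 2
      omega

theorem virasoroSpan_vac_le : A.virasoroSpan A.vac ≤ ⨆ n, A.wordSpan n := by
  refine A.virasoroSpan_le (-2) (fun n hn => A.L_vac (by omega)) ?_ ?_
  · exact le_iSup A.wordSpan 0 (Submodule.mem_span_singleton_self _)
  · intro x hx n hn
    suffices h : (⨆ n, A.wordSpan n) ≤ (⨆ n, A.wordSpan n).comap (A.L n) from h hx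
    refine iSup_le fun m y hy => ?_
    obtain ⟨k, rfl⟩ : ∃ k : ℕ, n = -(k + 1 : ℕ) := ⟨(-n - 1).toNat, by omega⟩
    exact le_iSup A.wordSpan _ (A.L_neg_mem_wordSpan k hy)

theorem mem_wordSpan {n : ℕ} {x : V} (hx : x ∈ A.virasoroSpan A.vac) (hn : x ∈ A.degree n) :
    x ∈ A.wordSpan n := by
  have h1 : (⨆ n, A.wordSpan n) ≤ A.wordSpan n ⊔ ⨆ (m : ℤ) (_ : m ≠ n), A.degree m := by
    refine iSup_le fun m => ?_
    by_cases h : m = n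
    · rw [h]; exact le_sup_left
    · exact le_sup_of_le_right ((A.wordSpan_le_degree m).trans
        (le_iSup₂ (f := fun (j : ℤ) (_ : j ≠ n) => A.degree j) (m : ℤ) (by exact_mod_cast h)))
  have h2 : x ∈ (A.wordSpan n ⊔ ⨆ (m : ℤ) (_ : m ≠ n), A.degree m) ⊓ A.degree n :=
    ⟨h1 (A.virasoroSpan_vac_le hx), hn⟩
  -- The modular law together with the independence of the `L_0`-eigenspaces extracts the component
  -- of degree `n`.
  rwa [sup_inf_assoc_of_le _ (A.wordSpan_le_degree n), inf_comm,
    (A.iSupIndep_degree n).eq_bot, sup_bot_eq] at h2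

/-- The `sl_2` argument that `L_(-1) L_1` has no negative integer eigenvalue: applying `L_1` turns
the equation for `y` in degree `m + 1` into one for `L_1 y` in degree `m`, with the still positive
constant `μ + 2m`; degrees below zero vanish. Consequently, no nonzero `L_(-1) y` with `y` of
positive degree is quasi-primary. -/
theorem eq_zero_of_L_neg_one_L_one (m : ℕ) {y : V} (hy : y ∈ A.degree m) (μ : ℕ) (hμ : 0 < μ)
    (h : A.L (-1) (A.L 1 y) + (μ : ℂ) • y = 0) : y = 0 := by
  have hμ' : (μ : ℂ) ≠ 0 := Nat.cast_ne_zero.2 hμ.ne'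
  suffices h1 : A.L 1 y = 0 by
    rw [h1, map_zero, zero_add] at h
    exact (smul_eq_zero.1 h).resolve_left hμ'
  induction m generalizing y μ with
  | zero =>
    exact A.eq_zero_of_mem_degree_neg (by norm_num) (A.L_mem_degree hy 1)
  | succ m ih =>
    have hy1 : A.L 1 y ∈ A.degree m := by
      have := A.L_mem_degree hy 1
      push_cast at this
      simpa using this
    have h2 : A.L (-1) (A.L 1 (A.L 1 y)) + ((μ + 2 * m : ℕ) : ℂ) • A.L 1 y = 0 := by
      have h3 := congrArg (A.L 1) h
      rw [map_add, map_zero, map_smul, A.virasoroRelations.apply_apply] at h3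
      norm_num at h3
      rw [A.mem_degree.1 hy1] at h3
      rw [← h3]
      push_cast
      module
    have h4 := ih hy1 (μ + 2 * m) (by omega) h2 (Nat.cast_ne_zero.2 (by omega))
    rw [h4, map_zero, zero_add] at h2
    exact (smul_eq_zero.1 h2).resolve_left (Nat.cast_ne_zero.2 (by omega))

theorem eq_zero_of_L_one_L_neg_one {m : ℕ} (hm : 0 < m) {y : V} (hy : y ∈ A.degree m)
    (h : A.L 1 (A.L (-1) y) = 0) : y = 0 := by
  refine A.eq_zero_of_L_neg_one_L_one m hy (2 * m) (by omega) ?_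
  rw [A.virasoroRelations.apply_apply] at h
  norm_num at h
  rw [A.mem_degree.1 hy] at h
  rw [← h]
  push_cast
  module

/-- A vector in the kernel of `L 1` that lies in `T + L (-1) V` for a space `T` of vectors in the
kernel of `L 1` lies in `T`. -/
theorem mem_of_mem_sup_map {n : ℕ} (hn : 0 < n) {T : Submodule ℂ V} {x : V}
    (hT : ∀ y ∈ T, A.L 1 y = 0) (hx : x ∈ T ⊔ (A.degree n).map (A.L (-1)))
    (h1 : A.L 1 x = 0) : x ∈ T := by
  obtain ⟨y, hy, z, ⟨w, hw, rfl⟩, rfl⟩ := Submodule.mem_sup.1 hx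
  rw [map_add, hT y hy, zero_add] at h1
  rwa [A.eq_zero_of_L_one_L_neg_one hn hw h1, map_zero, add_zero]

theorem mem_map_of_L_zero {n : ℕ} {y : V} {k : ℂ} (hk : k = n) (hy : A.L 0 y = k • y) :
    A.L (-1) y ∈ (A.degree n).map (A.L (-1)) := by
  refine Submodule.mem_map_of_mem (A.mem_degree.2 ?_)
  rw [hy, hk]
  norm_num

/-- The span `T` of the explicit vectors and the image of `L_(-1)` together contain all words of
this weight, and the quasi-primary part of that sum is `T`. Only spanning is asserted: for special
`c` the explicit vectors may be dependent or zero. -/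
theorem exists_quasiprimary_two {x : V} (hx : x ∈ A.virasoroSpan A.vac) (h : x ∈ A.degree 2)
    (h1 : A.L 1 x = 0) : ∃ a0 : ℂ,
      x = a0 • quasiprimaryTwo A.L A.vac := by
  have hL := A.virasoroRelations
  have hv : ∀ n : ℤ, -1 ≤ n → A.L n A.vac = 0 := fun n => A.L_vac
  set T : Submodule ℂ V := Submodule.span ℂ {quasiprimaryTwo A.L A.vac} with hT
  have hw : A.wordSpan 2 ≤ T ⊔ (A.degree (1 : ℕ)).map (A.L (-1)) := by
    refine sup_le ?_ (le_sup_of_le_right (Submodule.map_mono (A.wordSpan_le_degree 1)))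
    simp only [wordSpan, Submodule.map_sup, Submodule.map_span, Set.image_singleton,
      Submodule.map_bot, sup_le_iff, bot_le, and_true, true_and, Submodule.span_singleton_le_iff_mem]
    · obtain ⟨α, y, hy, e⟩ := hL.word_2 hv
      rw [e]
      exact Submodule.add_mem_sup (Submodule.mem_span_singleton.2 ⟨α, rfl⟩)
        (A.mem_map_of_L_zero (by norm_num) hy)
  have hx' : x ∈ T := by
    refine A.mem_of_mem_sup_map (by norm_num) (fun y hy => ?_) (hw (A.mem_wordSpan hx h)) h1
    suffices hle : T ≤ LinearMap.ker (A.L 1) from hle hy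
    rw [hT, Submodule.span_le]
    rintro _ rfl
    · exact hL.L_one_quasiprimaryTwo hv
  obtain ⟨a0, ha⟩ := Submodule.mem_span_singleton.1 hx'
  exact ⟨a0, ha.symm⟩

theorem exists_quasiprimary_four {x : V} (hx : x ∈ A.virasoroSpan A.vac) (h : x ∈ A.degree 4)
    (h1 : A.L 1 x = 0) : ∃ a0 : ℂ,
      x = a0 • quasiprimaryFour A.L A.vac := by
  have hL := A.virasoroRelations
  have hv : ∀ n : ℤ, -1 ≤ n → A.L n A.vac = 0 := fun n => A.L_vac
  set T : Submodule ℂ V := Submodule.span ℂ {quasiprimaryFour A.L A.vac} with hT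
  have hw : A.wordSpan 4 ≤ T ⊔ (A.degree (3 : ℕ)).map (A.L (-1)) := by
    refine sup_le ?_ (le_sup_of_le_right (Submodule.map_mono (A.wordSpan_le_degree 3)))
    simp only [wordSpan, Submodule.map_sup, Submodule.map_span, Set.image_singleton,
      Submodule.map_bot, sup_le_iff, bot_le, and_true, true_and, Submodule.span_singleton_le_iff_mem]
    · obtain ⟨α, y, hy, e⟩ := hL.word_2_2 hv
      rw [e]
      exact Submodule.add_mem_sup (Submodule.mem_span_singleton.2 ⟨α, rfl⟩)
        (A.mem_map_of_L_zero (by norm_num) hy)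
  have hx' : x ∈ T := by
    refine A.mem_of_mem_sup_map (by norm_num) (fun y hy => ?_) (hw (A.mem_wordSpan hx h)) h1
    suffices hle : T ≤ LinearMap.ker (A.L 1) from hle hy
    rw [hT, Submodule.span_le]
    rintro _ rfl
    · exact hL.L_one_quasiprimaryFour hv
  obtain ⟨a0, ha⟩ := Submodule.mem_span_singleton.1 hx'
  exact ⟨a0, ha.symm⟩

theorem exists_quasiprimary_six {x : V} (hx : x ∈ A.virasoroSpan A.vac) (h : x ∈ A.degree 6)
    (h1 : A.L 1 x = 0) : ∃ a0 a1 : ℂ,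
      x = a0 • quasiprimarySixA A.L A.vac + a1 • quasiprimarySixB A.L A.vac := by
  have hL := A.virasoroRelations
  have hv : ∀ n : ℤ, -1 ≤ n → A.L n A.vac = 0 := fun n => A.L_vac
  set T : Submodule ℂ V := Submodule.span ℂ {quasiprimarySixA A.L A.vac, quasiprimarySixB A.L A.vac} with hT
  have hw : A.wordSpan 6 ≤ T ⊔ (A.degree (5 : ℕ)).map (A.L (-1)) := by
    refine sup_le ?_ (le_sup_of_le_right (Submodule.map_mono (A.wordSpan_le_degree 5)))
    simp only [wordSpan, Submodule.map_sup, Submodule.map_span, Set.image_singleton,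
      Submodule.map_bot, sup_le_iff, bot_le, and_true, true_and, Submodule.span_singleton_le_iff_mem]
    refine ⟨?_, ?_⟩
    · obtain ⟨α, β, y, hy, e⟩ := hL.word_2_2_2 hv
      rw [e]
      exact Submodule.add_mem_sup (Submodule.mem_span_pair.2 ⟨α, β, rfl⟩)
        (A.mem_map_of_L_zero (by norm_num) hy)
    · obtain ⟨α, β, y, hy, e⟩ := hL.word_2_1_1_2 hv
      rw [e]
      exact Submodule.add_mem_sup (Submodule.mem_span_pair.2 ⟨α, β, rfl⟩)
        (A.mem_map_of_L_zero (by norm_num) hy)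
  have hx' : x ∈ T := by
    refine A.mem_of_mem_sup_map (by norm_num) (fun y hy => ?_) (hw (A.mem_wordSpan hx h)) h1
    suffices hle : T ≤ LinearMap.ker (A.L 1) from hle hy
    rw [hT, Submodule.span_le]
    rintro _ (rfl | rfl)
    · exact hL.L_one_quasiprimarySixA hv
    · exact hL.L_one_quasiprimarySixB hv
  obtain ⟨a0, a1, ha⟩ := Submodule.mem_span_pair.1 hx'
  exact ⟨a0, a1, ha.symm⟩

theorem exists_quasiprimary_eight {x : V} (hx : x ∈ A.virasoroSpan A.vac) (h : x ∈ A.degree 8)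
    (h1 : A.L 1 x = 0) : ∃ a0 a1 a2 : ℂ,
      x = a0 • quasiprimaryEightA A.L A.vac + a1 • quasiprimaryEightB A.L A.vac + a2 • quasiprimaryEightC A.L A.vac := by
  have hL := A.virasoroRelations
  have hv : ∀ n : ℤ, -1 ≤ n → A.L n A.vac = 0 := fun n => A.L_vac
  set T : Submodule ℂ V := Submodule.span ℂ {quasiprimaryEightA A.L A.vac, quasiprimaryEightB A.L A.vac, quasiprimaryEightC A.L A.vac} with hT
  have hw : A.wordSpan 8 ≤ T ⊔ (A.degree (7 : ℕ)).map (A.L (-1)) := by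
    refine sup_le ?_ (le_sup_of_le_right (Submodule.map_mono (A.wordSpan_le_degree 7)))
    simp only [wordSpan, Submodule.map_sup, Submodule.map_span, Set.image_singleton,
      Submodule.map_bot, sup_le_iff, bot_le, and_true, true_and, Submodule.span_singleton_le_iff_mem]
    refine ⟨⟨?_, ?_⟩, ?_, ?_, ?_⟩
    · obtain ⟨α, β, γ, y, hy, e⟩ := hL.word_2_2_2_2 hv
      rw [e]
      exact Submodule.add_mem_sup (Submodule.mem_span_triple.2 ⟨α, β, γ, rfl⟩)
        (A.mem_map_of_L_zero (by norm_num) hy)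
    · obtain ⟨α, β, γ, y, hy, e⟩ := hL.word_2_2_1_1_2 hv
      rw [e]
      exact Submodule.add_mem_sup (Submodule.mem_span_triple.2 ⟨α, β, γ, rfl⟩)
        (A.mem_map_of_L_zero (by norm_num) hy)
    · obtain ⟨α, β, γ, y, hy, e⟩ := hL.word_2_1_2_1_2 hv
      rw [e]
      exact Submodule.add_mem_sup (Submodule.mem_span_triple.2 ⟨α, β, γ, rfl⟩)
        (A.mem_map_of_L_zero (by norm_num) hy)
    · obtain ⟨α, β, γ, y, hy, e⟩ := hL.word_2_1_1_2_2 hv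
      rw [e]
      exact Submodule.add_mem_sup (Submodule.mem_span_triple.2 ⟨α, β, γ, rfl⟩)
        (A.mem_map_of_L_zero (by norm_num) hy)
    · obtain ⟨α, β, γ, y, hy, e⟩ := hL.word_2_1_1_1_1_2 hv
      rw [e]
      exact Submodule.add_mem_sup (Submodule.mem_span_triple.2 ⟨α, β, γ, rfl⟩)
        (A.mem_map_of_L_zero (by norm_num) hy)
  have hx' : x ∈ T := by
    refine A.mem_of_mem_sup_map (by norm_num) (fun y hy => ?_) (hw (A.mem_wordSpan hx h)) h1
    suffices hle : T ≤ LinearMap.ker (A.L 1) from hle hy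
    rw [hT, Submodule.span_le]
    rintro _ (rfl | rfl | rfl)
    · exact hL.L_one_quasiprimaryEightA hv
    · exact hL.L_one_quasiprimaryEightB hv
    · exact hL.L_one_quasiprimaryEightC hv
  obtain ⟨a0, a1, a2, ha⟩ := Submodule.mem_span_triple.1 hx'
  exact ⟨a0, a1, a2, ha.symm⟩

end VertexOperatorAlgebra

/-! ### The projection of quasi-primary vectors to the vacuum module. -/

section Projection

variable {V : Type*} [AddCommGroup V] [Module ℂ V] {A : VertexOperatorAlgebra V}

theorem VertexOperatorAlgebra.mem_virasoroSpan_self (v : V) : v ∈ A.virasoroSpan v :=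
  Submodule.mem_sInf.2 fun _ hU => hU.1

namespace VirasoroDecomposition

variable {ι : Type*} [DecidableEq ι] (D : VirasoroDecomposition A ι)

theorem hwv_mem_degree (i : ι) : D.hwv i ∈ A.degree (D.weight i) := by
  rw [A.mem_degree, D.L_zero_hwv]
  norm_num

theorem exists_weight_eq_zero : ∃ i, D.weight i = 0 := by
  by_contra! hD
  -- If all highest weights were positive, every summand would live in positive degrees, leaving no
  -- room for the vacuum.
  have h1 : (⊤ : Submodule ℂ V) ≤ ⨆ (n : ℤ) (_ : n ≠ 0), A.degree n := by
    rw [← D.isInternal.submodule_iSup_eq_top]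
    refine iSup_le fun i => (A.virasoroSpan_le_iSup_degree (D.hwv_mem_degree i)
      (D.L_pos_hwv i)).trans (iSup₂_le fun n hn => ?_)
    have := hD i
    exact le_iSup₂ (f := fun (n : ℤ) (_ : n ≠ 0) => A.degree n) n (by omega)
  exact A.vac_ne_zero (Submodule.disjoint_def.1 (A.iSupIndep_degree 0) _ A.vac_mem_degree
    (h1 Submodule.mem_top))

theorem exists_hwv_eq_smul_vac {i : ι} (hi : D.weight i = 0) :
    ∃ t : ℂ, t ≠ 0 ∧ D.hwv i = t • A.vac := by
  have h := D.hwv_mem_degree i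
  rw [hi, Nat.cast_zero, A.degree_zero] at h
  obtain ⟨t, ht⟩ := Submodule.mem_span_singleton.1 h
  refine ⟨t, ?_, ht.symm⟩
  rintro rfl
  exact D.hwv_ne_zero i (by rw [← ht, zero_smul])

theorem proj_mem_virasoroSpan (x : V) : D.proj x ∈ A.virasoroSpan A.vac := by
  have hx : x ∈ ⨆ i, A.virasoroSpan (D.hwv i) := by
    rw [D.isInternal.submodule_iSup_eq_top]; trivial
  induction hx using Submodule.iSup_induction' with
  | mem i y hy =>
    rw [D.proj_apply_of_mem i y hy]
    split_ifs with hi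
    · obtain ⟨t, -, ht⟩ := D.exists_hwv_eq_smul_vac hi
      refine (sInf_le ⟨?_, A.L_mem_virasoroSpan A.vac⟩ :
        A.virasoroSpan (D.hwv i) ≤ A.virasoroSpan A.vac) hy
      rw [ht]
      exact Submodule.smul_mem _ _ (A.mem_virasoroSpan_self _)
    · exact Submodule.zero_mem _
  | zero => rw [map_zero]; exact Submodule.zero_mem _
  | add y z _ _ h₁ h₂ => rw [map_add]; exact Submodule.add_mem _ h₁ h₂

theorem proj_vac : D.proj A.vac = A.vac := by
  obtain ⟨i, hi⟩ := D.exists_weight_eq_zero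
  obtain ⟨t, ht0, ht⟩ := D.exists_hwv_eq_smul_vac hi
  have hmem : A.vac ∈ A.virasoroSpan (D.hwv i) := by
    have := Submodule.smul_mem _ t⁻¹ (A.mem_virasoroSpan_self (D.hwv i))
    rwa [ht, smul_smul, inv_mul_cancel₀ ht0, one_smul, ← ht] at this
  rw [D.proj_apply_of_mem i _ hmem, if_pos hi]

theorem proj_mem_degree {n : ℤ} {v : V} (hv : v ∈ A.degree n) : D.proj v ∈ A.degree n := by
  rw [A.mem_degree] at hv ⊢
  rw [← D.proj_L, hv, map_smul]

end VirasoroDecomposition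

namespace VertexOperatorAlgebra

/-- The vectors annihilated by the modes `w_(n)`, `n ≥ 0`. -/
def commutant (A : VertexOperatorAlgebra V) (w : V) : Submodule ℂ V :=
  ⨅ n : ℕ, LinearMap.ker (A.mode w n)

theorem mem_commutant {w x : V} : x ∈ A.commutant w ↔ ∀ n : ℕ, A.mode w n x = 0 := by
  simp [commutant]

theorem vac_mem_commutant (w : V) : A.vac ∈ A.commutant w :=
  mem_commutant.2 fun n => A.mode_vac_of_nonneg w n (by simp)

/-- The range `n ≥ -1` is exactly where `w₂_(n+1)` is a nonnegative mode and kills the commutant.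
This is what carries computations with `w₁` over to the `L_n`. -/
theorem L_apply_of_mem_commutant {w₁ w₂ : V} (hω : w₁ + w₂ = A.ω) {n : ℤ} (hn : -1 ≤ n) {x : V}
    (hx : x ∈ A.commutant w₂) : A.L n x = A.mode w₁ (n + 1) x := by
  have h2 := mem_commutant.1 hx (n + 1).toNat
  rw [Int.toNat_of_nonneg (by omega)] at h2
  rw [L, ← hω, ← add_zero (A.mode w₁ (n + 1) x), ← h2]
  simp [mode]

namespace IsCommutingVirasoroPair

variable {w₁ w₂ : V} {c₁ c₂ : ℂ} (h : A.IsCommutingVirasoroPair w₁ w₂ c₁ c₂)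
include h

theorem mode_mem_commutant (n : ℤ) {x : V} (hx : x ∈ A.commutant w₂) :
    A.mode w₁ n x ∈ A.commutant w₂ := by
  rw [mem_commutant] at hx ⊢
  intro k
  have := congrArg (fun f : Module.End ℂ V => f x) (h.comm n k)
  simp only [Module.End.mul_apply] at this
  rw [← this, hx, map_zero]

variable (hω : w₁ + w₂ = A.ω)
include hω

variable {ι : Type*} [DecidableEq ι] (D : VirasoroDecomposition A ι)

/-- The projection of `z` is quasi-primary and lies in the vacuum module, because `π` commutes with
the `L_n`. Applying a lowering word gives on one side the pairing at `c`, on the other the word in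
`w₁` on `z`, a multiple of the vacuum, which `π` fixes. The coefficients stay as unknowns with
linear equations, so no determinant has to be nonzero here. -/
theorem exists_proj_eq_two {z : V} {s0 : ℂ} (hz : z ∈ A.commutant w₂)
    (h0 : A.mode w₁ (0 + 1) z = (2 : ℂ) • z) (h1 : A.mode w₁ (1 + 1) z = 0)
    (p0 : A.mode w₁ (2 + 1) z = s0 • A.vac) :
    ∃ x0 : ℂ, D.proj z = x0 • quasiprimaryTwo A.L A.vac ∧
      ((1 / 2) * A.c) * x0 = s0 := by
  have hL := A.virasoroRelations
  have hv : ∀ n : ℤ, -1 ≤ n → A.L n A.vac = 0 := fun n => A.L_vac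
  have t (n : ℤ) (hn : -1 ≤ n) {x : V} (hx : x ∈ A.commutant w₂) := L_apply_of_mem_commutant hω hn hx
  have k (n : ℤ) {x : V} (hx : x ∈ A.commutant w₂) := h.mode_mem_commutant n hx
  have hz0 : z ∈ A.degree 2 := by
    rw [A.mem_degree, t 0 (by norm_num) hz, h0]
    norm_num
  obtain ⟨x0, hx⟩ := A.exists_quasiprimary_two (D.proj_mem_virasoroSpan z)
    (D.proj_mem_degree hz0) (by rw [← D.proj_L, t 1 (by norm_num) hz, h1, map_zero])
  refine ⟨x0, hx, ?_⟩
  · have e := congrArg (fun y => A.L 2 y) hx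
    simp only [← D.proj_L, map_add, map_smul, hL.L_2_quasiprimaryTwo hv] at e
    rw [t 2 (by norm_num) hz, p0, map_smul, D.proj_vac] at e
    refine smul_left_injective ℂ A.vac_ne_zero ?_
    simp only [e]
    module

theorem exists_proj_eq_four {z : V} {s0 : ℂ} (hz : z ∈ A.commutant w₂)
    (h0 : A.mode w₁ (0 + 1) z = (4 : ℂ) • z) (h1 : A.mode w₁ (1 + 1) z = 0)
    (p0 : A.mode w₁ (2 + 1) (A.mode w₁ (2 + 1) z) = s0 • A.vac) :
    ∃ x0 : ℂ, D.proj z = x0 • quasiprimaryFour A.L A.vac ∧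
      ((1 / 2) * A.c ^ 2 + (11 / 5) * A.c) * x0 = s0 := by
  have hL := A.virasoroRelations
  have hv : ∀ n : ℤ, -1 ≤ n → A.L n A.vac = 0 := fun n => A.L_vac
  have t (n : ℤ) (hn : -1 ≤ n) {x : V} (hx : x ∈ A.commutant w₂) := L_apply_of_mem_commutant hω hn hx
  have k (n : ℤ) {x : V} (hx : x ∈ A.commutant w₂) := h.mode_mem_commutant n hx
  have hz0 : z ∈ A.degree 4 := by
    rw [A.mem_degree, t 0 (by norm_num) hz, h0]
    norm_num
  obtain ⟨x0, hx⟩ := A.exists_quasiprimary_four (D.proj_mem_virasoroSpan z)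
    (D.proj_mem_degree hz0) (by rw [← D.proj_L, t 1 (by norm_num) hz, h1, map_zero])
  refine ⟨x0, hx, ?_⟩
  · have e := congrArg (fun y => A.L 2 (A.L 2 y)) hx
    simp only [← D.proj_L, map_add, map_smul, hL.L_2_2_quasiprimaryFour hv] at e
    rw [t 2 (by norm_num) hz, t 2 (by norm_num) (k _ hz), p0, map_smul, D.proj_vac] at e
    refine smul_left_injective ℂ A.vac_ne_zero ?_
    simp only [e]
    module

theorem exists_proj_eq_six {z : V} {s0 s1 : ℂ} (hz : z ∈ A.commutant w₂)
    (h0 : A.mode w₁ (0 + 1) z = (6 : ℂ) • z) (h1 : A.mode w₁ (1 + 1) z = 0)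
    (p0 : A.mode w₁ (2 + 1) (A.mode w₁ (4 + 1) z) = s0 • A.vac)
    (p1 : A.mode w₁ (2 + 1) (A.mode w₁ (2 + 1) (A.mode w₁ (2 + 1) z)) = s1 • A.vac) :
    ∃ x0 x1 : ℂ, D.proj z = x0 • quasiprimarySixA A.L A.vac + x1 • quasiprimarySixB A.L A.vac ∧
      ((-4) * A.c ^ 2 + (-58 / 35) * A.c) * x0 + ((186 / 35) * A.c) * x1 = s0 ∧
      ((-36 / 5) * A.c ^ 2 + (-774 / 35) * A.c) * x0 + ((3 / 4) * A.c ^ 3 + (99 / 10) * A.c ^ 2 + (1128 / 35) * A.c) * x1 = s1 := by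
  have hL := A.virasoroRelations
  have hv : ∀ n : ℤ, -1 ≤ n → A.L n A.vac = 0 := fun n => A.L_vac
  have t (n : ℤ) (hn : -1 ≤ n) {x : V} (hx : x ∈ A.commutant w₂) := L_apply_of_mem_commutant hω hn hx
  have k (n : ℤ) {x : V} (hx : x ∈ A.commutant w₂) := h.mode_mem_commutant n hx
  have hz0 : z ∈ A.degree 6 := by
    rw [A.mem_degree, t 0 (by norm_num) hz, h0]
    norm_num
  obtain ⟨x0, x1, hx⟩ := A.exists_quasiprimary_six (D.proj_mem_virasoroSpan z)
    (D.proj_mem_degree hz0) (by rw [← D.proj_L, t 1 (by norm_num) hz, h1, map_zero])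
  refine ⟨x0, x1, hx, ?_, ?_⟩
  · have e := congrArg (fun y => A.L 2 (A.L 4 y)) hx
    simp only [← D.proj_L, map_add, map_smul, hL.L_2_4_quasiprimarySixA hv, hL.L_2_4_quasiprimarySixB hv] at e
    rw [t 4 (by norm_num) hz, t 2 (by norm_num) (k _ hz), p0, map_smul, D.proj_vac] at e
    refine smul_left_injective ℂ A.vac_ne_zero ?_
    simp only [e]
    module
  · have e := congrArg (fun y => A.L 2 (A.L 2 (A.L 2 y))) hx
    simp only [← D.proj_L, map_add, map_smul, hL.L_2_2_2_quasiprimarySixA hv, hL.L_2_2_2_quasiprimarySixB hv] at e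
    rw [t 2 (by norm_num) hz, t 2 (by norm_num) (k _ hz), t 2 (by norm_num) (k _ (k _ hz)), p1, map_smul, D.proj_vac] at e
    refine smul_left_injective ℂ A.vac_ne_zero ?_
    simp only [e]
    module

theorem exists_proj_eq_eight {z : V} {s0 s1 s2 : ℂ} (hz : z ∈ A.commutant w₂)
    (h0 : A.mode w₁ (0 + 1) z = (8 : ℂ) • z) (h1 : A.mode w₁ (1 + 1) z = 0)
    (p0 : A.mode w₁ (2 + 1) (A.mode w₁ (6 + 1) z) = s0 • A.vac)
    (p1 : A.mode w₁ (2 + 1) (A.mode w₁ (2 + 1) (A.mode w₁ (4 + 1) z)) = s1 • A.vac)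
    (p2 : A.mode w₁ (2 + 1) (A.mode w₁ (2 + 1) (A.mode w₁ (2 + 1) (A.mode w₁ (2 + 1) z))) = s2 • A.vac) :
    ∃ x0 x1 x2 : ℂ, D.proj z = x0 • quasiprimaryEightA A.L A.vac + x1 • quasiprimaryEightB A.L A.vac + x2 • quasiprimaryEightC A.L A.vac ∧
      ((25 / 3) * A.c ^ 2 + (55 / 63) * A.c) * x0 + ((-8) * A.c ^ 2 + (-166 / 35) * A.c) * x1 + ((-9) * A.c ^ 2 + (459 / 35) * A.c) * x2 = s0 ∧
      ((730 / 21) * A.c ^ 2 + (506 / 21) * A.c) * x0 + ((-4) * A.c ^ 3 + (-442 / 7) * A.c ^ 2 + (-3176 / 35) * A.c) * x1 + ((-114 / 7) * A.c ^ 2 + (4134 / 35) * A.c) * x2 = s1 ∧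
      ((698 / 7) * A.c ^ 2 + (5786 / 21) * A.c) * x0 + ((-72 / 5) * A.c ^ 3 + (-9036 / 35) * A.c ^ 2 + (-5028 / 7) * A.c) * x1 + ((3 / 2) * A.c ^ 4 + (198 / 5) * A.c ^ 3 + (8304 / 35) * A.c ^ 2 + (4518 / 7) * A.c) * x2 = s2 := by
  have hL := A.virasoroRelations
  have hv : ∀ n : ℤ, -1 ≤ n → A.L n A.vac = 0 := fun n => A.L_vac
  have t (n : ℤ) (hn : -1 ≤ n) {x : V} (hx : x ∈ A.commutant w₂) := L_apply_of_mem_commutant hω hn hx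
  have k (n : ℤ) {x : V} (hx : x ∈ A.commutant w₂) := h.mode_mem_commutant n hx
  have hz0 : z ∈ A.degree 8 := by
    rw [A.mem_degree, t 0 (by norm_num) hz, h0]
    norm_num
  obtain ⟨x0, x1, x2, hx⟩ := A.exists_quasiprimary_eight (D.proj_mem_virasoroSpan z)
    (D.proj_mem_degree hz0) (by rw [← D.proj_L, t 1 (by norm_num) hz, h1, map_zero])
  refine ⟨x0, x1, x2, hx, ?_, ?_, ?_⟩
  · have e := congrArg (fun y => A.L 2 (A.L 6 y)) hx
    simp only [← D.proj_L, map_add, map_smul, hL.L_2_6_quasiprimaryEightA hv, hL.L_2_6_quasiprimaryEightB hv, hL.L_2_6_quasiprimaryEightC hv] at e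
    rw [t 6 (by norm_num) hz, t 2 (by norm_num) (k _ hz), p0, map_smul, D.proj_vac] at e
    refine smul_left_injective ℂ A.vac_ne_zero ?_
    simp only [e]
    module
  · have e := congrArg (fun y => A.L 2 (A.L 2 (A.L 4 y))) hx
    simp only [← D.proj_L, map_add, map_smul, hL.L_2_2_4_quasiprimaryEightA hv, hL.L_2_2_4_quasiprimaryEightB hv, hL.L_2_2_4_quasiprimaryEightC hv] at e
    rw [t 4 (by norm_num) hz, t 2 (by norm_num) (k _ hz), t 2 (by norm_num) (k _ (k _ hz)), p1, map_smul, D.proj_vac] at e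
    refine smul_left_injective ℂ A.vac_ne_zero ?_
    simp only [e]
    module
  · have e := congrArg (fun y => A.L 2 (A.L 2 (A.L 2 (A.L 2 y)))) hx
    simp only [← D.proj_L, map_add, map_smul, hL.L_2_2_2_2_quasiprimaryEightA hv, hL.L_2_2_2_2_quasiprimaryEightB hv, hL.L_2_2_2_2_quasiprimaryEightC hv] at e
    rw [t 2 (by norm_num) hz, t 2 (by norm_num) (k _ hz), t 2 (by norm_num) (k _ (k _ hz)), t 2 (by norm_num) (k _ (k _ (k _ hz))), p2, map_smul, D.proj_vac] at e
    refine smul_left_injective ℂ A.vac_ne_zero ?_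
    simp only [e]
    module
end IsCommutingVirasoroPair

end VertexOperatorAlgebra

end Projection

/-- The pairing matrix of the quasi-primary vectors of weight eight at central charge `c`. -/
def pairingEight (c : ℂ) : Matrix (Fin 3) (Fin 3) ℂ :=
  !![(25 / 3) * c ^ 2 + (55 / 63) * c, (-8) * c ^ 2 + (-166 / 35) * c, (-9) * c ^ 2 + (459 / 35) * c;
      (730 / 21) * c ^ 2 + (506 / 21) * c, (-4) * c ^ 3 + (-442 / 7) * c ^ 2 + (-3176 / 35) * c, (-114 / 7) * c ^ 2 + (4134 / 35) * c;
      (698 / 7) * c ^ 2 + (5786 / 21) * c, (-72 / 5) * c ^ 3 + (-9036 / 35) * c ^ 2 + (-5028 / 7) * c, (3 / 2) * c ^ 4 + (198 / 5) * c ^ 3 + (8304 / 35) * c ^ 2 + (4518 / 7) * c]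

/-- The zeros are the excluded values of `e` and `c - e`, together with `1/2`. -/
theorem det_pairingEight (c : ℂ) : (pairingEight c).det =
    -(1 / 105) * (c ^ 3 * (5 * c + 22) ^ 2 * (2 * c - 1) * (7 * c + 68) * (5 * c + 3) *
      (3 * c + 46)) := by
  rw [pairingEight, Matrix.det_fin_three]
  simp
  ring

/-! ### Linear equations for the projections of the quasi-primary vectors of `w₁`. -/

section Pair

variable {V : Type*} [AddCommGroup V] [Module ℂ V] {A : VertexOperatorAlgebra V}

namespace VertexOperatorAlgebra

namespace IsCommutingVirasoroPair

variable {w₁ w₂ : V} {c₁ c₂ : ℂ} (h : A.IsCommutingVirasoroPair w₁ w₂ c₁ c₂)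
  (hω : w₁ + w₂ = A.ω) {ι : Type*} [DecidableEq ι] (D : VirasoroDecomposition A ι)
include h

theorem quasiprimaryTwo_mem_commutant :
    quasiprimaryTwo (fun n => A.mode w₁ (n + 1)) A.vac ∈ A.commutant w₂ := by
  have k (n : ℤ) {x : V} (hx : x ∈ A.commutant w₂) := h.mode_mem_commutant n hx
  rw [quasiprimaryTwo]
  apply_rules [Submodule.add_mem, Submodule.smul_mem, k, vac_mem_commutant]

include hω in
theorem proj_quasiprimaryTwo : ∃ x0 : ℂ,
    D.proj (quasiprimaryTwo (fun n => A.mode w₁ (n + 1)) A.vac) =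
      x0 • quasiprimaryTwo A.L A.vac ∧
      ((1 / 2) * A.c) * x0 =
        (1 / 2) * c₁ := by
  have hL := h.virasoro₁
  have hv : ∀ n : ℤ, -1 ≤ n → A.mode w₁ (n + 1) A.vac = 0 := fun n hn =>
    A.mode_vac_of_nonneg w₁ (n + 1) (by omega)
  exact h.exists_proj_eq_two hω D h.quasiprimaryTwo_mem_commutant (hL.L_zero_quasiprimaryTwo hv)
    (hL.L_one_quasiprimaryTwo hv) (hL.L_2_quasiprimaryTwo hv)

theorem quasiprimaryFour_mem_commutant :
    quasiprimaryFour (fun n => A.mode w₁ (n + 1)) A.vac ∈ A.commutant w₂ := by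
  have k (n : ℤ) {x : V} (hx : x ∈ A.commutant w₂) := h.mode_mem_commutant n hx
  rw [quasiprimaryFour]
  apply_rules [Submodule.add_mem, Submodule.smul_mem, k, vac_mem_commutant]

include hω in
theorem proj_quasiprimaryFour : ∃ x0 : ℂ,
    D.proj (quasiprimaryFour (fun n => A.mode w₁ (n + 1)) A.vac) =
      x0 • quasiprimaryFour A.L A.vac ∧
      ((1 / 2) * A.c ^ 2 + (11 / 5) * A.c) * x0 =
        (1 / 2) * c₁ ^ 2 + (11 / 5) * c₁ := by
  have hL := h.virasoro₁
  have hv : ∀ n : ℤ, -1 ≤ n → A.mode w₁ (n + 1) A.vac = 0 := fun n hn =>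
    A.mode_vac_of_nonneg w₁ (n + 1) (by omega)
  exact h.exists_proj_eq_four hω D h.quasiprimaryFour_mem_commutant (hL.L_zero_quasiprimaryFour hv)
    (hL.L_one_quasiprimaryFour hv) (hL.L_2_2_quasiprimaryFour hv)

theorem quasiprimarySixA_mem_commutant :
    quasiprimarySixA (fun n => A.mode w₁ (n + 1)) A.vac ∈ A.commutant w₂ := by
  have k (n : ℤ) {x : V} (hx : x ∈ A.commutant w₂) := h.mode_mem_commutant n hx
  rw [quasiprimarySixA]
  apply_rules [Submodule.add_mem, Submodule.smul_mem, k, vac_mem_commutant]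

include hω in
theorem proj_quasiprimarySixA : ∃ x0 x1 : ℂ,
    D.proj (quasiprimarySixA (fun n => A.mode w₁ (n + 1)) A.vac) =
      x0 • quasiprimarySixA A.L A.vac + x1 • quasiprimarySixB A.L A.vac ∧
      ((-4) * A.c ^ 2 + (-58 / 35) * A.c) * x0 + ((186 / 35) * A.c) * x1 =
        (-4) * c₁ ^ 2 + (-58 / 35) * c₁ ∧
      ((-36 / 5) * A.c ^ 2 + (-774 / 35) * A.c) * x0 + ((3 / 4) * A.c ^ 3 + (99 / 10) * A.c ^ 2 + (1128 / 35) * A.c) * x1 =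
        (-36 / 5) * c₁ ^ 2 + (-774 / 35) * c₁ := by
  have hL := h.virasoro₁
  have hv : ∀ n : ℤ, -1 ≤ n → A.mode w₁ (n + 1) A.vac = 0 := fun n hn =>
    A.mode_vac_of_nonneg w₁ (n + 1) (by omega)
  exact h.exists_proj_eq_six hω D h.quasiprimarySixA_mem_commutant (hL.L_zero_quasiprimarySixA hv)
    (hL.L_one_quasiprimarySixA hv) (hL.L_2_4_quasiprimarySixA hv) (hL.L_2_2_2_quasiprimarySixA hv)

theorem quasiprimaryEightA_mem_commutant :
    quasiprimaryEightA (fun n => A.mode w₁ (n + 1)) A.vac ∈ A.commutant w₂ := by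
  have k (n : ℤ) {x : V} (hx : x ∈ A.commutant w₂) := h.mode_mem_commutant n hx
  rw [quasiprimaryEightA]
  apply_rules [Submodule.add_mem, Submodule.smul_mem, k, vac_mem_commutant]

include hω in
theorem proj_quasiprimaryEightA : ∃ x0 x1 x2 : ℂ,
    D.proj (quasiprimaryEightA (fun n => A.mode w₁ (n + 1)) A.vac) =
      x0 • quasiprimaryEightA A.L A.vac + x1 • quasiprimaryEightB A.L A.vac + x2 • quasiprimaryEightC A.L A.vac ∧
      ((25 / 3) * A.c ^ 2 + (55 / 63) * A.c) * x0 + ((-8) * A.c ^ 2 + (-166 / 35) * A.c) * x1 + ((-9) * A.c ^ 2 + (459 / 35) * A.c) * x2 =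
        (25 / 3) * c₁ ^ 2 + (55 / 63) * c₁ ∧
      ((730 / 21) * A.c ^ 2 + (506 / 21) * A.c) * x0 + ((-4) * A.c ^ 3 + (-442 / 7) * A.c ^ 2 + (-3176 / 35) * A.c) * x1 + ((-114 / 7) * A.c ^ 2 + (4134 / 35) * A.c) * x2 =
        (730 / 21) * c₁ ^ 2 + (506 / 21) * c₁ ∧
      ((698 / 7) * A.c ^ 2 + (5786 / 21) * A.c) * x0 + ((-72 / 5) * A.c ^ 3 + (-9036 / 35) * A.c ^ 2 + (-5028 / 7) * A.c) * x1 + ((3 / 2) * A.c ^ 4 + (198 / 5) * A.c ^ 3 + (8304 / 35) * A.c ^ 2 + (4518 / 7) * A.c) * x2 =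
        (698 / 7) * c₁ ^ 2 + (5786 / 21) * c₁ := by
  have hL := h.virasoro₁
  have hv : ∀ n : ℤ, -1 ≤ n → A.mode w₁ (n + 1) A.vac = 0 := fun n hn =>
    A.mode_vac_of_nonneg w₁ (n + 1) (by omega)
  exact h.exists_proj_eq_eight hω D h.quasiprimaryEightA_mem_commutant (hL.L_zero_quasiprimaryEightA hv)
    (hL.L_one_quasiprimaryEightA hv) (hL.L_2_6_quasiprimaryEightA hv) (hL.L_2_2_4_quasiprimaryEightA hv) (hL.L_2_2_2_2_quasiprimaryEightA hv)

theorem quasiprimaryEightB_mem_commutant :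
    quasiprimaryEightB (fun n => A.mode w₁ (n + 1)) A.vac ∈ A.commutant w₂ := by
  have k (n : ℤ) {x : V} (hx : x ∈ A.commutant w₂) := h.mode_mem_commutant n hx
  rw [quasiprimaryEightB]
  apply_rules [Submodule.add_mem, Submodule.smul_mem, k, vac_mem_commutant]

include hω in
theorem proj_quasiprimaryEightB : ∃ x0 x1 x2 : ℂ,
    D.proj (quasiprimaryEightB (fun n => A.mode w₁ (n + 1)) A.vac) =
      x0 • quasiprimaryEightA A.L A.vac + x1 • quasiprimaryEightB A.L A.vac + x2 • quasiprimaryEightC A.L A.vac ∧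
      ((25 / 3) * A.c ^ 2 + (55 / 63) * A.c) * x0 + ((-8) * A.c ^ 2 + (-166 / 35) * A.c) * x1 + ((-9) * A.c ^ 2 + (459 / 35) * A.c) * x2 =
        (-8) * c₁ ^ 2 + (-166 / 35) * c₁ ∧
      ((730 / 21) * A.c ^ 2 + (506 / 21) * A.c) * x0 + ((-4) * A.c ^ 3 + (-442 / 7) * A.c ^ 2 + (-3176 / 35) * A.c) * x1 + ((-114 / 7) * A.c ^ 2 + (4134 / 35) * A.c) * x2 =
        (-4) * c₁ ^ 3 + (-442 / 7) * c₁ ^ 2 + (-3176 / 35) * c₁ ∧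
      ((698 / 7) * A.c ^ 2 + (5786 / 21) * A.c) * x0 + ((-72 / 5) * A.c ^ 3 + (-9036 / 35) * A.c ^ 2 + (-5028 / 7) * A.c) * x1 + ((3 / 2) * A.c ^ 4 + (198 / 5) * A.c ^ 3 + (8304 / 35) * A.c ^ 2 + (4518 / 7) * A.c) * x2 =
        (-72 / 5) * c₁ ^ 3 + (-9036 / 35) * c₁ ^ 2 + (-5028 / 7) * c₁ := by
  have hL := h.virasoro₁
  have hv : ∀ n : ℤ, -1 ≤ n → A.mode w₁ (n + 1) A.vac = 0 := fun n hn =>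
    A.mode_vac_of_nonneg w₁ (n + 1) (by omega)
  exact h.exists_proj_eq_eight hω D h.quasiprimaryEightB_mem_commutant (hL.L_zero_quasiprimaryEightB hv)
    (hL.L_one_quasiprimaryEightB hv) (hL.L_2_6_quasiprimaryEightB hv) (hL.L_2_2_4_quasiprimaryEightB hv) (hL.L_2_2_2_2_quasiprimaryEightB hv)

theorem quasiprimaryEightC_mem_commutant :
    quasiprimaryEightC (fun n => A.mode w₁ (n + 1)) A.vac ∈ A.commutant w₂ := by
  have k (n : ℤ) {x : V} (hx : x ∈ A.commutant w₂) := h.mode_mem_commutant n hx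
  rw [quasiprimaryEightC]
  apply_rules [Submodule.add_mem, Submodule.smul_mem, k, vac_mem_commutant]

include hω in
theorem proj_quasiprimaryEightC : ∃ x0 x1 x2 : ℂ,
    D.proj (quasiprimaryEightC (fun n => A.mode w₁ (n + 1)) A.vac) =
      x0 • quasiprimaryEightA A.L A.vac + x1 • quasiprimaryEightB A.L A.vac + x2 • quasiprimaryEightC A.L A.vac ∧
      ((25 / 3) * A.c ^ 2 + (55 / 63) * A.c) * x0 + ((-8) * A.c ^ 2 + (-166 / 35) * A.c) * x1 + ((-9) * A.c ^ 2 + (459 / 35) * A.c) * x2 =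
        (-9) * c₁ ^ 2 + (459 / 35) * c₁ ∧
      ((730 / 21) * A.c ^ 2 + (506 / 21) * A.c) * x0 + ((-4) * A.c ^ 3 + (-442 / 7) * A.c ^ 2 + (-3176 / 35) * A.c) * x1 + ((-114 / 7) * A.c ^ 2 + (4134 / 35) * A.c) * x2 =
        (-114 / 7) * c₁ ^ 2 + (4134 / 35) * c₁ ∧
      ((698 / 7) * A.c ^ 2 + (5786 / 21) * A.c) * x0 + ((-72 / 5) * A.c ^ 3 + (-9036 / 35) * A.c ^ 2 + (-5028 / 7) * A.c) * x1 + ((3 / 2) * A.c ^ 4 + (198 / 5) * A.c ^ 3 + (8304 / 35) * A.c ^ 2 + (4518 / 7) * A.c) * x2 =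
        (3 / 2) * c₁ ^ 4 + (198 / 5) * c₁ ^ 3 + (8304 / 35) * c₁ ^ 2 + (4518 / 7) * c₁ := by
  have hL := h.virasoro₁
  have hv : ∀ n : ℤ, -1 ≤ n → A.mode w₁ (n + 1) A.vac = 0 := fun n hn =>
    A.mode_vac_of_nonneg w₁ (n + 1) (by omega)
  exact h.exists_proj_eq_eight hω D h.quasiprimaryEightC_mem_commutant (hL.L_zero_quasiprimaryEightC hv)
    (hL.L_one_quasiprimaryEightC hv) (hL.L_2_6_quasiprimaryEightC hv) (hL.L_2_2_4_quasiprimaryEightC hv) (hL.L_2_2_2_2_quasiprimaryEightC hv)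

include hω D in
-- With the coefficients of the three projections as columns of a matrix, the linear equations say
-- that the pairing matrix at `c` times this matrix is the pairing matrix at `c₁`. Nondegeneracy is
-- therefore inherited by the total central charge.
theorem det_pairingEight_ne_zero (hc : (pairingEight c₁).det ≠ 0) :
    (pairingEight A.c).det ≠ 0 := by
  obtain ⟨x0, x1, x2, -, hx0, hx1, hx2⟩ := h.proj_quasiprimaryEightA hω D
  obtain ⟨y0, y1, y2, -, hy0, hy1, hy2⟩ := h.proj_quasiprimaryEightB hω D
  obtain ⟨z0, z1, z2, -, hz0, hz1, hz2⟩ := h.proj_quasiprimaryEightC hω D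
  simp only [neg_mul] at hx0 hx1 hx2 hy0 hy1 hy2 hz0 hz1 hz2
  have hm : pairingEight A.c * !![x0, y0, z0; x1, y1, z1; x2, y2, z2] = pairingEight c₁ := by
    ext i j
    fin_cases i <;> fin_cases j <;>
      simp only [pairingEight, Matrix.mul_apply, Fin.sum_univ_three] <;>
      simp <;> assumption
  rw [← hm, Matrix.det_mul] at hc
  exact left_ne_zero_of_mul hc
end IsCommutingVirasoroPair

end VertexOperatorAlgebra

end Pair

/-! ### Traces of zero modes on the lowest degree part of a module. -/

section

open Polynomial

namespace VOAModule

variable {V : Type*} [AddCommGroup V] [Module ℂ V] {A : VertexOperatorAlgebra V}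
  {W : Type*} [AddCommGroup W] [Module ℂ W] (M : VOAModule A W)

theorem coe_zeroMode_apply {μ : ℂ} {n : ℕ} {v : V} (hv : v ∈ A.homog n) (x : M.homog μ) :
    (M.zeroMode μ n v hv x : W) = M.mode v ((n : ℤ) - 1) x := rfl

theorem coe_aeval_zeroMode {μ : ℂ} {ν : V} (hν : ν ∈ A.homog 2) (p : ℂ[X]) (x : M.homog μ) :
    (aeval (M.zeroMode μ 2 ν hν) p x : W) = aeval (M.mode ν 1) p (x : W) := by
  induction p using Polynomial.induction_on' with
  | add p q hp hq => simp [hp, hq]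
  | monomial n a =>
    have h : ∀ (k : ℕ) (x : M.homog μ),
        ((M.zeroMode μ 2 ν hν ^ k) x : W) = (M.mode ν 1 ^ k) (x : W) := by
      intro k
      induction k with
      | zero => simp
      | succ k ih =>
        intro x
        rw [pow_succ, pow_succ, Module.End.mul_apply, Module.End.mul_apply, ih,
          M.coe_zeroMode_apply]
        norm_num
    simp [aeval_monomial, Module.algebraMap_end_eq_smul_id, h]

theorem finiteDimensional_homog (μ : ℂ) : FiniteDimensional ℂ (M.homog μ) := M.homog_finite μ

theorem zeroMode_eq_aeval {μ : ℂ} {ν : V} (hν : ν ∈ A.homog 2) {n : ℕ} {v : V}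
    (hv : v ∈ A.homog n) {k : ℤ} (hk : k = n) {p : ℂ[X]} (h : M.ActsBy ν (M.homog μ) v k p) :
    M.zeroMode μ n v hv = aeval (M.zeroMode μ 2 ν hν) p := by
  ext x
  rw [M.coe_aeval_zeroMode, M.coe_zeroMode_apply, ← h.zero x x.2, hk]

theorem zeroMode_omega (hω : A.ω ∈ A.homog 2) (μ : ℂ) :
    M.zeroMode μ 2 A.ω hω = algebraMap ℂ (Module.End ℂ (M.homog μ)) μ := by
  ext x
  rw [M.coe_zeroMode_apply, Module.algebraMap_end_apply]
  have := Module.End.mem_eigenspace_iff.1 x.2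
  norm_num
  exact this

theorem trace_aeval_omega (hω : A.ω ∈ A.homog 2) (μ : ℂ) (p : ℂ[X]) :
    LinearMap.trace ℂ (M.homog μ) (aeval (M.zeroMode μ 2 A.ω hω) p) =
      p.eval μ * Module.finrank ℂ (M.homog μ) := by
  have := M.finiteDimensional_homog μ
  rw [zeroMode_omega, aeval_algebraMap_apply_eq_algebraMap_eval, Algebra.algebraMap_eq_smul_one,
    map_smul, LinearMap.trace_one, smul_eq_mul]

/-- The lowest degree part of a module is annihilated by all operators of negative degree. -/
theorem HasConformalWeight.isHighestWeightSpace {h : ℂ} (hM : M.HasConformalWeight h) {ν : V}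
    (hν : ν ∈ A.homog 2) : M.IsHighestWeightSpace ν (M.homog h) where
  annihilate x hx i hi := by
    have h1 : M.mode ν i x ∈ M.homog (h + (2 : ℕ) - i - 1) :=
      M.mode_mem_homog (Module.End.mem_eigenspace_iff.1 hν) i hx
    by_contra hne
    obtain ⟨n, hn⟩ := hM.2 _ fun hbot => hne (by rwa [hbot, Submodule.mem_bot] at h1)
    have h2 : (1 - i : ℂ) = n := by
      push_cast at hn
      linear_combination hn
    have h3 : (1 - i : ℤ) = n := by exact_mod_cast h2
    omega
  stable x hx := by
    have h1 := M.zeroMode_mem h 2 ν hν x hx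
    norm_num at h1
    exact h1

/-- Comparison of the zero modes of `z` and `y` on the lowest degree part of a module. -/
theorem trace_eq_of_actsBy {h : ℂ} {ν : V}
    (hν : ν ∈ A.homog 2) (hω : A.ω ∈ A.homog 2) {n : ℕ} {z y : V} (hz : z ∈ A.homog n)
    (hy : y ∈ A.homog n) {k : ℤ} (hk : k = n) {p q : ℂ[X]}
    (hzp : M.ActsBy ν (M.homog h) z k p) (hyq : M.ActsBy A.ω (M.homog h) y k q)
    (htr : LinearMap.trace ℂ (M.homog h) (M.zeroMode h n z hz) =
      LinearMap.trace ℂ (M.homog h) (M.zeroMode h n y hy)) :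
    LinearMap.trace ℂ (M.homog h) (aeval (M.zeroMode h 2 ν hν) p) =
      q.eval h * Module.finrank ℂ (M.homog h) := by
  rw [M.zeroMode_eq_aeval hν hz hk hzp, M.zeroMode_eq_aeval hω hy hk hyq,
    M.trace_aeval_omega] at htr
  exact htr

end VOAModule

/-! ### Traces of zero modes on `V_2` when `V_1 = 0`. -/

namespace VertexOperatorAlgebra

variable {V : Type*} [AddCommGroup V] [Module ℂ V] {A : VertexOperatorAlgebra V}

theorem omega_mem_homog : A.ω ∈ A.homog 2 := by
  have h := A.L_mem_degree A.vac_mem_degree (-2)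
  rw [show A.L (-2) A.vac = A.ω from A.mode_vac A.ω] at h
  rw [homog_eq_degree]
  simpa using h

theorem mode_mem_degree_of_homog {ν : V} (hν : ν ∈ A.homog 2) {m n : ℤ} {x : V}
    (hx : x ∈ A.degree m) : A.mode ν n x ∈ A.degree (m + 1 - n) := by
  rw [homog_eq_degree] at hν
  have := A.mode_mem_degree (n := n) hν hx
  convert this using 2
  push_cast
  ring

/-- If `V_1 = 0`, the vectors `x ∈ V_2` with `ν_(3) x = 0` form a highest weight space. -/
theorem isHighestWeightSpace_of_degree_one (h1 : A.homog 1 = ⊥) {ν : V} {e : ℂ}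
    (hν : ν ∈ A.homog 2) (hvir : VirasoroRelations (fun n => A.mode ν (n + 1)) e) :
    A.selfModule.IsHighestWeightSpace ν (A.homog 2 ⊓ LinearMap.ker (A.mode ν 3)) where
  annihilate x hx i hi := by
    have hx2 := hx.1
    rw [SetLike.mem_coe, homog_eq_degree] at hx2
    have h2 : A.mode ν i x ∈ A.degree (2 + 1 - i) := mode_mem_degree_of_homog hν hx2
    change A.mode ν i x = 0
    obtain rfl | rfl | h4 : i = 2 ∨ i = 3 ∨ 4 ≤ i := by omega
    · have h3 : A.degree (2 + 1 - 2) = ⊥ := by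
        rw [← h1, homog_eq_degree]
        norm_num
      rwa [h3, Submodule.mem_bot] at h2
    · exact hx.2
    · exact A.eq_zero_of_mem_degree_neg (by omega) h2
  stable x hx := by
    have hx2 := hx.1
    rw [SetLike.mem_coe, homog_eq_degree] at hx2
    refine ⟨?_, ?_⟩
    · have h2 : A.mode ν 1 x ∈ A.degree (2 + 1 - 1) := mode_mem_degree_of_homog hν hx2
      rw [SetLike.mem_coe, homog_eq_degree]
      norm_num at h2 ⊢
      exact h2
    · have h3 : A.mode ν 3 x = 0 := hx.2
      have := hvir.apply_apply 2 0 x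
      norm_num at this
      rw [h3] at this
      change A.mode ν 3 (A.mode ν 1 x) = 0
      simpa using this

/-- The trace of the zero mode of `z` on `V_2`, if `V_1 = 0` and the zero mode of `z` on the highest
weight vectors for `ν` in `V_2` is the polynomial `p` in `ν_(1)`. -/
theorem trace_zeroMode_two (h1 : A.homog 1 = ⊥) {ν : V} {e : ℂ} (he : e ≠ 0)
    (hν : ν ∈ A.homog 2) (hvir : VirasoroRelations (fun n => A.mode ν (n + 1)) e)
    {n : ℕ} (hn : Even n) (hn2 : 2 ≤ n) {z : V} (hz : z ∈ A.homog n) {k : ℤ} (hk : k = n) {p : ℂ[X]}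
    (hzp : A.selfModule.ActsBy ν (A.homog 2 ⊓ LinearMap.ker (A.mode ν 3)) z k p) {s : ℂ}
    (hs : A.mode ν 3 (A.mode ν ((n : ℤ) - 1) z) = s • A.vac) :
    LinearMap.trace ℂ (A.selfModule.homog 2) (A.selfModule.zeroMode 2 n z hz) =
      LinearMap.trace ℂ (A.selfModule.homog 2) (aeval (A.selfModule.zeroMode 2 2 ν hν) p) -
        p.eval 2 + 2 / e * s := by
  have := A.selfModule.finiteDimensional_homog 2
  -- The functional `l` below reads off the scalar in `ν_(3) x ∈ V_0 = ℂ 1`; its kernel is the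
  -- highest weight space.
  obtain ⟨g, hg⟩ := Module.Projective.exists_dual_eq_one ℂ A.vac_ne_zero
  let l : A.selfModule.homog 2 →ₗ[ℂ] ℂ := g ∘ₗ A.mode ν 3 ∘ₗ (A.selfModule.homog 2).subtype
  have hd2 : ∀ x : A.selfModule.homog 2, (x : V) ∈ A.degree 2 := fun x => by
    rw [mem_degree, Int.cast_ofNat]
    exact Module.End.mem_eigenspace_iff.1 x.2
  have hl : ∀ x : A.selfModule.homog 2, A.mode ν 3 x = l x • A.vac := by
    intro x
    have h3 : A.mode ν 3 x ∈ A.degree (2 + 1 - 3) := mode_mem_degree_of_homog hν (hd2 x)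
    norm_num at h3
    rw [degree_zero] at h3
    obtain ⟨t, ht⟩ := Submodule.mem_span_singleton.1 h3
    have : l x = t := by
      change g (A.mode ν 3 x) = t
      rw [← ht, map_smul, hg, smul_eq_mul, mul_one]
    rw [this, ht]
  have hν' : ν ∈ A.selfModule.homog 2 := by
    have : A.homog 2 = A.selfModule.homog 2 := by
      rw [homog]
      norm_num
      rfl
    rwa [← this]
  have hνvac : A.mode ν (-1) A.vac = ν := A.mode_vac ν
  have hvv : ∀ j : ℤ, 0 ≤ j → A.mode ν j A.vac = 0 := A.mode_vac_of_nonneg ν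
  have hν1 : A.mode ν 1 ν = (2 : ℂ) • ν := by
    have := hvir.apply_apply 0 (-2) A.vac
    norm_num [hvv, hνvac] at this
    exact this
  have hν3 : l ⟨ν, hν'⟩ = e / 2 := by
    have := hvir.apply_apply 2 (-2) A.vac
    norm_num [hvv, hνvac] at this
    have h4 := hl ⟨ν, hν'⟩
    rw [this] at h4
    have := smul_left_injective ℂ A.vac_ne_zero h4
    rw [← this]
    ring
  -- The error of the polynomial formula vanishes on the hyperplane `l = 0`, so it has rank at most
  -- one and its trace is determined by its value at `ν`, where `l ν = e / 2 ≠ 0`.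
  set f := A.selfModule.zeroMode 2 n z hz - aeval (A.selfModule.zeroMode 2 2 ν hν) p with hf
  have hker : ∀ x, l x = 0 → f x = 0 := by
    intro x hx
    have h5 : (x : V) ∈ A.homog 2 ⊓ LinearMap.ker (A.mode ν 3) := by
      refine ⟨?_, ?_⟩
      · rw [SetLike.mem_coe, homog_eq_degree]
        exact hd2 x
      · rw [SetLike.mem_coe, LinearMap.mem_ker, hl, hx, zero_smul]
    ext
    rw [hf, LinearMap.sub_apply, Submodule.coe_sub, VOAModule.coe_aeval_zeroMode,
      VOAModule.coe_zeroMode_apply, ← hzp.zero _ h5, hk, sub_self, Submodule.coe_zero]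
  have hrank : f = l.smulRight ((2 / e) • f ⟨ν, hν'⟩) := by
    ext1 x
    have h6 := hker (x - (2 / e * l x) • ⟨ν, hν'⟩) (by
      rw [map_sub, map_smul, hν3, smul_eq_mul]
      field_simp
      ring)
    rw [map_sub, map_smul, sub_eq_zero] at h6
    rw [h6, LinearMap.smulRight_apply, smul_smul, mul_comm]
  have htr : LinearMap.trace ℂ (A.selfModule.homog 2) f = 2 / e * l (f ⟨ν, hν'⟩) := by
    conv_lhs => rw [hrank]
    rw [LinearMap.trace_smulRight, map_smul, smul_eq_mul]
  -- Skew symmetry has no correction terms: the products `ν_(i) z` with `i = n` lie in `V_1 = 0`,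
  -- and those with `i > n` in `V_0` or in negative degree. The sign is `+` because `n` is even.
  have hzν : A.mode z ((n : ℤ) - 1) ν = A.mode ν ((n : ℤ) - 1) z := by
    have hzd : z ∈ A.degree n := by rwa [homog_eq_degree] at hz
    have := A.mode_skew (u := ν) (v := z) (n - 1) (fun i hi => by
      have h7 : A.mode ν i z ∈ A.degree (n + 1 - i) := mode_mem_degree_of_homog hν hzd
      obtain h8 | h8 | h8 : i = n ∨ i = n + 1 ∨ n + 1 < i := by omega
      · have h9 : A.degree ((n : ℤ) + 1 - i) = ⊥ := by
          rw [← h1, homog_eq_degree]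
          congr 1
          push_cast
          omega
        rw [h9, Submodule.mem_bot] at h7
        rw [h7]
        exact Submodule.zero_mem _
      · rw [← degree_zero]
        convert h7 using 2
        omega
      · rw [A.eq_zero_of_mem_degree_neg (by omega) h7]
        exact Submodule.zero_mem _)
    rw [Nat.sub_add_cancel (by omega), hn.neg_one_pow, one_smul, Nat.cast_sub (by omega)] at this
    exact this
  have hlf : l (f ⟨ν, hν'⟩) = s - p.eval 2 * (e / 2) := by
    rw [hf, LinearMap.sub_apply, map_sub]
    congr 1
    · change g (A.mode ν 3 (A.mode z ((n : ℤ) - 1) ν)) = s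
      rw [hzν, hs, map_smul, hg, smul_eq_mul, mul_one]
    -- The vector `ν` is an eigenvector of `ν_(1)` with eigenvalue 2, nonzero since `l ν = e / 2`.
    · have h10 : aeval (A.selfModule.zeroMode 2 2 ν hν) p ⟨ν, hν'⟩ = p.eval 2 • ⟨ν, hν'⟩ := by
        refine Module.End.aeval_apply_of_hasEigenvector ⟨Module.End.mem_eigenspace_iff.2 ?_, ?_⟩
        · ext
          rw [VOAModule.coe_zeroMode_apply]
          norm_num
          exact hν1
        · intro h0
          rw [h0, map_zero] at hν3
          exact he (by linear_combination -2 * hν3)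
      rw [h10, map_smul, hν3, smul_eq_mul]
  rw [hf, map_sub, ← hf, hlf, sub_eq_iff_eq_add] at htr
  rw [htr]
  field_simp
  ring

end VertexOperatorAlgebra

end

/-! ### Design equations on the lowest degree part of a module. -/

section

open Polynomial VertexOperatorAlgebra

section

variable {V : Type*} [AddCommGroup V] [Module ℂ V] {A : VertexOperatorAlgebra V}

theorem VertexOperatorAlgebra.mem_homog_of_mem_commutant (n : ℕ) {w₁ w₂ : V} (hω : w₁ + w₂ = A.ω)
    {z : V} (hz : z ∈ A.commutant w₂) {k : ℂ} (h0 : A.mode w₁ (0 + 1) z = k • z)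
    (hk : k = n := by norm_num) : z ∈ A.homog n := by
  rw [homog, Module.End.mem_eigenspace_iff, L_apply_of_mem_commutant hω (by norm_num) hz, h0, hk]

namespace VOAModule

variable {w₁ w₂ : V} {c₁ c₂ : ℂ} (h : A.IsCommutingVirasoroPair w₁ w₂ c₁ c₂)
  (hω : w₁ + w₂ = A.ω) {ι : Type*} [DecidableEq ι] {D : VirasoroDecomposition A ι}
  {W : Type*} [AddCommGroup W] [Module ℂ W] (M : VOAModule A W) {μ : ℂ}
  (hM : M.HasConformalWeight μ) (hd : M.IsConformalDesign D 8 μ)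
include hω hM hd

/-- The lowest degree part is a highest weight space for both `w₁` and `ω`. On it `ω_(1)` is the
scalar `μ`, so the projected side of the design condition is a polynomial in `μ` times the
dimension. -/
theorem trace_quasiprimaryTwo : ∃ x0 : ℂ,
      ((1 / 2) * A.c) * x0 =
        (1 / 2) * c₁ ∧
      LinearMap.trace ℂ (M.homog μ) (M.zeroMode μ 2 w₁ h.mem₁) =
        (x0 * (μ)) * Module.finrank ℂ (M.homog μ) := by
  obtain ⟨x0, hproj, hx0⟩ := h.proj_quasiprimaryTwo hω D
  refine ⟨x0, hx0, ?_⟩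
  have hL := h.virasoro₁
  have hv : ∀ n : ℤ, -1 ≤ n → A.mode w₁ (n + 1) A.vac = 0 := fun n hn =>
    A.mode_vac_of_nonneg w₁ (n + 1) (by omega)
  have hz := mem_homog_of_mem_commutant (2) hω h.quasiprimaryTwo_mem_commutant (hL.L_zero_quasiprimaryTwo hv)
  have hvir : VirasoroRelations (fun n => A.mode A.ω (n + 1)) A.c := A.virasoro
  have hS := hM.isHighestWeightSpace M A.omega_mem_homog
  have hy := (ActsBy.quasiprimaryTwo hvir hS).smul x0
  have := M.trace_eq_of_actsBy h.mem₁ A.omega_mem_homog hz (D.proj_mem_homog hz) (by norm_num)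
    (ActsBy.quasiprimaryTwo hL (hM.isHighestWeightSpace M h.mem₁)) (hproj ▸ hy) (hd 2 (by norm_num) _ hz)
  simp only [map_add, map_mul, aeval_C, map_pow, aeval_X, ← Algebra.smul_def, map_smul, smul_eq_mul,
    eval_add, eval_mul, eval_C, eval_X, eval_pow] at this
  exact this

theorem trace_quasiprimaryFour : ∃ x0 : ℂ,
      ((1 / 2) * A.c ^ 2 + (11 / 5) * A.c) * x0 =
        (1 / 2) * c₁ ^ 2 + (11 / 5) * c₁ ∧
      LinearMap.trace ℂ (M.homog μ) ((M.zeroMode μ 2 w₁ h.mem₁) ^ 2) + (1 / 5) * LinearMap.trace ℂ (M.homog μ) (M.zeroMode μ 2 w₁ h.mem₁) =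
        (x0 * (μ ^ 2 + (1 / 5) * μ)) * Module.finrank ℂ (M.homog μ) := by
  obtain ⟨x0, hproj, hx0⟩ := h.proj_quasiprimaryFour hω D
  refine ⟨x0, hx0, ?_⟩
  have hL := h.virasoro₁
  have hv : ∀ n : ℤ, -1 ≤ n → A.mode w₁ (n + 1) A.vac = 0 := fun n hn =>
    A.mode_vac_of_nonneg w₁ (n + 1) (by omega)
  have hz := mem_homog_of_mem_commutant (4) hω h.quasiprimaryFour_mem_commutant (hL.L_zero_quasiprimaryFour hv)
  have hvir : VirasoroRelations (fun n => A.mode A.ω (n + 1)) A.c := A.virasoro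
  have hS := hM.isHighestWeightSpace M A.omega_mem_homog
  have hy := (ActsBy.quasiprimaryFour hvir hS).smul x0
  have := M.trace_eq_of_actsBy h.mem₁ A.omega_mem_homog hz (D.proj_mem_homog hz) (by norm_num)
    (ActsBy.quasiprimaryFour hL (hM.isHighestWeightSpace M h.mem₁)) (hproj ▸ hy) (hd 4 (by norm_num) _ hz)
  simp only [map_add, map_mul, aeval_C, map_pow, aeval_X, ← Algebra.smul_def, map_smul, smul_eq_mul,
    eval_add, eval_mul, eval_C, eval_X, eval_pow] at this
  exact this

theorem trace_quasiprimarySixA : ∃ x0 x1 : ℂ,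
      ((-4) * A.c ^ 2 + (-58 / 35) * A.c) * x0 + ((186 / 35) * A.c) * x1 =
        (-4) * c₁ ^ 2 + (-58 / 35) * c₁ ∧
      ((-36 / 5) * A.c ^ 2 + (-774 / 35) * A.c) * x0 + ((3 / 4) * A.c ^ 3 + (99 / 10) * A.c ^ 2 + (1128 / 35) * A.c) * x1 =
        (-36 / 5) * c₁ ^ 2 + (-774 / 35) * c₁ ∧
      (-4 / 5) * LinearMap.trace ℂ (M.homog μ) ((M.zeroMode μ 2 w₁ h.mem₁) ^ 2) + (-2 / 35) * LinearMap.trace ℂ (M.homog μ) (M.zeroMode μ 2 w₁ h.mem₁) =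
        (x0 * ((-4 / 5) * μ ^ 2 + (-2 / 35) * μ) + x1 * (μ ^ 3 + (3 / 5) * μ ^ 2 + (4 / 35) * μ)) * Module.finrank ℂ (M.homog μ) := by
  obtain ⟨x0, x1, hproj, hx0, hx1⟩ := h.proj_quasiprimarySixA hω D
  refine ⟨x0, x1, hx0, hx1, ?_⟩
  have hL := h.virasoro₁
  have hv : ∀ n : ℤ, -1 ≤ n → A.mode w₁ (n + 1) A.vac = 0 := fun n hn =>
    A.mode_vac_of_nonneg w₁ (n + 1) (by omega)
  have hz := mem_homog_of_mem_commutant (6) hω h.quasiprimarySixA_mem_commutant (hL.L_zero_quasiprimarySixA hv)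
  have hvir : VirasoroRelations (fun n => A.mode A.ω (n + 1)) A.c := A.virasoro
  have hS := hM.isHighestWeightSpace M A.omega_mem_homog
  have hy := ((ActsBy.quasiprimarySixA hvir hS).smul x0).add ((ActsBy.quasiprimarySixB hvir hS).smul x1)
  have := M.trace_eq_of_actsBy h.mem₁ A.omega_mem_homog hz (D.proj_mem_homog hz) (by norm_num)
    (ActsBy.quasiprimarySixA hL (hM.isHighestWeightSpace M h.mem₁)) (hproj ▸ hy) (hd 6 (by norm_num) _ hz)
  simp only [map_add, map_mul, aeval_C, map_pow, aeval_X, ← Algebra.smul_def, map_smul, smul_eq_mul,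
    eval_add, eval_mul, eval_C, eval_X, eval_pow] at this
  exact this

theorem trace_quasiprimaryEightA : ∃ x0 x1 x2 : ℂ,
      ((25 / 3) * A.c ^ 2 + (55 / 63) * A.c) * x0 + ((-8) * A.c ^ 2 + (-166 / 35) * A.c) * x1 + ((-9) * A.c ^ 2 + (459 / 35) * A.c) * x2 =
        (25 / 3) * c₁ ^ 2 + (55 / 63) * c₁ ∧
      ((730 / 21) * A.c ^ 2 + (506 / 21) * A.c) * x0 + ((-4) * A.c ^ 3 + (-442 / 7) * A.c ^ 2 + (-3176 / 35) * A.c) * x1 + ((-114 / 7) * A.c ^ 2 + (4134 / 35) * A.c) * x2 =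
        (730 / 21) * c₁ ^ 2 + (506 / 21) * c₁ ∧
      ((698 / 7) * A.c ^ 2 + (5786 / 21) * A.c) * x0 + ((-72 / 5) * A.c ^ 3 + (-9036 / 35) * A.c ^ 2 + (-5028 / 7) * A.c) * x1 + ((3 / 2) * A.c ^ 4 + (198 / 5) * A.c ^ 3 + (8304 / 35) * A.c ^ 2 + (4518 / 7) * A.c) * x2 =
        (698 / 7) * c₁ ^ 2 + (5786 / 21) * c₁ ∧
      (3 / 7) * LinearMap.trace ℂ (M.homog μ) ((M.zeroMode μ 2 w₁ h.mem₁) ^ 2) + (1 / 63) * LinearMap.trace ℂ (M.homog μ) (M.zeroMode μ 2 w₁ h.mem₁) =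
        (x0 * ((3 / 7) * μ ^ 2 + (1 / 63) * μ) + x1 * ((-4 / 5) * μ ^ 3 + (-26 / 35) * μ ^ 2 + (-2 / 35) * μ) + x2 * (μ ^ 4 + (6 / 5) * μ ^ 3 + (4 / 35) * μ ^ 2 + (3 / 35) * μ)) * Module.finrank ℂ (M.homog μ) := by
  obtain ⟨x0, x1, x2, hproj, hx0, hx1, hx2⟩ := h.proj_quasiprimaryEightA hω D
  refine ⟨x0, x1, x2, hx0, hx1, hx2, ?_⟩
  have hL := h.virasoro₁
  have hv : ∀ n : ℤ, -1 ≤ n → A.mode w₁ (n + 1) A.vac = 0 := fun n hn =>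
    A.mode_vac_of_nonneg w₁ (n + 1) (by omega)
  have hz := mem_homog_of_mem_commutant (8) hω h.quasiprimaryEightA_mem_commutant (hL.L_zero_quasiprimaryEightA hv)
  have hvir : VirasoroRelations (fun n => A.mode A.ω (n + 1)) A.c := A.virasoro
  have hS := hM.isHighestWeightSpace M A.omega_mem_homog
  have hy := (((ActsBy.quasiprimaryEightA hvir hS).smul x0).add ((ActsBy.quasiprimaryEightB hvir hS).smul x1)).add ((ActsBy.quasiprimaryEightC hvir hS).smul x2)
  have := M.trace_eq_of_actsBy h.mem₁ A.omega_mem_homog hz (D.proj_mem_homog hz) (by norm_num)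
    (ActsBy.quasiprimaryEightA hL (hM.isHighestWeightSpace M h.mem₁)) (hproj ▸ hy) (hd 8 (by norm_num) _ hz)
  simp only [map_add, map_mul, aeval_C, map_pow, aeval_X, ← Algebra.smul_def, map_smul, smul_eq_mul,
    eval_add, eval_mul, eval_C, eval_X, eval_pow] at this
  exact this
end VOAModule

end

end

/-! ### Design equations on `V_2`. -/

section

open Polynomial

namespace VertexOperatorAlgebra

variable {V : Type*} [AddCommGroup V] [Module ℂ V] {A : VertexOperatorAlgebra V}

theorem finrank_homog_two (A : VertexOperatorAlgebra V) :
    Module.finrank ℂ (A.homog 2) = Module.finrank ℂ (A.selfModule.homog 2) := by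
  have : A.homog 2 = A.selfModule.homog 2 := by
    rw [homog]
    norm_num
    rfl
  rw [this]

variable {w₁ w₂ : V} {c₁ c₂ : ℂ} (h : A.IsCommutingVirasoroPair w₁ w₂ c₁ c₂)
  (hω : w₁ + w₂ = A.ω) {ι : Type*} [DecidableEq ι] {D : VirasoroDecomposition A ι}
  (hc₁ : c₁ ≠ 0) (hc : A.c ≠ 0) (h1 : A.homog 1 = ⊥) (hd : A.selfModule.IsConformalDesign D 8 2)
include hω hc₁ hc h1 hd

/-- The trace formula on `V_2` is used twice, with `ν = w₁` for the vector and with `ν = ω` for its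
projection. In the second case `ω_(1) = 2`, which together with the rank one correction gives the
factor `d - 1`. -/
theorem trace_two_quasiprimaryTwo : ∃ x0 : ℂ,
      ((1 / 2) * A.c) * x0 =
        (1 / 2) * c₁ ∧
      LinearMap.trace ℂ (A.selfModule.homog 2) (A.selfModule.zeroMode 2 2 w₁ h.mem₁) -
          2 + 2 / c₁ * (c₁) =
        x0 * ((Module.finrank ℂ (A.homog 2) - 1) * (2) + 2 / A.c * (A.c)) := by
  obtain ⟨x0, hproj, hx0⟩ := h.proj_quasiprimaryTwo hω D
  refine ⟨x0, hx0, ?_⟩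
  have hL := h.virasoro₁
  have hv : ∀ n : ℤ, -1 ≤ n → A.mode w₁ (n + 1) A.vac = 0 := fun n hn =>
    A.mode_vac_of_nonneg w₁ (n + 1) (by omega)
  have hz := mem_homog_of_mem_commutant (2) hω h.quasiprimaryTwo_mem_commutant (hL.L_zero_quasiprimaryTwo hv)
  have hvir : VirasoroRelations (fun n => A.mode A.ω (n + 1)) A.c := A.virasoro
  have hv' : ∀ n : ℤ, -1 ≤ n → A.mode A.ω (n + 1) A.vac = 0 := fun n hn =>
    A.mode_vac_of_nonneg A.ω (n + 1) (by omega)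
  have hS := isHighestWeightSpace_of_degree_one h1 A.omega_mem_homog hvir
  have hy := (VOAModule.ActsBy.quasiprimaryTwo hvir hS).smul x0
  have e1 := trace_zeroMode_two h1 hc₁ h.mem₁ hL (n := 2) (by decide) (by norm_num) hz (by norm_num)
    (VOAModule.ActsBy.quasiprimaryTwo hL (isHighestWeightSpace_of_degree_one h1 h.mem₁ hL))
    (hL.L_2_0_quasiprimaryTwo hv)
  have e2 := trace_zeroMode_two h1 hc A.omega_mem_homog hvir (n := 2) (by decide) (by norm_num)
    (D.proj_mem_homog hz) (by norm_num) (hproj ▸ hy)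
    (s := x0 * (A.c)) (by
      rw [hproj]
      have t0 : A.mode A.ω 3 (A.mode A.ω 1 (quasiprimaryTwo A.L A.vac)) =
          (A.c) • A.vac := hvir.L_2_0_quasiprimaryTwo hv'
      change A.mode A.ω 3 (A.mode A.ω 1 _) = _
      simp only [map_add, map_smul, t0]
      module)
  have e3 := hd 2 (by norm_num) _ hz
  rw [e1, e2, VOAModule.trace_aeval_omega, ← A.finrank_homog_two] at e3
  simp only [map_add, map_mul, aeval_C, map_pow, aeval_X, ← Algebra.smul_def, map_smul, smul_eq_mul,
    eval_add, eval_mul, eval_C, eval_X, eval_pow] at e3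
  linear_combination e3

theorem trace_two_quasiprimaryFour : ∃ x0 : ℂ,
      ((1 / 2) * A.c ^ 2 + (11 / 5) * A.c) * x0 =
        (1 / 2) * c₁ ^ 2 + (11 / 5) * c₁ ∧
      LinearMap.trace ℂ (A.selfModule.homog 2) ((A.selfModule.zeroMode 2 2 w₁ h.mem₁) ^ 2) + (1 / 5) * LinearMap.trace ℂ (A.selfModule.homog 2) (A.selfModule.zeroMode 2 2 w₁ h.mem₁) -
          22 / 5 + 2 / c₁ * ((1 / 2) * c₁ ^ 2 + (11 / 5) * c₁) =
        x0 * ((Module.finrank ℂ (A.homog 2) - 1) * (22 / 5) + 2 / A.c * ((1 / 2) * A.c ^ 2 + (11 / 5) * A.c)) := by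
  obtain ⟨x0, hproj, hx0⟩ := h.proj_quasiprimaryFour hω D
  refine ⟨x0, hx0, ?_⟩
  have hL := h.virasoro₁
  have hv : ∀ n : ℤ, -1 ≤ n → A.mode w₁ (n + 1) A.vac = 0 := fun n hn =>
    A.mode_vac_of_nonneg w₁ (n + 1) (by omega)
  have hz := mem_homog_of_mem_commutant (4) hω h.quasiprimaryFour_mem_commutant (hL.L_zero_quasiprimaryFour hv)
  have hvir : VirasoroRelations (fun n => A.mode A.ω (n + 1)) A.c := A.virasoro
  have hv' : ∀ n : ℤ, -1 ≤ n → A.mode A.ω (n + 1) A.vac = 0 := fun n hn =>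
    A.mode_vac_of_nonneg A.ω (n + 1) (by omega)
  have hS := isHighestWeightSpace_of_degree_one h1 A.omega_mem_homog hvir
  have hy := (VOAModule.ActsBy.quasiprimaryFour hvir hS).smul x0
  have e1 := trace_zeroMode_two h1 hc₁ h.mem₁ hL (n := 4) (by decide) (by norm_num) hz (by norm_num)
    (VOAModule.ActsBy.quasiprimaryFour hL (isHighestWeightSpace_of_degree_one h1 h.mem₁ hL))
    (hL.L_2_2_quasiprimaryFour hv)
  have e2 := trace_zeroMode_two h1 hc A.omega_mem_homog hvir (n := 4) (by decide) (by norm_num)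
    (D.proj_mem_homog hz) (by norm_num) (hproj ▸ hy)
    (s := x0 * ((1 / 2) * A.c ^ 2 + (11 / 5) * A.c)) (by
      rw [hproj]
      have t0 : A.mode A.ω 3 (A.mode A.ω 3 (quasiprimaryFour A.L A.vac)) =
          ((1 / 2) * A.c ^ 2 + (11 / 5) * A.c) • A.vac := hvir.L_2_2_quasiprimaryFour hv'
      change A.mode A.ω 3 (A.mode A.ω 3 _) = _
      simp only [map_add, map_smul, t0]
      module)
  have e3 := hd 4 (by norm_num) _ hz
  rw [e1, e2, VOAModule.trace_aeval_omega, ← A.finrank_homog_two] at e3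
  simp only [map_add, map_mul, aeval_C, map_pow, aeval_X, ← Algebra.smul_def, map_smul, smul_eq_mul,
    eval_add, eval_mul, eval_C, eval_X, eval_pow] at e3
  linear_combination e3

theorem trace_two_quasiprimarySixA : ∃ x0 x1 : ℂ,
      ((-4) * A.c ^ 2 + (-58 / 35) * A.c) * x0 + ((186 / 35) * A.c) * x1 =
        (-4) * c₁ ^ 2 + (-58 / 35) * c₁ ∧
      ((-36 / 5) * A.c ^ 2 + (-774 / 35) * A.c) * x0 + ((3 / 4) * A.c ^ 3 + (99 / 10) * A.c ^ 2 + (1128 / 35) * A.c) * x1 =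
        (-36 / 5) * c₁ ^ 2 + (-774 / 35) * c₁ ∧
      (-4 / 5) * LinearMap.trace ℂ (A.selfModule.homog 2) ((A.selfModule.zeroMode 2 2 w₁ h.mem₁) ^ 2) + (-2 / 35) * LinearMap.trace ℂ (A.selfModule.homog 2) (A.selfModule.zeroMode 2 2 w₁ h.mem₁) -
          -116 / 35 + 2 / c₁ * ((-4) * c₁ ^ 2 + (-58 / 35) * c₁) =
        x0 * ((Module.finrank ℂ (A.homog 2) - 1) * (-116 / 35) + 2 / A.c * ((-4) * A.c ^ 2 + (-58 / 35) * A.c)) + x1 * ((Module.finrank ℂ (A.homog 2) - 1) * (372 / 35) + 2 / A.c * ((186 / 35) * A.c)) := by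
  obtain ⟨x0, x1, hproj, hx0, hx1⟩ := h.proj_quasiprimarySixA hω D
  refine ⟨x0, x1, hx0, hx1, ?_⟩
  have hL := h.virasoro₁
  have hv : ∀ n : ℤ, -1 ≤ n → A.mode w₁ (n + 1) A.vac = 0 := fun n hn =>
    A.mode_vac_of_nonneg w₁ (n + 1) (by omega)
  have hz := mem_homog_of_mem_commutant (6) hω h.quasiprimarySixA_mem_commutant (hL.L_zero_quasiprimarySixA hv)
  have hvir : VirasoroRelations (fun n => A.mode A.ω (n + 1)) A.c := A.virasoro
  have hv' : ∀ n : ℤ, -1 ≤ n → A.mode A.ω (n + 1) A.vac = 0 := fun n hn =>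
    A.mode_vac_of_nonneg A.ω (n + 1) (by omega)
  have hS := isHighestWeightSpace_of_degree_one h1 A.omega_mem_homog hvir
  have hy := ((VOAModule.ActsBy.quasiprimarySixA hvir hS).smul x0).add ((VOAModule.ActsBy.quasiprimarySixB hvir hS).smul x1)
  have e1 := trace_zeroMode_two h1 hc₁ h.mem₁ hL (n := 6) (by decide) (by norm_num) hz (by norm_num)
    (VOAModule.ActsBy.quasiprimarySixA hL (isHighestWeightSpace_of_degree_one h1 h.mem₁ hL))
    (hL.L_2_4_quasiprimarySixA hv)
  have e2 := trace_zeroMode_two h1 hc A.omega_mem_homog hvir (n := 6) (by decide) (by norm_num)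
    (D.proj_mem_homog hz) (by norm_num) (hproj ▸ hy)
    (s := x0 * ((-4) * A.c ^ 2 + (-58 / 35) * A.c) + x1 * ((186 / 35) * A.c)) (by
      rw [hproj]
      have t0 : A.mode A.ω 3 (A.mode A.ω 5 (quasiprimarySixA A.L A.vac)) =
          ((-4) * A.c ^ 2 + (-58 / 35) * A.c) • A.vac := hvir.L_2_4_quasiprimarySixA hv'
      have t1 : A.mode A.ω 3 (A.mode A.ω 5 (quasiprimarySixB A.L A.vac)) =
          ((186 / 35) * A.c) • A.vac := hvir.L_2_4_quasiprimarySixB hv'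
      change A.mode A.ω 3 (A.mode A.ω 5 _) = _
      simp only [map_add, map_smul, t0, t1]
      module)
  have e3 := hd 6 (by norm_num) _ hz
  rw [e1, e2, VOAModule.trace_aeval_omega, ← A.finrank_homog_two] at e3
  simp only [map_add, map_mul, aeval_C, map_pow, aeval_X, ← Algebra.smul_def, map_smul, smul_eq_mul,
    eval_add, eval_mul, eval_C, eval_X, eval_pow] at e3
  linear_combination e3

theorem trace_two_quasiprimaryEightA : ∃ x0 x1 x2 : ℂ,
      ((25 / 3) * A.c ^ 2 + (55 / 63) * A.c) * x0 + ((-8) * A.c ^ 2 + (-166 / 35) * A.c) * x1 + ((-9) * A.c ^ 2 + (459 / 35) * A.c) * x2 =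
        (25 / 3) * c₁ ^ 2 + (55 / 63) * c₁ ∧
      ((730 / 21) * A.c ^ 2 + (506 / 21) * A.c) * x0 + ((-4) * A.c ^ 3 + (-442 / 7) * A.c ^ 2 + (-3176 / 35) * A.c) * x1 + ((-114 / 7) * A.c ^ 2 + (4134 / 35) * A.c) * x2 =
        (730 / 21) * c₁ ^ 2 + (506 / 21) * c₁ ∧
      ((698 / 7) * A.c ^ 2 + (5786 / 21) * A.c) * x0 + ((-72 / 5) * A.c ^ 3 + (-9036 / 35) * A.c ^ 2 + (-5028 / 7) * A.c) * x1 + ((3 / 2) * A.c ^ 4 + (198 / 5) * A.c ^ 3 + (8304 / 35) * A.c ^ 2 + (4518 / 7) * A.c) * x2 =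
        (698 / 7) * c₁ ^ 2 + (5786 / 21) * c₁ ∧
      (3 / 7) * LinearMap.trace ℂ (A.selfModule.homog 2) ((A.selfModule.zeroMode 2 2 w₁ h.mem₁) ^ 2) + (1 / 63) * LinearMap.trace ℂ (A.selfModule.homog 2) (A.selfModule.zeroMode 2 2 w₁ h.mem₁) -
          110 / 63 + 2 / c₁ * ((25 / 3) * c₁ ^ 2 + (55 / 63) * c₁) =
        x0 * ((Module.finrank ℂ (A.homog 2) - 1) * (110 / 63) + 2 / A.c * ((25 / 3) * A.c ^ 2 + (55 / 63) * A.c)) + x1 * ((Module.finrank ℂ (A.homog 2) - 1) * (-332 / 35) + 2 / A.c * ((-8) * A.c ^ 2 + (-166 / 35) * A.c)) + x2 * ((Module.finrank ℂ (A.homog 2) - 1) * (918 / 35) + 2 / A.c * ((-9) * A.c ^ 2 + (459 / 35) * A.c)) := by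
  obtain ⟨x0, x1, x2, hproj, hx0, hx1, hx2⟩ := h.proj_quasiprimaryEightA hω D
  refine ⟨x0, x1, x2, hx0, hx1, hx2, ?_⟩
  have hL := h.virasoro₁
  have hv : ∀ n : ℤ, -1 ≤ n → A.mode w₁ (n + 1) A.vac = 0 := fun n hn =>
    A.mode_vac_of_nonneg w₁ (n + 1) (by omega)
  have hz := mem_homog_of_mem_commutant (8) hω h.quasiprimaryEightA_mem_commutant (hL.L_zero_quasiprimaryEightA hv)
  have hvir : VirasoroRelations (fun n => A.mode A.ω (n + 1)) A.c := A.virasoro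
  have hv' : ∀ n : ℤ, -1 ≤ n → A.mode A.ω (n + 1) A.vac = 0 := fun n hn =>
    A.mode_vac_of_nonneg A.ω (n + 1) (by omega)
  have hS := isHighestWeightSpace_of_degree_one h1 A.omega_mem_homog hvir
  have hy := (((VOAModule.ActsBy.quasiprimaryEightA hvir hS).smul x0).add ((VOAModule.ActsBy.quasiprimaryEightB hvir hS).smul x1)).add ((VOAModule.ActsBy.quasiprimaryEightC hvir hS).smul x2)
  have e1 := trace_zeroMode_two h1 hc₁ h.mem₁ hL (n := 8) (by decide) (by norm_num) hz (by norm_num)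
    (VOAModule.ActsBy.quasiprimaryEightA hL (isHighestWeightSpace_of_degree_one h1 h.mem₁ hL))
    (hL.L_2_6_quasiprimaryEightA hv)
  have e2 := trace_zeroMode_two h1 hc A.omega_mem_homog hvir (n := 8) (by decide) (by norm_num)
    (D.proj_mem_homog hz) (by norm_num) (hproj ▸ hy)
    (s := x0 * ((25 / 3) * A.c ^ 2 + (55 / 63) * A.c) + x1 * ((-8) * A.c ^ 2 + (-166 / 35) * A.c) + x2 * ((-9) * A.c ^ 2 + (459 / 35) * A.c)) (by
      rw [hproj]
      have t0 : A.mode A.ω 3 (A.mode A.ω 7 (quasiprimaryEightA A.L A.vac)) =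
          ((25 / 3) * A.c ^ 2 + (55 / 63) * A.c) • A.vac := hvir.L_2_6_quasiprimaryEightA hv'
      have t1 : A.mode A.ω 3 (A.mode A.ω 7 (quasiprimaryEightB A.L A.vac)) =
          ((-8) * A.c ^ 2 + (-166 / 35) * A.c) • A.vac := hvir.L_2_6_quasiprimaryEightB hv'
      have t2 : A.mode A.ω 3 (A.mode A.ω 7 (quasiprimaryEightC A.L A.vac)) =
          ((-9) * A.c ^ 2 + (459 / 35) * A.c) • A.vac := hvir.L_2_6_quasiprimaryEightC hv'
      change A.mode A.ω 3 (A.mode A.ω 7 _) = _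
      simp only [map_add, map_smul, t0, t1, t2]
      module)
  have e3 := hd 8 (by norm_num) _ hz
  rw [e1, e2, VOAModule.trace_aeval_omega, ← A.finrank_homog_two] at e3
  simp only [map_add, map_mul, aeval_C, map_pow, aeval_X, ← Algebra.smul_def, map_smul, smul_eq_mul,
    eval_add, eval_mul, eval_C, eval_X, eval_pow] at e3
  linear_combination e3
end VertexOperatorAlgebra

end

/-! ### Elimination in the numerical relations. -/

theorem eq_of_lowest_weight_relations {c e h N m1 m2 u0 v0 y0 y1 z0 z1 z2 : ℂ}
    (hN : N ≠ 0) (hh : h ≠ 0) (he0 : e ≠ 0) (hce : c - e ≠ 0) (hc0 : c ≠ 0)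
    (hc1 : 5 * c + 22 ≠ 0) (hc2 : 7 * c + 68 ≠ 0) (hc3 : 2 * c - 1 ≠ 0) (hc4 : 5 * c + 44 ≠ 0)
    (E20 : ((1 / 2) * c) * u0 =
      (1 / 2) * e)
    (T2 : m1 = (u0 * (h)) * N)
    (E40 : ((1 / 2) * c ^ 2 + (11 / 5) * c) * v0 =
      (1 / 2) * e ^ 2 + (11 / 5) * e)
    (T4 : m2 + (1 / 5) * m1 = (v0 * (h ^ 2 + (1 / 5) * h)) * N)
    (E60 : ((-4) * c ^ 2 + (-58 / 35) * c) * y0 + ((186 / 35) * c) * y1 =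
      (-4) * e ^ 2 + (-58 / 35) * e)
    (E61 : ((-36 / 5) * c ^ 2 + (-774 / 35) * c) * y0 + ((3 / 4) * c ^ 3 + (99 / 10) * c ^ 2 + (1128 / 35) * c) * y1 =
      (-36 / 5) * e ^ 2 + (-774 / 35) * e)
    (T6 : (-4 / 5) * m2 + (-2 / 35) * m1 = (y0 * ((-4 / 5) * h ^ 2 + (-2 / 35) * h) + y1 * (h ^ 3 + (3 / 5) * h ^ 2 + (4 / 35) * h)) * N)
    (E80 : ((25 / 3) * c ^ 2 + (55 / 63) * c) * z0 + ((-8) * c ^ 2 + (-166 / 35) * c) * z1 + ((-9) * c ^ 2 + (459 / 35) * c) * z2 =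
      (25 / 3) * e ^ 2 + (55 / 63) * e)
    (E81 : ((730 / 21) * c ^ 2 + (506 / 21) * c) * z0 + ((-4) * c ^ 3 + (-442 / 7) * c ^ 2 + (-3176 / 35) * c) * z1 + ((-114 / 7) * c ^ 2 + (4134 / 35) * c) * z2 =
      (730 / 21) * e ^ 2 + (506 / 21) * e)
    (E82 : ((698 / 7) * c ^ 2 + (5786 / 21) * c) * z0 + ((-72 / 5) * c ^ 3 + (-9036 / 35) * c ^ 2 + (-5028 / 7) * c) * z1 + ((3 / 2) * c ^ 4 + (198 / 5) * c ^ 3 + (8304 / 35) * c ^ 2 + (4518 / 7) * c) * z2 =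
      (698 / 7) * e ^ 2 + (5786 / 21) * e)
    (T8 : (3 / 7) * m2 + (1 / 63) * m1 = (z0 * ((3 / 7) * h ^ 2 + (1 / 63) * h) + z1 * ((-4 / 5) * h ^ 3 + (-26 / 35) * h ^ 2 + (-2 / 35) * h) + z2 * (h ^ 4 + (6 / 5) * h ^ 3 + (4 / 35) * h ^ 2 + (3 / 35) * h)) * N) :
    c = 142 / 5 ∧ h = 11 / 5 := by
  have M1 : c * m1 = (N * e * h) := by
    linear_combination c * T2 + 2 * (N * h) * E20
  have M2 : ((1 / 2) * c ^ 2 + (11 / 5) * c) * m2 = ((1 / 2) * N * e ^ 2 * h ^ 2 + (11 / 5) * N * e * h ^ 2 + (1 / 10) * N * e ^ 2 * h + (11 / 25) * N * e * h) - ((1 / 2) * c ^ 2 + (11 / 5) * c) * (1 / 5) * m1 := by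
    linear_combination ((1 / 2) * c ^ 2 + (11 / 5) * c) * T4 + (N * h ^ 2 + (1 / 5) * N * h) * E40
  -- Cramer's rule. The coefficient on the left is the determinant of the weight 6 pairings divided
  -- by `c`, namely `-(3/70) c (5c+22) (2c-1) (7c+68)`.
  have X60 : ((-3) * c ^ 4 + (-2859 / 70) * c ^ 3 + (-3747 / 35) * c ^ 2 + (2244 / 35) * c) * y0 = ((-3) * c ^ 2 * e ^ 2 + (-198 / 5) * c * e ^ 2 + (-87 / 70) * c ^ 2 * e + (-2871 / 175) * c * e + (-15864 / 175) * e ^ 2 + (2244 / 35) * e) := by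
    linear_combination ((3 / 4) * c ^ 2 + (99 / 10) * c + (1128 / 35)) * E60 + ((-186 / 35)) * E61
  have X61 : ((-3) * c ^ 4 + (-2859 / 70) * c ^ 3 + (-3747 / 35) * c ^ 2 + (2244 / 35) * c) * y1 = ((13392 / 175) * c * e + (-13392 / 175) * e ^ 2) := by
    linear_combination ((36 / 5) * c + (774 / 35)) * E60 + ((-4) * c + (-58 / 35)) * E61
  -- Eliminating `m1`, `m2`, `y0`, `y1` gives an expression quadratic in `e` that vanishes at `e =
  -- 0` and `e = c`; `R6` is what remains after `e (c - e)` and other nonzero factors are cancelled.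
  -- `R8` arises in the same way.
  have R6 : ((31) * c * h + (-1) * c ^ 2 + (-248) * h ^ 2 + (-7) * c + (124) * h + (-4)) = 0 := by
    have : N * e * (c - e) * c * c * h * (5 * c + 22) * ((31) * c * h + (-1) * c ^ 2 + (-248) * h ^ 2 + (-7) * c + (124) * h + (-4)) = 0 := by
      linear_combination (875 / 27) * (((-3) * c ^ 4 + (-2859 / 70) * c ^ 3 + (-3747 / 35) * c ^ 2 + (2244 / 35) * c) * c * ((1 / 2) * c ^ 2 + (11 / 5) * c) * T6 - ((-3) * c ^ 4 + (-2859 / 70) * c ^ 3 + (-3747 / 35) * c ^ 2 + (2244 / 35) * c) * (-4 / 5) * c * M2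
        - ((-3) * c ^ 4 + (-2859 / 70) * c ^ 3 + (-3747 / 35) * c ^ 2 + (2244 / 35) * c) * (18 / 175) * ((1 / 2) * c ^ 2 + (11 / 5) * c) * M1 + c * ((1 / 2) * c ^ 2 + (11 / 5) * c) * (((-4 / 5) * N * h ^ 2 + (-2 / 35) * N * h) * X60 + (N * h ^ 3 + (3 / 5) * N * h ^ 2 + (4 / 35) * N * h) * X61))
    refine (mul_eq_zero.1 this).resolve_left ?_
    simp [*]
  -- Cramer's rule again, with the common factor `c ^ 2 * (5 * c + 22)` removed from the determinant
  -- of weight 8.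
  have X80 : ((-10) * c ^ 6 + (-6205 / 21) * c ^ 5 + (-39271 / 15) * c ^ 4 + (-706096 / 105) * c ^ 3 + (2564 / 21) * c ^ 2 + (68816 / 35) * c) * z0 = ((-10) * c ^ 4 * e ^ 2 + (-2061 / 7) * c ^ 3 * e ^ 2 + (-22 / 21) * c ^ 4 * e + (-645896 / 245) * c ^ 2 * e ^ 2 + (13409 / 735) * c ^ 3 * e + (-302780 / 49) * c * e ^ 2 + (-400972 / 735) * c ^ 2 * e + (-1938068 / 735) * c * e + (675936 / 245) * e ^ 2 + (68816 / 35) * e) := by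
    linear_combination ((-6 / 5) * c ^ 4 + (-1587 / 35) * c ^ 3 + (-19758 / 35) * c ^ 2 + (-78684 / 35) * c + (41796 / 35)) * E80 + ((12 / 5) * c ^ 3 + (561 / 7) * c ^ 2 + (17202 / 35) * c + (-10116 / 35)) * E81 + ((-36 / 5) * c ^ 2 + (-318 / 7) * c + (1002 / 35)) * E82
  have X81 : ((-10) * c ^ 6 + (-6205 / 21) * c ^ 5 + (-39271 / 15) * c ^ 4 + (-706096 / 105) * c ^ 3 + (2564 / 21) * c ^ 2 + (68816 / 35) * c) * z1 = ((-22550 / 441) * c ^ 2 * e ^ 2 + (22550 / 441) * c ^ 3 * e + (-496100 / 441) * c * e ^ 2 + (496100 / 441) * c ^ 2 * e + (-1897808 / 735) * c * e + (1897808 / 735) * e ^ 2) := by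
    linear_combination ((-73 / 7) * c ^ 3 + (-8283 / 35) * c ^ 2 + (-39334 / 35) * c + (27032 / 35)) * E80 + ((5 / 2) * c ^ 3 + (2321 / 42) * c ^ 2 + (35561 / 105) * c + (-4852 / 35)) * E81 + ((-248 / 7) * c + (1016 / 105)) * E82
  have X82 : ((-10) * c ^ 6 + (-6205 / 21) * c ^ 5 + (-39271 / 15) * c ^ 4 + (-706096 / 105) * c ^ 3 + (2564 / 21) * c ^ 2 + (68816 / 35) * c) * z2 = ((187616 / 147) * c * e ^ 2 + (-187616 / 147) * c ^ 2 * e + (-4408976 / 2205) * c * e + (4408976 / 2205) * e ^ 2) := by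
    linear_combination ((-712 / 35) * c ^ 2 + (-30988 / 105) * c + (36724 / 105)) * E80 + ((24) * c ^ 2 + (5868 / 35) * c + (-3244 / 105)) * E81 + ((-20 / 3) * c ^ 2 + (-1322 / 63) * c + (502 / 315)) * E82
  have R8 : ((255840) * c * h ^ 3 + (8200) * c ^ 2 * h ^ 2 + (-3690) * c ^ 3 * h + (140) * c ^ 4 + (487408) * c * h ^ 2 + (-89011) * c ^ 2 * h + (3384) * c ^ 3 + (400816) * h ^ 3 + (-327754) * c * h + (18169) * c ^ 2 + (66912) * h ^ 2 + (16422) * c + (-140056) * h + (5880)) = 0 := by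
    have : N * e * (c - e) * c * c * h * (5 * c + 22) * ((255840) * c * h ^ 3 + (8200) * c ^ 2 * h ^ 2 + (-3690) * c ^ 3 * h + (140) * c ^ 4 + (487408) * c * h ^ 2 + (-89011) * c ^ 2 * h + (3384) * c ^ 3 + (400816) * h ^ 3 + (-327754) * c * h + (18169) * c ^ 2 + (66912) * h ^ 2 + (16422) * c + (-140056) * h + (5880)) = 0 := by
      linear_combination (22050 / 11) * (((-10) * c ^ 6 + (-6205 / 21) * c ^ 5 + (-39271 / 15) * c ^ 4 + (-706096 / 105) * c ^ 3 + (2564 / 21) * c ^ 2 + (68816 / 35) * c) * c * ((1 / 2) * c ^ 2 + (11 / 5) * c) * T8 - ((-10) * c ^ 6 + (-6205 / 21) * c ^ 5 + (-39271 / 15) * c ^ 4 + (-706096 / 105) * c ^ 3 + (2564 / 21) * c ^ 2 + (68816 / 35) * c) * (3 / 7) * c * M2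
        - ((-10) * c ^ 6 + (-6205 / 21) * c ^ 5 + (-39271 / 15) * c ^ 4 + (-706096 / 105) * c ^ 3 + (2564 / 21) * c ^ 2 + (68816 / 35) * c) * (-22 / 315) * ((1 / 2) * c ^ 2 + (11 / 5) * c) * M1 + c * ((1 / 2) * c ^ 2 + (11 / 5) * c) * (((3 / 7) * N * h ^ 2 + (1 / 63) * N * h) * X80 + ((-4 / 5) * N * h ^ 3 + (-26 / 35) * N * h ^ 2 + (-2 / 35) * N * h) * X81 + (N * h ^ 4 + (6 / 5) * N * h ^ 3 + (4 / 35) * N * h ^ 2 + (3 / 35) * N * h) * X82))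
    refine (mul_eq_zero.1 this).resolve_left ?_
    simp [*]
  -- The remainder of the cubic `R8` on division by the quadratic `R6` in `h` is linear in `h`.
  -- Substituting its root back into `R6` determines `c`.
  have h1 : (7 * c + 68) * (2 * c - 1) * (5 * c + 44) * (3 * c + 5 - 41 * h) = 0 := by
    linear_combination (-124 / 13) * (R8 - ((-31980 / 31) * c * h + (-10045 / 62) * c ^ 2 + (-332715 / 124) * c + (-50102 / 31) * h + (-33415 / 31)) * R6)
  have h2 : h = (3 * c + 5) / 41 := by
    have := (mul_eq_zero.1 h1).resolve_left (mul_ne_zero (mul_ne_zero hc2 hc3) hc4)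
    linear_combination -(1 / 41) * this
  have h3 : (5 * c + 22) * (5 * c - 142) = 0 := by
    rw [h2] at R6
    linear_combination (-1681 / 4) * R6
  have h4 : c = 142 / 5 := by
    linear_combination (1 / 5) * (mul_eq_zero.1 h3).resolve_left hc1
  refine ⟨h4, ?_⟩
  rw [h2, h4]
  norm_num

theorem eq_of_degree_two_relations {c e d m1 m2 u0 v0 y0 y1 z0 z1 z2 : ℂ}
    (he0 : e ≠ 0) (hce : c - e ≠ 0) (hc0 : c ≠ 0)
    (hc1 : 5 * c + 22 ≠ 0) (hc2 : 7 * c + 68 ≠ 0) (hc3 : 2 * c - 1 ≠ 0) (hc4 : 5 * c + 44 ≠ 0)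
    (E20 : ((1 / 2) * c) * u0 =
      (1 / 2) * e)
    (T2 : m1 - 2 + 2 / e * (e) =
      u0 * ((d - 1) * (2) + 2 / c * (c)))
    (E40 : ((1 / 2) * c ^ 2 + (11 / 5) * c) * v0 =
      (1 / 2) * e ^ 2 + (11 / 5) * e)
    (T4 : m2 + (1 / 5) * m1 - 22 / 5 + 2 / e * ((1 / 2) * e ^ 2 + (11 / 5) * e) =
      v0 * ((d - 1) * (22 / 5) + 2 / c * ((1 / 2) * c ^ 2 + (11 / 5) * c)))
    (E60 : ((-4) * c ^ 2 + (-58 / 35) * c) * y0 + ((186 / 35) * c) * y1 =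
      (-4) * e ^ 2 + (-58 / 35) * e)
    (E61 : ((-36 / 5) * c ^ 2 + (-774 / 35) * c) * y0 + ((3 / 4) * c ^ 3 + (99 / 10) * c ^ 2 + (1128 / 35) * c) * y1 =
      (-36 / 5) * e ^ 2 + (-774 / 35) * e)
    (T6 : (-4 / 5) * m2 + (-2 / 35) * m1 - -116 / 35 + 2 / e * ((-4) * e ^ 2 + (-58 / 35) * e) =
      y0 * ((d - 1) * (-116 / 35) + 2 / c * ((-4) * c ^ 2 + (-58 / 35) * c)) + y1 * ((d - 1) * (372 / 35) + 2 / c * ((186 / 35) * c)))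
    (E80 : ((25 / 3) * c ^ 2 + (55 / 63) * c) * z0 + ((-8) * c ^ 2 + (-166 / 35) * c) * z1 + ((-9) * c ^ 2 + (459 / 35) * c) * z2 =
      (25 / 3) * e ^ 2 + (55 / 63) * e)
    (E81 : ((730 / 21) * c ^ 2 + (506 / 21) * c) * z0 + ((-4) * c ^ 3 + (-442 / 7) * c ^ 2 + (-3176 / 35) * c) * z1 + ((-114 / 7) * c ^ 2 + (4134 / 35) * c) * z2 =
      (730 / 21) * e ^ 2 + (506 / 21) * e)
    (E82 : ((698 / 7) * c ^ 2 + (5786 / 21) * c) * z0 + ((-72 / 5) * c ^ 3 + (-9036 / 35) * c ^ 2 + (-5028 / 7) * c) * z1 + ((3 / 2) * c ^ 4 + (198 / 5) * c ^ 3 + (8304 / 35) * c ^ 2 + (4518 / 7) * c) * z2 =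
      (698 / 7) * e ^ 2 + (5786 / 21) * e)
    (T8 : (3 / 7) * m2 + (1 / 63) * m1 - 110 / 63 + 2 / e * ((25 / 3) * e ^ 2 + (55 / 63) * e) =
      z0 * ((d - 1) * (110 / 63) + 2 / c * ((25 / 3) * c ^ 2 + (55 / 63) * c)) + z1 * ((d - 1) * (-332 / 35) + 2 / c * ((-8) * c ^ 2 + (-166 / 35) * c)) + z2 * ((d - 1) * (918 / 35) + 2 / c * ((-9) * c ^ 2 + (459 / 35) * c))) :
    c = 24 ∧ d = 196884 ∨ c = 142 / 5 ∧ d = -164081 := by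
  have hE : 2 / e * e = 2 := div_mul_cancel₀ 2 he0
  have hC : 2 / c * c = 2 := div_mul_cancel₀ 2 hc0
  -- All pairings are divisible by the central charge, so `2 / e` and `2 / c` can be eliminated
  -- through `E * e = 2` and `C * c = 2`.
  generalize 2 / e = E at hE T2 T4 T6 T8
  generalize 2 / c = C at hC T2 T4 T6 T8
  have T2 : m1 - 0 = u0 * ((2) * d) := by
    linear_combination T2 - ((1)) * hE + (u0 * ((1))) * hC
  have T4 : m2 + (1 / 5) * m1 - ((-1) * e) = v0 * (c + (22 / 5) * d) := by
    linear_combination T4 - ((1 / 2) * e + (11 / 5)) * hE + (v0 * ((1 / 2) * c + (11 / 5))) * hC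
  have T6 : (-4 / 5) * m2 + (-2 / 35) * m1 - ((8) * e) = y0 * ((-8) * c + (-116 / 35) * d) + y1 * ((372 / 35) * d) := by
    linear_combination T6 - ((-4) * e + (-58 / 35)) * hE + (y0 * ((-4) * c + (-58 / 35)) + y1 * ((186 / 35))) * hC
  have T8 : (3 / 7) * m2 + (1 / 63) * m1 - ((-50 / 3) * e) = z0 * ((50 / 3) * c + (110 / 63) * d) + z1 * ((-16) * c + (-332 / 35) * d) + z2 * ((-18) * c + (918 / 35) * d) := by
    linear_combination T8 - ((25 / 3) * e + (55 / 63)) * hE + (z0 * ((25 / 3) * c + (55 / 63)) + z1 * ((-8) * c + (-166 / 35)) + z2 * ((-9) * c + (459 / 35))) * hC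
  have M1 : c * m1 = ((2) * d * e) := by
    linear_combination c * T2 + 2 * ((2) * d) * E20
  have M2 : ((1 / 2) * c ^ 2 + (11 / 5) * c) * m2 = ((1 / 2) * c * e ^ 2 + (-1 / 2) * c ^ 2 * e + (11 / 5) * d * e ^ 2 + (242 / 25) * d * e) - ((1 / 2) * c ^ 2 + (11 / 5) * c) * (1 / 5) * m1 := by
    linear_combination ((1 / 2) * c ^ 2 + (11 / 5) * c) * T4 + (c + (22 / 5) * d) * E40
  have X60 : ((-3) * c ^ 4 + (-2859 / 70) * c ^ 3 + (-3747 / 35) * c ^ 2 + (2244 / 35) * c) * y0 = ((-3) * c ^ 2 * e ^ 2 + (-198 / 5) * c * e ^ 2 + (-87 / 70) * c ^ 2 * e + (-2871 / 175) * c * e + (-15864 / 175) * e ^ 2 + (2244 / 35) * e) := by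
    linear_combination ((3 / 4) * c ^ 2 + (99 / 10) * c + (1128 / 35)) * E60 + ((-186 / 35)) * E61
  have X61 : ((-3) * c ^ 4 + (-2859 / 70) * c ^ 3 + (-3747 / 35) * c ^ 2 + (2244 / 35) * c) * y1 = ((13392 / 175) * c * e + (-13392 / 175) * e ^ 2) := by
    linear_combination ((36 / 5) * c + (774 / 35)) * E60 + ((-4) * c + (-58 / 35)) * E61
  have R6 : ((-2) * c ^ 2 * d + (70) * c ^ 3 + (110) * c * d + (955) * c ^ 2 + (2388) * c + (-1496) * d) = 0 := by
    have : e * (c - e) * c * c * (5 * c + 22) * ((-2) * c ^ 2 * d + (70) * c ^ 3 + (110) * c * d + (955) * c ^ 2 + (2388) * c + (-1496) * d) = 0 := by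
      linear_combination (875 / 27) * (((-3) * c ^ 4 + (-2859 / 70) * c ^ 3 + (-3747 / 35) * c ^ 2 + (2244 / 35) * c) * c * ((1 / 2) * c ^ 2 + (11 / 5) * c) * T6 - ((-3) * c ^ 4 + (-2859 / 70) * c ^ 3 + (-3747 / 35) * c ^ 2 + (2244 / 35) * c) * (-4 / 5) * c * M2
        - ((-3) * c ^ 4 + (-2859 / 70) * c ^ 3 + (-3747 / 35) * c ^ 2 + (2244 / 35) * c) * (18 / 175) * ((1 / 2) * c ^ 2 + (11 / 5) * c) * M1 + c * ((1 / 2) * c ^ 2 + (11 / 5) * c) * (((-8) * c + (-116 / 35) * d) * X60 + ((372 / 35) * d) * X61))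
    refine (mul_eq_zero.1 this).resolve_left ?_
    simp [*]
  have X80 : ((-10) * c ^ 6 + (-6205 / 21) * c ^ 5 + (-39271 / 15) * c ^ 4 + (-706096 / 105) * c ^ 3 + (2564 / 21) * c ^ 2 + (68816 / 35) * c) * z0 = ((-10) * c ^ 4 * e ^ 2 + (-2061 / 7) * c ^ 3 * e ^ 2 + (-22 / 21) * c ^ 4 * e + (-645896 / 245) * c ^ 2 * e ^ 2 + (13409 / 735) * c ^ 3 * e + (-302780 / 49) * c * e ^ 2 + (-400972 / 735) * c ^ 2 * e + (-1938068 / 735) * c * e + (675936 / 245) * e ^ 2 + (68816 / 35) * e) := by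
    linear_combination ((-6 / 5) * c ^ 4 + (-1587 / 35) * c ^ 3 + (-19758 / 35) * c ^ 2 + (-78684 / 35) * c + (41796 / 35)) * E80 + ((12 / 5) * c ^ 3 + (561 / 7) * c ^ 2 + (17202 / 35) * c + (-10116 / 35)) * E81 + ((-36 / 5) * c ^ 2 + (-318 / 7) * c + (1002 / 35)) * E82
  have X81 : ((-10) * c ^ 6 + (-6205 / 21) * c ^ 5 + (-39271 / 15) * c ^ 4 + (-706096 / 105) * c ^ 3 + (2564 / 21) * c ^ 2 + (68816 / 35) * c) * z1 = ((-22550 / 441) * c ^ 2 * e ^ 2 + (22550 / 441) * c ^ 3 * e + (-496100 / 441) * c * e ^ 2 + (496100 / 441) * c ^ 2 * e + (-1897808 / 735) * c * e + (1897808 / 735) * e ^ 2) := by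
    linear_combination ((-73 / 7) * c ^ 3 + (-8283 / 35) * c ^ 2 + (-39334 / 35) * c + (27032 / 35)) * E80 + ((5 / 2) * c ^ 3 + (2321 / 42) * c ^ 2 + (35561 / 105) * c + (-4852 / 35)) * E81 + ((-248 / 7) * c + (1016 / 105)) * E82
  have X82 : ((-10) * c ^ 6 + (-6205 / 21) * c ^ 5 + (-39271 / 15) * c ^ 4 + (-706096 / 105) * c ^ 3 + (2564 / 21) * c ^ 2 + (68816 / 35) * c) * z2 = ((187616 / 147) * c * e ^ 2 + (-187616 / 147) * c ^ 2 * e + (-4408976 / 2205) * c * e + (4408976 / 2205) * e ^ 2) := by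
    linear_combination ((-712 / 35) * c ^ 2 + (-30988 / 105) * c + (36724 / 105)) * E80 + ((24) * c ^ 2 + (5868 / 35) * c + (-3244 / 105)) * E81 + ((-20 / 3) * c ^ 2 + (-1322 / 63) * c + (502 / 315)) * E82
  have R8 : ((280) * c ^ 4 * d + (-32550) * c ^ 5 + (-7992) * c ^ 3 * d + (-962055) * c ^ 4 + (-254106) * c ^ 2 * d + (-8513815) * c ^ 3 + (6714532) * c * d + (-21634870) * c ^ 2 + (-6317112) * c + (6399888) * d) = 0 := by
    have : e * (c - e) * c * c * (5 * c + 22) * ((280) * c ^ 4 * d + (-32550) * c ^ 5 + (-7992) * c ^ 3 * d + (-962055) * c ^ 4 + (-254106) * c ^ 2 * d + (-8513815) * c ^ 3 + (6714532) * c * d + (-21634870) * c ^ 2 + (-6317112) * c + (6399888) * d) = 0 := by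
      linear_combination (22050 / 11) * (((-10) * c ^ 6 + (-6205 / 21) * c ^ 5 + (-39271 / 15) * c ^ 4 + (-706096 / 105) * c ^ 3 + (2564 / 21) * c ^ 2 + (68816 / 35) * c) * c * ((1 / 2) * c ^ 2 + (11 / 5) * c) * T8 - ((-10) * c ^ 6 + (-6205 / 21) * c ^ 5 + (-39271 / 15) * c ^ 4 + (-706096 / 105) * c ^ 3 + (2564 / 21) * c ^ 2 + (68816 / 35) * c) * (3 / 7) * c * M2
        - ((-10) * c ^ 6 + (-6205 / 21) * c ^ 5 + (-39271 / 15) * c ^ 4 + (-706096 / 105) * c ^ 3 + (2564 / 21) * c ^ 2 + (68816 / 35) * c) * (-22 / 315) * ((1 / 2) * c ^ 2 + (11 / 5) * c) * M1 + c * ((1 / 2) * c ^ 2 + (11 / 5) * c) * (((50 / 3) * c + (110 / 63) * d) * X80 + ((-16) * c + (-332 / 35) * d) * X81 + ((-18) * c + (918 / 35) * d) * X82))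
    refine (mul_eq_zero.1 this).resolve_left ?_
    simp [*]
  -- Both relations are linear in `d`; this is their resultant.
  have h1 : c * (5 * c + 22) * (7 * c + 68) * (2 * c - 1) * (5 * c + 44) * ((c - 24) * (5 * c - 142)) = 0 := by
    linear_combination (1 / 26) * (((-2) * c ^ 2 + (110) * c + (-1496)) * R8 - ((280) * c ^ 4 + (-7992) * c ^ 3 + (-254106) * c ^ 2 + (6714532) * c + (6399888)) * R6)
  have h2 := (mul_eq_zero.1 h1).resolve_left (by simp [*])
  rcases mul_eq_zero.1 h2 with h3 | h3
  · obtain rfl : c = 24 := by linear_combination h3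
    exact Or.inl ⟨rfl, by linear_combination (-1 / 8) * R6⟩
  · obtain rfl : c = 142 / 5 := by linear_combination (1 / 5) * h3
    exact Or.inr ⟨rfl, by linear_combination (25 / 372) * R6⟩

/-! ### The possible central charges, weights and dimensions. -/

section

variable {V : Type*} [AddCommGroup V] [Module ℂ V] {A : VertexOperatorAlgebra V}
  {w₁ w₂ : V} {c₁ c₂ : ℂ} (h : A.IsCommutingVirasoroPair w₁ w₂ c₁ c₂)
  (hω : w₁ + w₂ = A.ω) (hc : c₁ + c₂ = A.c) {ι : Type*} [DecidableEq ι]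
  (D : VirasoroDecomposition A ι)
  (h₁ : c₁ ∉ ({-46 / 3, -68 / 7, -22 / 5, -3 / 5, 0} : Set ℂ)) (h₁' : c₁ ≠ 1 / 2)
include h hω

namespace VertexOperatorAlgebra.IsCommutingVirasoroPair

include D h₁ h₁' in
/-- The central charge avoids the zeros of the Kac determinants in degree at most eight of the
vacuum module. -/
theorem centralCharge_ne :
    A.c ≠ 0 ∧ 5 * A.c + 22 ≠ 0 ∧ 7 * A.c + 68 ≠ 0 ∧ 2 * A.c - 1 ≠ 0 := by
  simp only [Set.mem_insert_iff, Set.mem_singleton_iff, not_or] at h₁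
  obtain ⟨h1, h2, h3, h4, h5⟩ := h₁
  -- The conditions on `c₁` say that no factor of the determinant vanishes at `c₁`; hence none
  -- vanishes at the total central charge.
  have hne := h.det_pairingEight_ne_zero hω D (by
    rw [det_pairingEight]
    refine mul_ne_zero (by norm_num) (mul_ne_zero (mul_ne_zero (mul_ne_zero (mul_ne_zero
      (mul_ne_zero (pow_ne_zero _ h5) (pow_ne_zero _ ?_)) ?_) ?_) ?_) ?_)
    · exact fun h0 => h3 (by linear_combination (1 / 5) * h0)
    · exact fun h0 => h₁' (by linear_combination (1 / 2) * h0)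
    · exact fun h0 => h2 (by linear_combination (1 / 7) * h0)
    · exact fun h0 => h4 (by linear_combination (1 / 5) * h0)
    · exact fun h0 => h1 (by linear_combination (1 / 3) * h0))
  rw [det_pairingEight] at hne
  refine ⟨?_, ?_, ?_, ?_⟩ <;>
  · intro h0
    simp [h0] at hne

end VertexOperatorAlgebra.IsCommutingVirasoroPair

variable {D}
include hc h₁ h₁'

/-- If `V` contains a suitable pair of commuting Virasoro vectors, then the lowest degree part of a
module can be a conformal 8-design only if `c = 142 / 5` and the conformal weight is `11 / 5`. -/
theorem VOAModule.IsConformalDesign.centralCharge_eq {W : Type*} [AddCommGroup W] [Module ℂ W]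
    {M : VOAModule A W} {μ : ℂ} (hd : M.IsConformalDesign D 8 μ) (hM : M.HasConformalWeight μ)
    (hμ : μ ≠ 0) (h₂ : c₂ ≠ 0) (hA : A.c ≠ -44 / 5) :
    A.c = 142 / 5 ∧ μ = 11 / 5 := by
  obtain ⟨n0, n1, n2, n3⟩ := h.centralCharge_ne hω D h₁ h₁'
  have h0 : c₁ ≠ 0 := by
    rintro rfl
    simp at h₁
  have hN : (Module.finrank ℂ (M.homog μ) : ℂ) ≠ 0 := by
    have := M.finiteDimensional_homog μ
    have := Submodule.nontrivial_iff_ne_bot.2 hM.1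
    exact Nat.cast_ne_zero.2 Module.finrank_pos.ne'
  obtain ⟨u0, E20, T2⟩ := VOAModule.trace_quasiprimaryTwo h hω M hM hd
  obtain ⟨v0, E40, T4⟩ := VOAModule.trace_quasiprimaryFour h hω M hM hd
  obtain ⟨y0, y1, E60, E61, T6⟩ := VOAModule.trace_quasiprimarySixA h hω M hM hd
  obtain ⟨z0, z1, z2, E80, E81, E82, T8⟩ := VOAModule.trace_quasiprimaryEightA h hω M hM hd
  exact eq_of_lowest_weight_relations hN hμ h0 (by rwa [← hc, add_sub_cancel_left]) n0 n1 n2 n3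
    (fun h0 => hA (by linear_combination (1 / 5) * h0)) E20 T2 E40 T4 E60 E61 T6 E80 E81 E82 T8

/-- If `V` contains a suitable pair of commuting Virasoro vectors and `V_1 = 0`, the possible
central charges and dimensions of `V_2` for which `V_2` is a conformal 8-design. -/
theorem centralCharge_eq_of_isConformalDesign_two (hd : A.selfModule.IsConformalDesign D 8 2)
    (h1 : A.homog 1 = ⊥) (h₂ : c₂ ≠ 0) (hA : A.c ≠ -44 / 5) :
    A.c = 24 ∧ (Module.finrank ℂ (A.homog 2) : ℂ) = 196884 ∨
      A.c = 142 / 5 ∧ (Module.finrank ℂ (A.homog 2) : ℂ) = -164081 := by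
  obtain ⟨n0, n1, n2, n3⟩ := h.centralCharge_ne hω D h₁ h₁'
  have h0 : c₁ ≠ 0 := by
    rintro rfl
    simp at h₁
  obtain ⟨u0, E20, T2⟩ := VertexOperatorAlgebra.trace_two_quasiprimaryTwo h hω h0 n0 h1 hd
  obtain ⟨v0, E40, T4⟩ := VertexOperatorAlgebra.trace_two_quasiprimaryFour h hω h0 n0 h1 hd
  obtain ⟨y0, y1, E60, E61, T6⟩ :=
    VertexOperatorAlgebra.trace_two_quasiprimarySixA h hω h0 n0 h1 hd
  obtain ⟨z0, z1, z2, E80, E81, E82, T8⟩ :=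
    VertexOperatorAlgebra.trace_two_quasiprimaryEightA h hω h0 n0 h1 hd
  exact eq_of_degree_two_relations h0 (by rwa [← hc, add_sub_cancel_left]) n0 n1 n2 n3
    (fun h0 => hA (by linear_combination (1 / 5) * h0)) E20 T2 E40 T4 E60 E61 T6 E80 E81 E82 T8

end

theorem VertexOperatorAlgebra.IsCommutingVirasoroPair.symm {V : Type*} [AddCommGroup V] [Module ℂ V]
    {A : VertexOperatorAlgebra V} {w₁ w₂ : V} {c₁ c₂ : ℂ}
    (h : A.IsCommutingVirasoroPair w₁ w₂ c₁ c₂) : A.IsCommutingVirasoroPair w₂ w₁ c₂ c₁ :=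
  ⟨h.mem₂, h.mem₁, h.virasoro₂, h.virasoro₁, fun m n => (h.comm n m).symm⟩

end ConformalDesign

end

/-! ### The two propositions. -/

theorem proposition4p6
    {V : Type*} [AddCommGroup V] [Module ℂ V]
    (A : ConformalDesign.VertexOperatorAlgebra V)
    {ι : Type*} [DecidableEq ι] (D : ConformalDesign.VirasoroDecomposition A ι)
    (c e : ℂ) (hc : A.c = c) (ω' : V)
    (hω' : A.IsCommutingVirasoroPair ω' (A.ω - ω') e (c - e))
    (he : e ∉ ({-46 / 3, -68 / 7, -22 / 5, -3 / 5, 0} : Set ℂ))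
    (hce : c - e ∉ ({-46 / 3, -68 / 7, -22 / 5, -3 / 5, 0} : Set ℂ)) :
    -- modules whose lowest degree part is a conformal 8-design
    (c ∉ ({-31, -44 / 5, -184 / 105, 6 / 55, (-47 + 5 * (Real.sqrt 57 : ℂ)) / 4,
          (-47 - 5 * (Real.sqrt 57 : ℂ)) / 4, 1} : Set ℂ) →
      ∀ {W : Type*} [AddCommGroup W] [Module ℂ W] (M : ConformalDesign.VOAModule A W) (h : ℂ),
        M.HasConformalWeight h → h ≠ 0 → M.IsConformalDesign D 8 h →
        (e ≠ 1 / 2 → c - e ≠ 1 / 2 →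
          (c - 24 * h + 12) *
            (10 * c ^ 3 + (141 - 615 * h) * c ^ 2 + 2 * (5740 * h ^ 2 - 3321 * h + 171) * c
              - 24 * (2870 * h ^ 3 - 2870 * h ^ 2 + 451 * h + 15)) = 0) ∧
        ((e = 1 / 2 ∧ A.IsSimpleSubalgebra (A.generated {ω'}) ∨
            e = c - 1 / 2 ∧ A.IsSimpleSubalgebra (A.generated {A.ω - ω'})) →
          152700 * c ^ 6 + (3535420 - 2546820 * h) * c ^ 5
            + 2 * (5519040 * h ^ 2 - 33944388 * h + 10007663) * c ^ 4
            + (-66228480 * h ^ 3 + 505357184 * h ^ 2 - 303807330 * h + 24963561) * c ^ 3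
            + (-2634772224 * h ^ 3 + 409756928 * h ^ 2 + 611923251 * h - 162937170) * c ^ 2
            + 3 * (4450030592 * h ^ 3 - 4570094080 * h ^ 2 + 1282098891 * h - 49633193) * c
            + 18 * (120063488 * h ^ 3 - 120063488 * h ^ 2 + 34154597 * h - 1236817) = 0)) ∧
    -- the case that `V_1 = 0` and `V_2` is a conformal 8-design
    (c ∉ ({-31, -44 / 5, -184 / 105, 6 / 55, 36, (-47 + 5 * (Real.sqrt 57 : ℂ)) / 4,
          (-47 - 5 * (Real.sqrt 57 : ℂ)) / 4, 1} : Set ℂ) →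
      20 * c ^ 3 - 2178 * c ^ 2 + 65956 * c - 595056 ≠ 0 →
      A.homog 1 = ⊥ → A.selfModule.IsConformalDesign D 8 2 →
        (e ≠ 1 / 2 → c - e ≠ 1 / 2 →
          (Module.finrank ℂ (A.homog 2) : ℂ) =
            15 * c * (155 * c ^ 3 + 4133 * c ^ 2 + 32074 * c + 88392) /
              (20 * c ^ 3 - 2178 * c ^ 2 + 65956 * c - 595056)) ∧
        ((e = 1 / 2 ∧ A.IsSimpleSubalgebra (A.generated {ω'}) ∨
            e = c - 1 / 2 ∧ A.IsSimpleSubalgebra (A.generated {A.ω - ω'})) →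
          260520 * c ^ 5 - 7840184 * c ^ 4 - 72048858 * c ^ 3 + 5528559692 * c ^ 2
              - 75371626638 * c + 17347413996 ≠ 0 →
          (Module.finrank ℂ (A.homog 2) : ℂ) =
            -(15 * c * (5734920 * c ^ 5 + 59136716 * c ^ 4 + 283246086 * c ^ 3
                + 2858841411 * c ^ 2 + 7908127017 * c - 2179288566)) /
              (260520 * c ^ 5 - 7840184 * c ^ 4 - 72048858 * c ^ 3 + 5528559692 * c ^ 2
                - 75371626638 * c + 17347413996))) := by
  subst hc
  have hsum : ω' + (A.ω - ω') = A.ω := add_sub_cancel _ _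
  have hsum' : (A.ω - ω') + ω' = A.ω := sub_add_cancel _ _
  have he0 : e ≠ 0 := by
    rintro rfl
    simp at he
  have hce0 : A.c - e ≠ 0 := by
    intro h0
    simp [h0] at hce
  -- The two commuting Virasoro vectors play symmetric roles, so the argument can be run with
  -- whichever central charge differs from `1/2`.
  have low (hne : e ≠ 1 / 2 ∨ A.c - e ≠ 1 / 2) {W : Type _} [AddCommGroup W] [Module ℂ W]
      (M : ConformalDesign.VOAModule A W) (h : ℂ) (hM : M.HasConformalWeight h) (hh : h ≠ 0)
      (hd : M.IsConformalDesign D 8 h) (hA : A.c ≠ -44 / 5) : A.c = 142 / 5 ∧ h = 11 / 5 := by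
    rcases hne with hne | hne
    · exact hd.centralCharge_eq hω' hsum (add_sub_cancel _ _) he hne hM hh hce0 hA
    · exact hd.centralCharge_eq hω'.symm hsum' (sub_add_cancel _ _) hce hne hM hh he0 hA
  have two (hne : e ≠ 1 / 2 ∨ A.c - e ≠ 1 / 2) (h1 : A.homog 1 = ⊥)
      (hd : A.selfModule.IsConformalDesign D 8 2) (hA : A.c ≠ -44 / 5) :
      A.c = 24 ∧ (Module.finrank ℂ (A.homog 2) : ℂ) = 196884 ∨
        A.c = 142 / 5 ∧ (Module.finrank ℂ (A.homog 2) : ℂ) = -164081 := by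
    rcases hne with hne | hne
    · exact ConformalDesign.centralCharge_eq_of_isConformalDesign_two hω' hsum
        (add_sub_cancel _ _) he hne hd h1 hce0 hA
    · exact ConformalDesign.centralCharge_eq_of_isConformalDesign_two hω'.symm hsum'
        (sub_add_cancel _ _) hce hne hd h1 he0 hA
  have half (h1 : A.c ≠ 1) : e ≠ 1 / 2 ∨ A.c - e ≠ 1 / 2 := by
    by_contra! hcon
    exact h1 (by linear_combination hcon.1 + hcon.2)
  refine ⟨fun hc W _ _ M h hM hh hd => ?_, fun hc hG h1 hd => ?_⟩
  · simp only [Set.mem_insert_iff, Set.mem_singleton_iff, not_or] at hc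
    obtain ⟨-, hA, -, -, -, -, hA1⟩ := hc
    obtain ⟨hc', hh'⟩ := low (half hA1) M h hM hh hd hA
    -- At `c = 142/5`, `h = 11/5` the cubic factor in case (G) and the polynomial in case (H) both
    -- vanish.
    rw [hc', hh']
    norm_num
  · simp only [Set.mem_insert_iff, Set.mem_singleton_iff, not_or] at hc
    obtain ⟨-, hA, -, -, -, -, -, hA1⟩ := hc
    -- Both points satisfy both formulas for `d`, including the one with negative `d`.
    rcases two (half hA1) h1 hd hA with ⟨hc', hd'⟩ | ⟨hc', hd'⟩ <;>
    · rw [hd', hc']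
      norm_num
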